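/- Let $(\Omega,\mathcal F,Q)$ be a probability space with a filtration $\{\mathcal F_t\}_{t\ge 0}$, let $E$ be a measurable space with a $\sigma$-finite measure $\nu$, and let $\gamma,\lambda_Q:E\times[0,\infty)\to[0,\infty)$ be measurable. Under $Q$, let $N$ and $C$ be Poisson random measures on $E\times[0,\infty)$ with mean measures $\nu_0(du\times ds)=\gamma(u,s)\,\nu(du)\,ds$ and $\nu_1(du\times ds)=\lambda_Q(u,s)\,\nu(du)\,ds$ respectively (counting measures, finite on each set of some fixed countable measurable cover of $E\times[0,\infty)$), and let $D$ be a real-valued cadlag process, such that $N$ is independent of the pair $(C,D)$. Assume that $N$, $C$, $D$ are $\{\mathcal F_t\}$-adapted and that, for every $t\ge0$, the restriction of $N$ to $E\times(t,\infty)$ is independent of $\mathcal F_t$, and likewise for $C$. Let $\eta_t$ and $\eta_{t-}$ be the restrictions of $C$ to $E\times[0,t]$ and $E\times[0,t)$, write $C(A,t)=C(A\times[0,t])$, and let $\lambda(u,s,x,\eta)\ge 0$ be a jointly measurable real-valued function of $u\in E$, $s\ge0$, $x\in\mathbb R$ and a measure $\eta$ on $E\times[0,\infty)$, which vanishes whenever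 $\lambda_Q(u,s)=0$ (with $0/0:=0$ in the quotient below). Let $L$ be an $\{\mathcal F_t\}$-martingale under $Q$ such that, $Q$-almost surely, for all $t\ge 0$, $$L(t)=1+\int_{E\times[0,t]}\Big(\frac{\lambda(u,s,D_{s-},\eta_{s-})}{\lambda_Q(u,s)}-1\Big)L(s-)\,\big[C(du\times ds)-\lambda_Q(u,s)\,\nu(du)\,ds\big],$$ where the integrals with respect to $C$ and to $\lambda_Q\,\nu(du)\,ds$ converge absolutely. Let $P$ be a measure on $\mathcal F$ with $dP|_{\mathcal F_t}=L(t)\,dQ|_{\mathcal F_t}$ for every $t\ge0$. Then $P$ is a probability measure, and under $P$: (i) for every measurable $A\subset E$ such that, almost surely, $\int_{A\times[0,t]}\lambda(u,s,D_s,\eta_s)\,\nu(du)\,ds<\infty$ for all $t$, the process $C(A,t)$ is almost surely finite for all $t$ and $$C(A,t)-\int_{A\times[0,t]}\lambda(u,s,D_s,\eta_s)\,\nu(du)\,ds$$ is an $\{\mathcal F_t\}$-local martingale; (ii) $N$ is independent of $C$ and is a Poisson random measure with mean measure $\nu_0$. -/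

import Mathlib

open MeasureTheory ProbabilityTheory Filter Topology Set
open scoped NNReal ENNReal

/-- `X` is a counting process on `S`: a measurable map into the space of measures on `S` (with the
σ-algebra generated by the evaluations `m ↦ m B`), all of whose realizations are counting measures
(values in `{0, 1, 2, …, ∞}`) that are finite on each set of one fixed countable measurable
cover of `S`. -/
structure IsPointProcess {Ω S : Type*} [MeasurableSpace Ω] [MeasurableSpace S]
    (X : Ω → Measure S) : Prop where
  measurable : Measurable X
  counting : ∀ ω B, MeasurableSet B → ∃ n : ℕ∞, X ω B = (n : ℝ≥0∞)
  locally_finite : ∃ K : ℕ → Set S, (∀ n, MeasurableSet (K n)) ∧ (⋃ n, K n) = univ ∧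
    ∀ n ω, X ω (K n) < ∞

/-- `X` is, under `P`, a Poisson random measure with mean measure `μ`. -/
structure IsPoissonRandomMeasure {Ω S : Type*} [MeasurableSpace Ω] [MeasurableSpace S]
    (X : Ω → Measure S) (μ : Measure S) (P : Measure Ω) : Prop extends IsPointProcess X where
  law : ∀ B, MeasurableSet B → μ B ≠ ∞ →
    P.map (fun ω => X ω B) = (poissonMeasure (μ B).toNNReal).map (fun k : ℕ => (k : ℝ≥0∞))
  indep : ∀ (n : ℕ) (B : Fin n → Set S), (∀ i, MeasurableSet (B i)) →
    (∀ i j, i ≠ j → Disjoint (B i) (B j)) → iIndepFun (fun i ω => X ω (B i)) P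

/-- Compatibility of a random measure on `E × [0, ∞)` with a filtration: `X` is adapted (its
restriction to `E × [0, t]` is `ℱ t`-measurable) and its increments after time `t` (its restriction
to `E × (t, ∞)`) are independent of `ℱ t`. -/
structure IsCompatible {Ω E : Type*} {mΩ : MeasurableSpace Ω} [MeasurableSpace E]
    (X : Ω → Measure (E × ℝ≥0)) (ℱ : Filtration ℝ≥0 mΩ) (P : Measure Ω) : Prop where
  adapted : ∀ t, Measurable[ℱ t] (fun ω => (X ω).restrict (univ ×ˢ Iic t))
  indep : ∀ t, Indep
    (MeasurableSpace.comap (fun ω => (X ω).restrict (univ ×ˢ Ioi t)) inferInstance) (ℱ t) P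

/-- Right-continuous with left limits. -/
def IsCadlagPath (f : ℝ≥0 → ℝ) : Prop :=
  ∀ t, ContinuousWithinAt f (Ici t) t ∧ ∃ l, Tendsto f (𝓝[<] t) (𝓝 l)

/-- Lebesgue measure on the time axis `[0, ∞)`. -/
noncomputable def timeMeasure : Measure ℝ≥0 :=
  (volume : Measure ℝ).comap (fun s : ℝ≥0 => (s : ℝ))

/-- The measure `g(u, s) ν(du) ds` on `E × [0, ∞)`. -/
noncomputable def meanMeasure {E : Type*} [MeasurableSpace E] (ν : Measure E)
    (g : E → ℝ≥0 → ℝ≥0) : Measure (E × ℝ≥0) :=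
  (ν.prod timeMeasure).withDensity (fun z => (g z.1 z.2 : ℝ≥0∞))

/-- The configuration `η_s` of the points of `c` up to and including time `s`. -/
noncomputable def config {E : Type*} [MeasurableSpace E] (c : Measure (E × ℝ≥0)) (s : ℝ≥0) :
    Measure (E × ℝ≥0) :=
  c.restrict (univ ×ˢ Iic s)

/-- The configuration `η_{s-}` of the points of `c` strictly before time `s`. -/
noncomputable def configLeft {E : Type*} [MeasurableSpace E] (c : Measure (E × ℝ≥0)) (s : ℝ≥0) :
    Measure (E × ℝ≥0) :=
  c.restrict (univ ×ˢ Iio s)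

/-- The integrand `(λ(u, s, D_{s-}, η_{s-}) / λ_Q(u, s) - 1) L(s-)`, as a function of `z = (u, s)`,
for given paths `c` of `C`, `d` of `D` and `l` of `L`. -/
noncomputable def likelihoodIntegrand {E : Type*} [MeasurableSpace E]
    (lam : E → ℝ≥0 → ℝ → Measure (E × ℝ≥0) → ℝ≥0) (lamQ : E → ℝ≥0 → ℝ≥0)
    (c : Measure (E × ℝ≥0)) (d l : ℝ≥0 → ℝ) (z : E × ℝ≥0) : ℝ :=
  ((lam z.1 z.2 (Function.leftLim d z.2) (configLeft c z.2) : ℝ) / (lamQ z.1 z.2 : ℝ) - 1)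
    * Function.leftLim l z.2

/-- `L` solves the stochastic integral equation
`L(t) = 1 + ∫_{E × [0,t]} (λ(u,s,D_{s-},η_{s-}) / λ_Q(u,s) - 1) L(s-) [C(du × ds) - λ_Q(u,s) ν(du) ds]`
for all `t ≥ 0`, almost surely, both integrals being absolutely convergent. -/
def SolvesLikelihoodEquation {Ω E : Type*} [MeasurableSpace Ω] [MeasurableSpace E]
    (ν : Measure E) (lam : E → ℝ≥0 → ℝ → Measure (E × ℝ≥0) → ℝ≥0) (lamQ : E → ℝ≥0 → ℝ≥0)
    (C : Ω → Measure (E × ℝ≥0)) (D L : ℝ≥0 → Ω → ℝ) (Q : Measure Ω) : Prop :=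
  ∀ᵐ ω ∂Q, ∀ t : ℝ≥0,
    IntegrableOn (likelihoodIntegrand lam lamQ (C ω) (fun s => D s ω) (fun s => L s ω))
      (univ ×ˢ Iic t) (C ω) ∧
    IntegrableOn (likelihoodIntegrand lam lamQ (C ω) (fun s => D s ω) (fun s => L s ω))
      (univ ×ˢ Iic t) (meanMeasure ν lamQ) ∧
    L t ω = 1 +
      ((∫ z in univ ×ˢ Iic t,
          likelihoodIntegrand lam lamQ (C ω) (fun s => D s ω) (fun s => L s ω) z ∂(C ω)) -
        ∫ z in univ ×ˢ Iic t,
          likelihoodIntegrand lam lamQ (C ω) (fun s => D s ω) (fun s => L s ω) z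
            ∂(meanMeasure ν lamQ))

/-- `∫_{A × [0,t]} λ(u, s, D_s, η_s) ν(du) ds`, in `[0, ∞]`, for given paths `c` of `C` and
`d` of `D`. -/
noncomputable def cumulativeIntensity {E : Type*} [MeasurableSpace E] (ν : Measure E)
    (lam : E → ℝ≥0 → ℝ → Measure (E × ℝ≥0) → ℝ≥0)
    (c : Measure (E × ℝ≥0)) (d : ℝ≥0 → ℝ) (A : Set E) (t : ℝ≥0) : ℝ≥0∞ :=
  ∫⁻ z in A ×ˢ Iic t, (lam z.1 z.2 (d z.2) (config c z.2) : ℝ≥0∞) ∂(ν.prod timeMeasure)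

/-- `X` is a local martingale with respect to `ℱ` and `P`. -/
def IsLocalMartingale {Ω : Type*} {mΩ : MeasurableSpace Ω} (X : ℝ≥0 → Ω → ℝ)
    (ℱ : Filtration ℝ≥0 mΩ) (P : Measure Ω) : Prop :=
  Locally (fun Y => Martingale Y ℱ P) ℱ X P

/-! ### Locally finite random measures as kernels -/

/-! The proof is a Girsanov-type change of measure. Almost surely `C` has no point at time `0`, so
`L(0) = 1` and `P` has mass `1`. Write `ρ = λ/λ_Q`.

Compensator. Under `Q`, `lintegral_compensation` equates the expected integrals of a predictable
integrand against `C` and against its mean measure. Let `G` be a predictable set before time `t`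
that contains boundedly many points of `C`. Weighting the points in each dyadic time cell by `L` at
the right end of the cell and integrating over `Q` gives exactly `E_P C(G)`. As the mesh shrinks,
right continuity turns the weight into `L(s)` at the point itself. There the equation reads `L(s) =
ρ L(s-)`, because `C` has at most one point at each time. So `E_P C(G) = E_Q ∫_G ρ L(s-) dC`
(`lintegral_section_eq`). Compensation under `Q` turns this into `E_Q ∫_G λ L(s-) ν(du) ds`. At a
fixed time `L(s-) = L(s)` almost surely, so Fubini leads back to `E_P ∫_G λ ν(du) ds`
(`lintegral_section_eq_intensity`). A countable predictable cover extends this to all predictable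
integrands (`lintegral_compensation_left`). Stopping when the cumulative intensity reaches a level
makes everything integrable and yields (i).

Independence. It suffices that `L(t)` is almost surely a function of `(C, D)`: under `Q` it is then
independent of `N`, so weighting by it neither changes the law of `N` nor ties `N` to `C`. Where
`L(t) ≠ 0`, a maximal inequality keeps `L` away from `0` on `[0, t]`, so the integrability of `(ρ -
1) L(s-)` passes to `ρ - 1`. The linear equation is then solved by Picard iteration at a factorial
rate. Where `ρ - 1` is not integrable, `L(t) = 0` (`exists_measurable_ae_eq_density`). Since `P` has
a known density only on each `ℱ t`, the product form of the law of `(N, C)` is checked on bounded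
time windows, which give a generating π-system. -/

theorem isSFiniteKernel_of_forall_isFiniteMeasure {α β : Type*} [MeasurableSpace α]
    [MeasurableSpace β] (κ : Kernel α β) (h : ∀ a, κ a univ < ∞) : IsSFiniteKernel κ := by
  classical
  -- The integer part of the total mass cuts `α` into countably many measurable pieces, on each of
  -- which `κ` is a finite kernel.
  have hm : Measurable fun a => ⌊(κ a univ).toNNReal⌋₊ :=
    Nat.measurable_floor.comp (κ.measurable_coe MeasurableSet.univ).ennreal_toNNReal
  have hA : ∀ m : ℕ, MeasurableSet {a | ⌊(κ a univ).toNNReal⌋₊ = m} := fun m =>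
    hm (measurableSet_singleton m)
  have hfin : ∀ m : ℕ, IsFiniteKernel (Kernel.piecewise (hA m) κ 0) := by
    refine fun m => ⟨⟨(m : ℝ≥0∞) + 1, by finiteness, fun a => ?_⟩⟩
    rw [Kernel.piecewise_apply]
    split_ifs with ha
    · have h1 := Nat.lt_floor_add_one (κ a univ).toNNReal
      simp only [mem_ofPred_eq] at ha
      rw [ha] at h1
      rw [← ENNReal.coe_toNNReal (h a).ne]
      exact_mod_cast h1.le
    · simp
  have hsum : κ = Kernel.sum (fun m => Kernel.piecewise (hA m) κ 0) := by
    ext a s hs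
    rw [Kernel.sum_apply' _ _ hs, tsum_eq_single ⌊(κ a univ).toNNReal⌋₊]
    · simp [Kernel.piecewise_apply]
    · intro m hm
      rw [Kernel.piecewise_apply, if_neg]
      · simp
      · exact fun h => hm h.symm
  rw [hsum]
  exact Kernel.isSFiniteKernel_sum

/-- All realizations of `X` are finite on each set of one countable measurable cover. -/
def HasFiniteCover {Ω S : Type*} [MeasurableSpace S] (X : Ω → Measure S) : Prop :=
  ∃ K : ℕ → Set S, (∀ n, MeasurableSet (K n)) ∧ (⋃ n, K n) = univ ∧ ∀ n ω, X ω (K n) < ∞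

namespace HasFiniteCover

variable {Ω S : Type*} [MeasurableSpace S] {X : Ω → Measure S}

theorem restrict (h : HasFiniteCover X) (B : Set S) :
    HasFiniteCover fun ω => (X ω).restrict B := by
  obtain ⟨K, hK, hU, hf⟩ := h
  exact ⟨K, hK, hU, fun n ω => (Measure.restrict_apply_le _ _).trans_lt (hf n ω)⟩

theorem sigmaFinite (h : HasFiniteCover X) (ω : Ω) : SigmaFinite (X ω) := by
  obtain ⟨K, hK, hU, hf⟩ := h
  exact ⟨⟨⟨K, fun _ => trivial, fun n => hf n ω, hU⟩⟩⟩

/-- Disjointing the cover writes the kernel as a sum of kernels of finite, though not uniformly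
bounded, mass. S-finiteness is what makes integrals against `X ω` measurable in `ω` and gives `Q ⊗ₘ
κ` its Fubini theorem. -/
theorem isSFiniteKernel {mΩ : MeasurableSpace Ω} (h : HasFiniteCover X) (hX : Measurable X) :
    IsSFiniteKernel (⟨X, hX⟩ : Kernel Ω S) := by
  obtain ⟨K, hK, hU, hf⟩ := h
  set κ : Kernel Ω S := ⟨X, hX⟩ with hκ
  have hD := fun n => MeasurableSet.disjointed hK n
  have hsum : κ = Kernel.sum fun n => κ.restrict (hD n) := by
    ext ω s hs
    rw [Kernel.sum_apply' _ _ hs]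
    simp only [Kernel.restrict_apply]
    rw [← Measure.sum_apply _ hs, ← Measure.restrict_iUnion (disjoint_disjointed _) hD,
      iUnion_disjointed, hU, Measure.restrict_univ]
  rw [hsum]
  have : ∀ n, IsSFiniteKernel (κ.restrict (hD n)) := fun n =>
      isSFiniteKernel_of_forall_isFiniteMeasure _ fun ω => by
    rw [Kernel.restrict_apply, Measure.restrict_apply_univ]
    exact (measure_mono (disjointed_subset _ _)).trans_lt (hf n ω)
  exact Kernel.isSFiniteKernel_sum

theorem measurable_lintegral {mΩ : MeasurableSpace Ω} (h : HasFiniteCover X) (hX : Measurable X)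
    {f : Ω × S → ℝ≥0∞} (hf : Measurable f) : Measurable fun ω => ∫⁻ z, f (ω, z) ∂X ω := by
  have := h.isSFiniteKernel hX
  exact hf.lintegral_kernel_prod_right' (κ := ⟨X, hX⟩)

theorem measurable_integral {mΩ : MeasurableSpace Ω} (h : HasFiniteCover X) (hX : Measurable X)
    {f : Ω × S → ℝ} (hf : Measurable f) : Measurable fun ω => ∫ z, f (ω, z) ∂X ω := by
  have := h.isSFiniteKernel hX
  exact (hf.stronglyMeasurable.integral_kernel_prod_right' (κ := ⟨X, hX⟩)).measurable

end HasFiniteCover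

theorem IsPointProcess.hasFiniteCover {Ω S : Type*} [MeasurableSpace Ω] [MeasurableSpace S]
    {X : Ω → Measure S} (h : IsPointProcess X) : HasFiniteCover X := h.locally_finite

theorem Measurable.restrict_measure {Ω S : Type*} [MeasurableSpace Ω] [MeasurableSpace S]
    {X : Ω → Measure S} (hX : Measurable X) {B : Set S} (hB : MeasurableSet B) :
    Measurable fun ω => (X ω).restrict B := by
  refine Measure.measurable_of_measurable_coe _ fun s hs => ?_
  simp_rw [Measure.restrict_apply hs]
  exact (Measure.measurable_coe (hs.inter hB)).comp hX

/-! ### Dyadic grids -/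

/-- The last point of the dyadic grid of level `k` strictly before `s` (or `0`). -/
noncomputable def prevGrid (k : ℕ) (s : ℝ≥0) : ℝ≥0 := ((⌈s * 2 ^ k⌉₊ - 1 : ℕ) : ℝ≥0) / 2 ^ k

/-- The first point of the dyadic grid of level `k` at or after `s`. -/
noncomputable def nextGrid (k : ℕ) (s : ℝ≥0) : ℝ≥0 := (⌈s * 2 ^ k⌉₊ : ℝ≥0) / 2 ^ k

theorem prevGrid_lt (k : ℕ) {s : ℝ≥0} (hs : 0 < s) : prevGrid k s < s := by
  have h2 : (0 : ℝ≥0) < 2 ^ k := by positivity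
  rw [prevGrid, div_lt_iff₀ h2]
  have h0 : 0 < ⌈s * 2 ^ k⌉₊ := Nat.ceil_pos.2 (by positivity)
  exact Nat.lt_ceil.1 (by omega)

theorem prevGrid_zero (k : ℕ) : prevGrid k 0 = 0 := by simp [prevGrid]

theorem le_nextGrid (k : ℕ) (s : ℝ≥0) : s ≤ nextGrid k s := by
  have h2 : (0 : ℝ≥0) < 2 ^ k := by positivity
  rw [nextGrid, le_div_iff₀ h2]
  exact Nat.le_ceil _

theorem nextGrid_le (k : ℕ) (s : ℝ≥0) : nextGrid k s ≤ s + 1 / 2 ^ k := by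
  have h2 : (0 : ℝ≥0) < 2 ^ k := by positivity
  rw [nextGrid, div_le_iff₀ h2, add_mul, one_div_mul_cancel h2.ne']
  exact (Nat.ceil_lt_add_one (by positivity)).le

theorem le_prevGrid_add (k : ℕ) (s : ℝ≥0) : s ≤ prevGrid k s + 1 / 2 ^ k := by
  have h2 : (0 : ℝ≥0) < 2 ^ k := by positivity
  rw [prevGrid, ← add_div, le_div_iff₀ h2]
  refine (Nat.le_ceil _).trans ?_
  exact_mod_cast (by omega : ⌈s * 2 ^ k⌉₊ ≤ ⌈s * 2 ^ k⌉₊ - 1 + 1)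

theorem tendsto_one_div_two_pow : Tendsto (fun k : ℕ => (1 : ℝ≥0) / 2 ^ k) atTop (𝓝 0) := by
  have := NNReal.tendsto_pow_atTop_nhds_zero_of_lt_one (r := 1 / 2)
    (by rw [← NNReal.coe_lt_coe]; norm_num)
  simpa using this

theorem tendsto_nextGrid (s : ℝ≥0) : Tendsto (fun k => nextGrid k s) atTop (𝓝 s) := by
  refine tendsto_of_tendsto_of_tendsto_of_le_of_le tendsto_const_nhds ?_
    (fun k => le_nextGrid k s) (fun k => nextGrid_le k s)
  simpa using tendsto_const_nhds.add tendsto_one_div_two_pow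

theorem tendsto_prevGrid (s : ℝ≥0) : Tendsto (fun k => prevGrid k s) atTop (𝓝 s) := by
  rcases eq_or_ne s 0 with rfl | hs
  · simp [prevGrid_zero]
  refine tendsto_of_tendsto_of_tendsto_of_le_of_le ?_ tendsto_const_nhds
    (fun k => tsub_le_iff_right.2 (le_prevGrid_add k s))
    (fun k => (prevGrid_lt k (pos_iff_ne_zero.2 hs)).le)
  simpa using tendsto_const_nhds.sub tendsto_one_div_two_pow (a := s)

theorem tendsto_prevGrid_nhdsLT {s : ℝ≥0} (hs : 0 < s) :
    Tendsto (fun k => prevGrid k s) atTop (𝓝[<] s) :=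
  tendsto_nhdsWithin_iff.2 ⟨tendsto_prevGrid s, Eventually.of_forall fun k => prevGrid_lt k hs⟩

/-- There is nothing to the left of `0`, and `Function.leftLim` then returns the value itself. -/
theorem leftLim_zero_nnreal (f : ℝ≥0 → ℝ) : Function.leftLim f 0 = f 0 :=
  leftLim_eq_of_isBot fun _ => zero_le

theorem IsCadlagPath.tendsto_leftLim {f : ℝ≥0 → ℝ} (hf : IsCadlagPath f) (s : ℝ≥0) :
    Tendsto f (𝓝[<] s) (𝓝 (Function.leftLim f s)) :=
  tendsto_leftLim_of_tendsto (hf s).2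

theorem IsCadlagPath.tendsto_prevGrid {f : ℝ≥0 → ℝ} (hf : IsCadlagPath f) (s : ℝ≥0) :
    Tendsto (fun k => f (prevGrid k s)) atTop (𝓝 (Function.leftLim f s)) := by
  rcases eq_or_ne s 0 with rfl | hs
  · simp [prevGrid_zero, leftLim_zero_nnreal]
  · exact (hf.tendsto_leftLim s).comp (tendsto_prevGrid_nhdsLT (pos_iff_ne_zero.2 hs))

/-! ### The time axis -/

theorem timeMeasure_apply (B : Set ℝ≥0) :
    timeMeasure B = volume ((fun s : ℝ≥0 => (s : ℝ)) '' B) :=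
  (MeasurableEmbedding.subtype_coe measurableSet_Ici).comap_apply _ _

instance : SigmaFinite timeMeasure := by
  refine ⟨⟨⟨fun n => Iic (n : ℝ≥0), fun _ => trivial, fun n => ?_, ?_⟩⟩⟩
  · rw [timeMeasure_apply]
    refine (measure_mono (t := Icc (0 : ℝ) n) ?_).trans_lt measure_Icc_lt_top
    rintro _ ⟨s, hs, rfl⟩
    exact ⟨s.2, by exact_mod_cast hs⟩
  · refine eq_univ_of_forall fun s => mem_iUnion.2 ?_
    obtain ⟨n, hn⟩ := exists_nat_ge s
    exact ⟨n, hn⟩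

instance : NullSingletonClass timeMeasure :=
  ⟨fun s => by rw [timeMeasure_apply]; simp⟩
-- Grids refine: a level `k` grid point below `s` is also a level `k + 1` grid point below `s`, so
-- the last such point can only move right.
theorem monotone_prevGrid (s : ℝ≥0) : Monotone fun k => prevGrid k s := by
  refine monotone_nat_of_le_succ fun k => ?_
  have h2 : (0 : ℝ≥0) < 2 ^ k := by positivity
  rcases eq_or_ne s 0 with rfl | hs
  · simp [prevGrid_zero]
  have h := prevGrid_lt k (pos_iff_ne_zero.2 hs)
  have hlt : (((⌈s * 2 ^ k⌉₊ - 1) * 2 : ℕ) : ℝ≥0) < s * 2 ^ (k + 1) := by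
    rw [prevGrid, div_lt_iff₀ h2] at h
    rw [pow_succ, ← mul_assoc, Nat.cast_mul]
    exact mul_lt_mul_of_pos_right h two_pos
  have := Nat.lt_ceil.2 hlt
  change ((⌈s * 2 ^ k⌉₊ - 1 : ℕ) : ℝ≥0) / 2 ^ k ≤ ((⌈s * 2 ^ (k + 1)⌉₊ - 1 : ℕ) : ℝ≥0) / 2 ^ (k + 1)
  have hle : (⌈s * 2 ^ k⌉₊ - 1) * 2 ≤ ⌈s * 2 ^ (k + 1)⌉₊ - 1 := Nat.le_sub_one_of_lt this
  rw [div_le_div_iff₀ h2 (by positivity)]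
  calc ((⌈s * 2 ^ k⌉₊ - 1 : ℕ) : ℝ≥0) * 2 ^ (k + 1)
      = (((⌈s * 2 ^ k⌉₊ - 1) * 2 : ℕ) : ℝ≥0) * 2 ^ k := by rw [Nat.cast_mul, pow_succ]; push_cast; ring
    _ ≤ _ := by gcongr

/-! ### The predictable σ-algebra on `Ω × E × [0, ∞)` -/

section Predictable

variable {Ω E : Type*} {mΩ : MeasurableSpace Ω} [MeasurableSpace E]

/-- The predictable rectangles. -/
def predictableRectangles (E : Type*) [MeasurableSpace E] (ℱ : Filtration ℝ≥0 mΩ) :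
    Set (Set (Ω × E × ℝ≥0)) :=
  {G | ∃ (s : ℝ≥0) (F : Set Ω) (U : Set (E × ℝ≥0)), MeasurableSet[ℱ s] F ∧ MeasurableSet U ∧
    (s = 0 ∨ U ⊆ {z | s < z.2}) ∧ G = F ×ˢ U}

/-- The predictable σ-algebra on `Ω × E × [0, ∞)`. -/
@[reducible] def predictable (E : Type*) [MeasurableSpace E] (ℱ : Filtration ℝ≥0 mΩ) :
    MeasurableSpace (Ω × E × ℝ≥0) :=
  MeasurableSpace.generateFrom (predictableRectangles E ℱ)

theorem isPiSystem_predictableRectangles (ℱ : Filtration ℝ≥0 mΩ) :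
    IsPiSystem (predictableRectangles E ℱ) := by
  have key : ∀ {s s' : ℝ≥0} {F F' : Set Ω} {U U' : Set (E × ℝ≥0)}, s ≤ s' → MeasurableSet[ℱ s] F →
      MeasurableSet[ℱ s'] F' → MeasurableSet U → MeasurableSet U' → (s' = 0 ∨ U' ⊆ {z | s' < z.2}) →
      (F ×ˢ U) ∩ (F' ×ˢ U') ∈ predictableRectangles E ℱ := by
    intro s s' F F' U U' hs hF hF' hU hU' h
    refine ⟨s', F ∩ F', U ∩ U', (ℱ.mono hs _ hF).inter hF', hU.inter hU',
      h.imp id fun h => inter_subset_right.trans h, prod_inter_prod⟩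
  rintro _ ⟨s, F, U, hF, hU, h, rfl⟩ _ ⟨s', F', U', hF', hU', h', rfl⟩ -
  rcases le_total s s' with hs | hs
  · exact key hs hF hF' hU hU' h'
  · rw [inter_comm]
    exact key hs hF' hF hU' hU h

theorem predictable_le (ℱ : Filtration ℝ≥0 mΩ) :
    predictable E ℱ ≤ mΩ.prod inferInstance := by
  refine MeasurableSpace.generateFrom_le ?_
  rintro _ ⟨s, F, U, hF, hU, -, rfl⟩
  exact (ℱ.le s _ hF).prod hU

theorem measurableSet_predictable_prod {ℱ : Filtration ℝ≥0 mΩ} {s : ℝ≥0} {F : Set Ω}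
    (hF : MeasurableSet[ℱ s] F) {U : Set (E × ℝ≥0)} (hU : MeasurableSet U)
    (h : U ⊆ {z | s < z.2}) : MeasurableSet[predictable E ℱ] (F ×ˢ U) :=
  MeasurableSpace.measurableSet_generateFrom ⟨s, F, U, hF, hU, Or.inr h, rfl⟩

theorem measurableSet_predictable_prod_zero {ℱ : Filtration ℝ≥0 mΩ} {F : Set Ω}
    (hF : MeasurableSet[ℱ 0] F) {U : Set (E × ℝ≥0)} (hU : MeasurableSet U) :
    MeasurableSet[predictable E ℱ] (F ×ˢ U) :=
  MeasurableSpace.measurableSet_generateFrom ⟨0, F, U, hF, hU, Or.inl rfl, rfl⟩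

theorem measurable_predictable_snd (ℱ : Filtration ℝ≥0 mΩ) :
    Measurable[predictable E ℱ] (Prod.snd : Ω × E × ℝ≥0 → E × ℝ≥0) := by
  intro U hU
  have : (Prod.snd : Ω × E × ℝ≥0 → E × ℝ≥0) ⁻¹' U = univ ×ˢ U := by ext; simp
  rw [this]
  exact measurableSet_predictable_prod_zero MeasurableSet.univ hU

/-- A predictable set restricted to `[0, t]` is `ℱ t ⊗ 𝓑`-measurable. -/
theorem measurableSet_predictable_inter {ℱ : Filtration ℝ≥0 mΩ} {G : Set (Ω × E × ℝ≥0)}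
    (hG : MeasurableSet[predictable E ℱ] G) (t : ℝ≥0) :
    MeasurableSet[(ℱ t).prod inferInstance] (G ∩ {x | x.2.2 ≤ t}) := by
  let : MeasurableSpace Ω := ℱ t
  have hT : MeasurableSet {x : Ω × E × ℝ≥0 | x.2.2 ≤ t} :=
    measurableSet_le measurable_snd.snd measurable_const
  refine MeasurableSpace.generateFrom_induction
    (C := predictableRectangles E ℱ) (p := fun G _ => MeasurableSet (G ∩ {x | x.2.2 ≤ t}))
    ?_ ?_ ?_ ?_ G hG
  · rintro _ ⟨s, F, U, hF, hU, h, rfl⟩ -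
    by_cases hs : s ≤ t
    · exact (MeasurableSet.prod (ℱ.mono hs _ hF) hU).inter hT
    · convert MeasurableSet.empty
      rcases h with rfl | h
      · simp at hs
      · refine eq_empty_of_forall_notMem ?_
        rintro ⟨ω, z⟩ ⟨⟨-, hz⟩, hzt⟩
        exact hs ((h hz).le.trans hzt)
  · simp
  · intro G _ hG
    have : Gᶜ ∩ {x : Ω × E × ℝ≥0 | x.2.2 ≤ t} = {x | x.2.2 ≤ t} \ (G ∩ {x | x.2.2 ≤ t}) := by
      ext; simp; tauto
    rw [this]
    exact hT.diff hG
  · intro f _ hf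
    rw [iUnion_inter]
    exact MeasurableSet.iUnion hf

theorem measurable_predictable_indicator {ℱ : Filtration ℝ≥0 mΩ} {β : Type*} [MeasurableSpace β]
    [Zero β] {f : Ω × E × ℝ≥0 → β} (hf : Measurable[predictable E ℱ] f) (t : ℝ≥0) :
    Measurable[(ℱ t).prod inferInstance] ({x : Ω × E × ℝ≥0 | x.2.2 ≤ t}.indicator f) := by
  let : MeasurableSpace Ω := ℱ t
  have hT : MeasurableSet {x : Ω × E × ℝ≥0 | x.2.2 ≤ t} :=
    measurableSet_le measurable_snd.snd measurable_const
  intro B hB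
  rw [indicator_preimage]
  refine (measurableSet_predictable_inter (hf hB) t).union ?_
  exact (measurable_const hB).diff hT

/-- The section of a predictable function at `z` is measurable with respect to `ℱ z.2`. -/
theorem measurable_predictable_section {ℱ : Filtration ℝ≥0 mΩ} {β : Type*} [MeasurableSpace β]
    [Zero β] {f : Ω × E × ℝ≥0 → β} (hf : Measurable[predictable E ℱ] f) (z : E × ℝ≥0) :
    Measurable[ℱ z.2] fun ω => f (ω, z) := by
  have h := measurable_predictable_indicator hf z.2
  let : MeasurableSpace Ω := ℱ z.2
  have h2 : Measurable fun ω : Ω => ((ω, z) : Ω × E × ℝ≥0) := measurable_prodMk_right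
  convert h.comp h2 using 1
  ext ω
  simp

/-- Adaptedness of the integral of a predictable function against an adapted random measure. -/
theorem measurable_setLIntegral_predictable {ℱ : Filtration ℝ≥0 mΩ} {X : Ω → Measure (E × ℝ≥0)}
    (hX : HasFiniteCover X)
    (hXa : ∀ t, Measurable[ℱ t] fun ω => (X ω).restrict (univ ×ˢ Iic t))
    {f : Ω × E × ℝ≥0 → ℝ≥0∞} (hf : Measurable[predictable E ℱ] f) (t : ℝ≥0) :
    Measurable[ℱ t] fun ω => ∫⁻ z in univ ×ˢ Iic t, f (ω, z) ∂X ω := by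
  have h := measurable_predictable_indicator hf t
  let : MeasurableSpace Ω := ℱ t
  convert (hX.restrict (univ ×ˢ Iic t)).measurable_lintegral (hXa t) h using 2 with ω
  refine setLIntegral_congr_fun (MeasurableSet.univ.prod measurableSet_Iic) fun z hz => ?_
  simp only [mem_prod, mem_univ, mem_Iic, true_and] at hz
  simp [hz]

/-- The process frozen at the last grid point is constant in time on each dyadic cell and is already
known at the left end of the cell. Cell `0` also contains time `0`, which is why rectangles over `ℱ
0` may include it. -/
theorem measurable_prevGrid_predictable {ℱ : Filtration ℝ≥0 mΩ} {β : Type*} [MeasurableSpace β]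
    {Y : ℝ≥0 → Ω → β} (hY : ∀ t, Measurable[ℱ t] (Y t)) (k : ℕ) :
    Measurable[predictable E ℱ] fun x : Ω × E × ℝ≥0 => Y (prevGrid k x.2.2) x.1 := by
  intro B hB
  have hn : ∀ n : ℕ, MeasurableSet {z : E × ℝ≥0 | ⌈z.2 * 2 ^ k⌉₊ - 1 = n} := fun n =>
    ((measurable_from_top (f := fun n : ℕ => n - 1)).comp
      (Nat.measurable_ceil.comp (measurable_snd.mul_const _))) (measurableSet_singleton n)
  have heq : (fun x : Ω × E × ℝ≥0 => Y (prevGrid k x.2.2) x.1) ⁻¹' B =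
      ⋃ n : ℕ, (Y ((n : ℝ≥0) / 2 ^ k) ⁻¹' B) ×ˢ {z : E × ℝ≥0 | ⌈z.2 * 2 ^ k⌉₊ - 1 = n} := by
    ext x
    simp [prevGrid]
  rw [heq]
  refine MeasurableSet.iUnion fun n => ?_
  rcases Nat.eq_zero_or_pos n with rfl | hpos
  · refine measurableSet_predictable_prod_zero ?_ (hn 0)
    simpa using hY 0 hB
  · refine measurableSet_predictable_prod (hY _ hB) (hn n) fun z hz => ?_
    have hz' : ⌈z.2 * 2 ^ k⌉₊ - 1 = n := hz
    have hz0 : 0 < z.2 := by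
      rcases eq_or_ne z.2 0 with h | h
      · simp [h] at hz'; omega
      · exact pos_iff_ne_zero.2 h
    have := prevGrid_lt k hz0
    rwa [prevGrid, hz'] at this

theorem measurable_leftLim_predictable {ℱ : Filtration ℝ≥0 mΩ} {D : ℝ≥0 → Ω → ℝ}
    (hD : ∀ ω, IsCadlagPath fun t => D t ω) (hDa : ∀ t, Measurable[ℱ t] (D t)) :
    Measurable[predictable E ℱ]
      fun x : Ω × E × ℝ≥0 => Function.leftLim (fun s => D s x.1) x.2.2 := by
  let := predictable E ℱ
  refine measurable_of_tendsto_metrizable (fun k => measurable_prevGrid_predictable hDa k) ?_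
  rw [tendsto_pi_nhds]
  exact fun x => (hD x.1).tendsto_prevGrid x.2.2

theorem iUnion_Iic_prevGrid {s : ℝ≥0} (hs : 0 < s) : ⋃ k, Iic (prevGrid k s) = Iio s := by
  ext r
  simp only [mem_iUnion, mem_Iic, mem_Iio]
  refine ⟨fun ⟨k, hk⟩ => hk.trans_lt (prevGrid_lt k hs), fun hr => ?_⟩
  exact ((tendsto_prevGrid s).eventually_const_le hr).exists

theorem configLeft_zero (c : Measure (E × ℝ≥0)) : configLeft c 0 = 0 := by
  rw [configLeft]
  simp

theorem configLeft_apply_eq_iSup (c : Measure (E × ℝ≥0)) {s : ℝ≥0} (hs : 0 < s)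
    {B : Set (E × ℝ≥0)} (hB : MeasurableSet B) :
    configLeft c s B = ⨆ k, config c (prevGrid k s) B := by
  simp only [configLeft, config, Measure.restrict_apply hB]
  rw [← iUnion_Iic_prevGrid hs, prod_iUnion, inter_iUnion]
  refine Monotone.measure_iUnion fun i j hij => ?_
  exact inter_subset_inter_right _ (prod_mono_right (Iic_subset_Iic.2 (monotone_prevGrid s hij)))

/-- The points strictly before `s` are exhausted by those up to the previous grid points, so each
evaluation is a countable supremum of predictable functions. -/
theorem measurable_configLeft_predictable {ℱ : Filtration ℝ≥0 mΩ} {X : Ω → Measure (E × ℝ≥0)}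
    (hXa : ∀ t, Measurable[ℱ t] fun ω => (X ω).restrict (univ ×ˢ Iic t)) :
    Measurable[predictable E ℱ] fun x : Ω × E × ℝ≥0 => configLeft (X x.1) x.2.2 := by
  have hsnd := measurable_predictable_snd (E := E) ℱ
  have hstep := fun k => measurable_prevGrid_predictable (E := E) hXa k
  let := predictable E ℱ
  refine Measure.measurable_of_measurable_coe _ fun B hB => ?_
  -- Time `0` is cut out: since `prevGrid k 0 = 0`, the approximations would count the points at
  -- time `0`, which `configLeft` leaves out.
  have heq : (fun x : Ω × E × ℝ≥0 => configLeft (X x.1) x.2.2 B) =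
      {x : Ω × E × ℝ≥0 | 0 < x.2.2}.indicator
        fun x => ⨆ k, (X x.1).restrict (univ ×ˢ Iic (prevGrid k x.2.2)) B := by
    ext x
    rcases eq_or_ne x.2.2 0 with h | h
    · simp [h, configLeft_zero]
    · have h' := pos_iff_ne_zero.2 h
      rw [indicator_of_mem (by exact h'), configLeft_apply_eq_iSup _ h' hB]
      rfl
  rw [heq]
  refine Measurable.indicator (Measurable.iSup fun k => ?_) ?_
  · exact (Measure.measurable_coe hB).comp (hstep k)
  · exact measurableSet_lt measurable_const (measurable_snd.comp hsnd)

end Predictable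
/-! ### Path properties -/

/-- For fixed `ε`, right continuity gives every time `s` an interval `(s, y)` free of jumps larger
than `ε`. The intervals attached to the times of such jumps are pairwise disjoint, hence countable.
-/
theorem IsCadlagPath.countable_jumps {f : ℝ≥0 → ℝ} (hf : IsCadlagPath f) :
    {s | Function.leftLim f s ≠ f s}.Countable := by
  have hsub : {s | Function.leftLim f s ≠ f s} ⊆
      ⋃ n : ℕ, {s | 1 / ((n : ℝ) + 1) < |Function.leftLim f s - f s|} := by
    intro s hs
    obtain ⟨n, hn⟩ := exists_nat_one_div_lt (abs_pos.2 (sub_ne_zero.2 hs))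
    exact mem_iUnion.2 ⟨n, hn⟩
  refine (countable_iUnion fun n => ?_).mono hsub
  set ε : ℝ := 1 / ((n : ℝ) + 1) with hε
  have hε0 : 0 < ε := by positivity
  have hright : ∀ s, ∃ y, s < y ∧ ∀ r ∈ Ioo s y, |Function.leftLim f r - f r| ≤ ε := by
    intro s
    have h := (hf s).1.tendsto.eventually (Metric.ball_mem_nhds (f s) (half_pos hε0))
    obtain ⟨y, hy, hy'⟩ := mem_nhdsGE_iff_exists_Ico_subset.1 h
    refine ⟨y, hy, fun r hr => ?_⟩
    have hball : ∀ r ∈ Ioo s y, |f r - f s| < ε / 2 := fun r hr => by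
      simpa [Real.dist_eq] using hy' ⟨hr.1.le, hr.2⟩
    have hl : |Function.leftLim f r - f s| ≤ ε / 2 := by
      have hne : (𝓝[<] r).NeBot := nhdsLT_neBot_of_exists_lt ⟨s, hr.1⟩
      refine le_of_tendsto ((hf.tendsto_leftLim r).sub_const (f s)).abs ?_
      filter_upwards [Ioo_mem_nhdsLT hr.1] with q hq
      exact (hball q ⟨hq.1, hq.2.trans hr.2⟩).le
    calc |Function.leftLim f r - f r| = |(Function.leftLim f r - f s) - (f r - f s)| := by ring_nf
      _ ≤ |Function.leftLim f r - f s| + |f r - f s| := abs_sub _ _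
      _ ≤ ε / 2 + ε / 2 := add_le_add hl (hball r hr).le
      _ = ε := add_halves ε
  choose y hy hyr using hright
  refine Set.PairwiseDisjoint.countable_of_Ioo (y := y) ?_ fun s _ => hy s
  have key : ∀ s s', s < s' → ε < |Function.leftLim f s' - f s'| →
      Disjoint (Ioo s (y s)) (Ioo s' (y s')) := by
    intro s s' hlt hs'
    have : y s ≤ s' := by
      by_contra! h
      exact absurd (hyr s s' ⟨hlt, h⟩) (not_le.2 hs')
    refine Set.disjoint_left.2 fun r hr hr' => ?_
    exact absurd (hr.2.trans_le this) (not_lt.2 hr'.1.le)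
  intro s hs s' hs' hne
  rcases lt_or_gt_of_ne hne with h | h
  · exact key s s' h hs'
  · exact (key s' s h hs).symm

/-! ### Counting measures and their time slices -/

section Counting

variable {E : Type*} [MeasurableSpace E] {c : Measure (E × ℝ≥0)}

theorem measurableSet_slice (s : ℝ≥0) : MeasurableSet (univ ×ˢ {s} : Set (E × ℝ≥0)) :=
  MeasurableSet.univ.prod (measurableSet_singleton s)

theorem countable_slices [SFinite c] : {s : ℝ≥0 | c (univ ×ˢ {s}) ≠ 0}.Countable := by
  have := Measure.countable_meas_pos_of_disjoint_iUnion (μ := c)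
    (As := fun s : ℝ≥0 => (univ ×ˢ {s} : Set (E × ℝ≥0))) measurableSet_slice ?_
  · simpa only [pos_iff_ne_zero] using this
  · intro s s' h
    exact Set.disjoint_left.2 fun z hz hz' => h (hz.2.symm.trans hz'.2)

theorem config_eq_configLeft {s : ℝ≥0} (h : c (univ ×ˢ {s}) = 0) :
    config c s = configLeft c s := by
  refine Measure.restrict_congr_set ?_
  rw [← Iio_union_right, prod_union]
  exact union_ae_eq_left_of_ae_eq_empty (ae_eq_empty.2 h)

/-- A locally finite measure with values in `{0, 1, …, ∞}` is carried by countably many time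
slices. -/
theorem ae_of_forall_slice (hc : ∀ B, MeasurableSet B → ∃ n : ℕ∞, c B = (n : ℝ≥0∞))
    [SigmaFinite c] {p : E × ℝ≥0 → Prop} (h : ∀ s, c {z | z.2 = s ∧ ¬ p z} = 0) :
    ∀ᵐ z ∂c, p z := by
  set J := {s : ℝ≥0 | c (univ ×ˢ {s}) ≠ 0} with hJ
  have hJc : J.Countable := countable_slices
  have hJm : MeasurableSet J := hJc.measurableSet
  have hnull : c (univ ×ˢ Jᶜ) = 0 := by
    have hmeas : MeasurableSet (univ ×ˢ Jᶜ : Set (E × ℝ≥0)) := MeasurableSet.univ.prod hJm.compl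
    have h1 : ∀ n, c (univ ×ˢ Jᶜ ∩ spanningSets c n) = 0 := by
      intro n
      set A := univ ×ˢ Jᶜ ∩ spanningSets c n with hA
      have hAm : MeasurableSet A := hmeas.inter (measurableSet_spanningSets c n)
      have hfin : IsFiniteMeasure (c.restrict A) :=
        ⟨by
          rw [Measure.restrict_apply_univ]
          exact (measure_mono inter_subset_right).trans_lt (measure_spanningSets_lt_top c n)⟩
      set m := (c.restrict A).map Prod.snd with hm
      have hmap : ∀ B, MeasurableSet B → m B = c (univ ×ˢ B ∩ A) := by
        intro B hB
        rw [hm, Measure.map_apply measurable_snd hB, Measure.restrict_apply (measurable_snd hB)]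
        congr 2
        ext; simp
      -- The projected measure `m` is finite and has no atoms, so outer regularity gives every time
      -- a neighbourhood of mass below `1`. Integer values force that mass to be `0`, and locally
      -- null implies null.
      have hm0 : m univ = 0 := by
        refine measure_null_of_locally_null _ fun s _ => ?_
        have hs0 : m {s} = 0 := by
          rw [hmap _ (measurableSet_singleton s)]
          by_cases hs : s ∈ J
          · convert measure_empty (μ := c)
            refine eq_empty_of_forall_notMem fun z hz => ?_
            have h2 : z.2 = s := hz.1.2
            exact hz.2.1.2 (h2 ▸ hs)
          · exact measure_mono_null inter_subset_left (not_not.1 hs)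
        obtain ⟨U, hU, hUo, hlt⟩ := Set.exists_isOpen_lt_of_lt {s} (1 : ℝ≥0∞) (μ := m)
          (by rw [hs0]; exact one_pos)
        refine ⟨U, mem_nhdsWithin_of_mem_nhds (hUo.mem_nhds (hU rfl)), ?_⟩
        rw [hmap U hUo.measurableSet] at hlt ⊢
        obtain ⟨k, hk⟩ := hc _ ((MeasurableSet.univ.prod hUo.measurableSet).inter hAm)
        rw [hk] at hlt ⊢
        have : k < 1 := by exact_mod_cast hlt
        rw [Order.lt_one_iff.1 this]
        simp
      rw [hmap univ MeasurableSet.univ] at hm0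
      simpa using hm0
    rw [← inter_univ (univ ×ˢ Jᶜ), ← iUnion_spanningSets c, inter_iUnion]
    exact measure_iUnion_null h1
  refine measure_mono_null (t := univ ×ˢ Jᶜ ∪ ⋃ s ∈ J, {z | z.2 = s ∧ ¬ p z}) ?_
    (measure_union_null hnull ((measure_biUnion_null_iff hJc).2 fun s _ => h s))
  intro z hz
  by_cases hzJ : z.2 ∈ J
  · exact Or.inr (mem_iUnion₂.2 ⟨z.2, hzJ, rfl, hz⟩)
  · exact Or.inl ⟨trivial, hzJ⟩

/-- If a counting measure has at most one point on each time slice, then integrating over the slice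
is evaluating at the point. -/
theorem ae_eq_setIntegral_slice (hc : ∀ B, MeasurableSet B → ∃ n : ℕ∞, c B = (n : ℝ≥0∞))
    [SigmaFinite c] (h1 : ∀ s, c (univ ×ˢ {s}) ≤ 1) {f : E × ℝ≥0 → ℝ} (hf : Measurable f) :
    ∀ᵐ z ∂c, ∫ z' in univ ×ˢ {z.2}, f z' ∂c = f z := by
  refine ae_of_forall_slice hc fun s => ?_
  by_cases hs : c (univ ×ˢ {s}) = 0
  · refine measure_mono_null ?_ hs
    rintro z ⟨hz, -⟩
    exact ⟨trivial, hz⟩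
  have hs1 : c (univ ×ˢ {s}) = 1 := by
    obtain ⟨n, hn⟩ := hc _ (measurableSet_slice s)
    have hle := h1 s
    rw [hn] at hs hle ⊢
    have h2 : n ≤ 1 := by exact_mod_cast hle
    have h3 : n ≠ 0 := by rintro rfl; simp at hs
    have : n = 1 := le_antisymm h2 (Order.one_le_iff_ne_zero.2 h3)
    simp [this]
  set c' := c.restrict (univ ×ˢ {s}) with hc'
  have hprob : IsProbabilityMeasure c' := ⟨by rw [hc', Measure.restrict_apply_univ, hs1]⟩
  -- On the slice `c` is a probability measure with values `0` and `1` only, so a measurable real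
  -- function is almost everywhere constant, and the constant is its integral.
  obtain ⟨a, ha⟩ := Filter.exists_eventuallyEq_const_of_forall_separating (f := f) (l := ae c')
    MeasurableSet (fun U hU => by
      obtain ⟨n, hn⟩ := hc _ ((hf hU).inter (measurableSet_slice s))
      rw [← Measure.restrict_apply (hf hU)] at hn
      rcases eq_or_ne n 0 with rfl | hn0
      · right
        have h0 : c' (f ⁻¹' U) = 0 := by simpa using hn
        exact measure_eq_zero_iff_ae_notMem.1 h0
      · left
        have hle : 1 ≤ c' (f ⁻¹' U) := by
          rw [hn]
          exact_mod_cast Order.one_le_iff_ne_zero.2 hn0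
        exact (prob_compl_eq_zero_iff (hf hU)).2 (le_antisymm prob_le_one hle))
  have hint : ∫ z' in univ ×ˢ {s}, f z' ∂c = a := by
    rw [integral_congr_ae ha]; simp
  have : ∀ᵐ z ∂c, z ∈ (univ ×ˢ {s} : Set (E × ℝ≥0)) → f z = a :=
    (ae_restrict_iff' (measurableSet_slice s)).1 ha
  refine measure_mono_null ?_ this
  rintro z ⟨rfl, hz⟩ h
  exact hz (hint.trans (h ⟨trivial, rfl⟩).symm)

end Counting
/-! ### Poisson random measures -/

theorem lintegral_natCast_poissonMeasure (r : ℝ≥0) :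
    ∫⁻ k, (k : ℝ≥0∞) ∂poissonMeasure r = r := by
  rw [lintegral_countable']
  simp_rw [poissonMeasure_singleton]
  rw [tsum_eq_zero_add' ENNReal.summable]
  have hterm : ∀ n : ℕ, ((n + 1 : ℕ) : ℝ≥0∞) *
      ENNReal.ofReal (Real.exp (-r) * r ^ (n + 1) / (n + 1).factorial) =
      r * poissonMeasure r {n} := by
    intro n
    rw [poissonMeasure_singleton, ← ENNReal.ofReal_coe_nnreal, ← ENNReal.ofReal_natCast,
      ← ENNReal.ofReal_mul (by positivity), ← ENNReal.ofReal_mul (by positivity)]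
    congr 1
    rw [Nat.factorial_succ]
    push_cast
    field_simp
    ring
  simp_rw [hterm]
  rw [ENNReal.tsum_mul_left, ← measure_iUnion (fun i j h => by simpa using h)
    fun n => measurableSet_singleton n]
  simp [iUnion_of_singleton]

/-- `1 - e^{-r}(1 + r) ≤ 1 - (1 - r)(1 + r) = r²`. The quadratic order is what makes the sum over
small cells vanish in `ae_simple`. -/
theorem poissonMeasure_two_le (r : ℝ≥0) :
    poissonMeasure r {k | 2 ≤ k} ≤ (r : ℝ≥0∞) ^ 2 := by
  have hset : {k : ℕ | 2 ≤ k} = ({0} ∪ {1})ᶜ := by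
    ext k; simp; omega
  rw [hset, prob_compl_eq_one_sub (by measurability),
    measure_union (by simp) (measurableSet_singleton _), poissonMeasure_singleton,
    poissonMeasure_singleton, ← ENNReal.ofReal_add (by positivity) (by positivity),
    ← ENNReal.ofReal_one, ← ENNReal.ofReal_sub _ (by positivity), ← ENNReal.ofReal_coe_nnreal,
    ← ENNReal.ofReal_pow (by positivity)]
  refine ENNReal.ofReal_le_ofReal ?_
  have h := Real.one_sub_le_exp_neg (r : ℝ)
  have hr : (0 : ℝ) ≤ r := r.2
  simp only [pow_zero, mul_one, Nat.factorial_zero, Nat.cast_one, div_one, pow_one,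
    Nat.factorial_one]
  nlinarith

namespace IsPoissonRandomMeasure

variable {Ω S : Type*} [MeasurableSpace Ω] [MeasurableSpace S] {X : Ω → Measure S}
  {μ : Measure S} {P : Measure Ω}

theorem measurable_apply (h : IsPoissonRandomMeasure X μ P) {B : Set S} (hB : MeasurableSet B) :
    Measurable fun ω => X ω B :=
  (Measure.measurable_coe hB).comp h.measurable

theorem lintegral_apply (h : IsPoissonRandomMeasure X μ P) {B : Set S} (hB : MeasurableSet B)
    (hfin : μ B ≠ ∞) : ∫⁻ ω, X ω B ∂P = μ B := by
  have h1 : ∫⁻ ω, X ω B ∂P = ∫⁻ x, x ∂(P.map fun ω => X ω B) :=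
    (lintegral_map measurable_id (h.measurable_apply hB)).symm
  rw [h1, h.law B hB hfin, lintegral_map (f := fun x : ℝ≥0∞ => x) measurable_id
    (by fun_prop)]
  rw [lintegral_natCast_poissonMeasure, ENNReal.coe_toNNReal hfin]

theorem measure_two_le (h : IsPoissonRandomMeasure X μ P) {B : Set S} (hB : MeasurableSet B)
    (hfin : μ B ≠ ∞) : P {ω | 2 ≤ X ω B} ≤ μ B ^ 2 := by
  have h1 : P {ω | 2 ≤ X ω B} = (P.map fun ω => X ω B) (Ici 2) :=
    (Measure.map_apply (h.measurable_apply hB) measurableSet_Ici).symm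
  rw [h1, h.law B hB hfin, Measure.map_apply (by fun_prop) measurableSet_Ici]
  refine le_trans (le_of_eq ?_) ((poissonMeasure_two_le (μ B).toNNReal).trans_eq ?_)
  · congr 1
    ext k
    simp only [mem_preimage, mem_Ici, mem_ofPred_eq]
    exact_mod_cast Iff.rfl
  · rw [ENNReal.coe_toNNReal hfin]

theorem ae_eq_zero (h : IsPoissonRandomMeasure X μ P) {B : Set S} (hB : MeasurableSet B)
    (h0 : μ B = 0) : ∀ᵐ ω ∂P, X ω B = 0 := by
  have := h.lintegral_apply hB (by simp [h0])
  rw [h0, lintegral_eq_zero_iff (h.measurable_apply hB)] at this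
  exact this

/-- Two points at the same time share a dyadic cell at every level. Inside a set of finite mean this
has probability at most the sum of the squared cell masses, that is, the `μ ⊗ μ`-mass of the pairs
sharing a cell. These sets of pairs converge to the pairs with equal times, which are null because
`μ` does not charge slices. -/
theorem ae_simple {E : Type*} [MeasurableSpace E] {X : Ω → Measure (E × ℝ≥0)}
    {μ : Measure (E × ℝ≥0)} [SigmaFinite μ] (h : IsPoissonRandomMeasure X μ P)
    (hμ : ∀ s, μ (univ ×ˢ {s}) = 0) : ∀ᵐ ω ∂P, ∀ s, X ω (univ ×ˢ {s}) ≤ 1 := by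
  have key : ∀ j, ∀ᵐ ω ∂P, ∀ s, ¬ 2 ≤ X ω (spanningSets μ j ∩ univ ×ˢ {s}) := by
    intro j
    set U := spanningSets μ j with hU
    have hUm : MeasurableSet U := measurableSet_spanningSets μ j
    have hUfin : μ U < ∞ := measure_spanningSets_lt_top μ j
    have hfin : IsFiniteMeasure (μ.restrict U) := ⟨by simpa using hUfin⟩
    have hceil : ∀ k : ℕ, Measurable fun z : E × ℝ≥0 => ⌈z.2 * 2 ^ k⌉₊ := fun k =>
      Nat.measurable_ceil.comp (measurable_snd.mul_const _)
    have hcell : ∀ k n : ℕ, MeasurableSet {z : E × ℝ≥0 | ⌈z.2 * 2 ^ k⌉₊ = n} := fun k n =>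
      hceil k (measurableSet_singleton n)
    set A : ℕ → Set ((E × ℝ≥0) × E × ℝ≥0) := fun k =>
      {p | ⌈p.1.2 * 2 ^ k⌉₊ = ⌈p.2.2 * 2 ^ k⌉₊} with hA
    have hAm : ∀ k, MeasurableSet (A k) := fun k =>
      measurableSet_eq_fun ((hceil k).comp measurable_fst) ((hceil k).comp measurable_snd)
    have hbound : ∀ k, P {ω | ¬ ∀ s, ¬ 2 ≤ X ω (U ∩ univ ×ˢ {s})} ≤
        ((μ.restrict U).prod (μ.restrict U)) (A k) := by
      intro k
      have hsub : {ω | ¬ ∀ s, ¬ 2 ≤ X ω (U ∩ univ ×ˢ {s})} ⊆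
          ⋃ n : ℕ, {ω | 2 ≤ X ω ({z : E × ℝ≥0 | ⌈z.2 * 2 ^ k⌉₊ = n} ∩ U)} := by
        intro ω hω
        simp only [mem_ofPred_eq, not_forall, not_not] at hω
        obtain ⟨s, hs⟩ := hω
        refine mem_iUnion.2 ⟨⌈s * 2 ^ k⌉₊, hs.trans (measure_mono ?_)⟩
        rintro z ⟨hz, hz'⟩
        refine ⟨?_, hz⟩
        have : z.2 = s := hz'.2
        simp [this]
      have hAeq : A k = ⋃ n : ℕ, {z : E × ℝ≥0 | ⌈z.2 * 2 ^ k⌉₊ = n} ×ˢ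
          {z : E × ℝ≥0 | ⌈z.2 * 2 ^ k⌉₊ = n} := by
        ext p
        simp [hA, eq_comm]
      calc P {ω | ¬ ∀ s, ¬ 2 ≤ X ω (U ∩ univ ×ˢ {s})}
          ≤ ∑' n : ℕ, P {ω | 2 ≤ X ω ({z : E × ℝ≥0 | ⌈z.2 * 2 ^ k⌉₊ = n} ∩ U)} :=
            (measure_mono hsub).trans (measure_iUnion_le _)
        _ ≤ ∑' n : ℕ, μ ({z : E × ℝ≥0 | ⌈z.2 * 2 ^ k⌉₊ = n} ∩ U) ^ 2 :=
            ENNReal.tsum_le_tsum fun n => h.measure_two_le ((hcell k n).inter hUm)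
              ((measure_mono inter_subset_right).trans_lt hUfin).ne
        _ = ((μ.restrict U).prod (μ.restrict U)) (A k) := by
            rw [hAeq, measure_iUnion]
            · refine tsum_congr fun n => ?_
              rw [Measure.prod_prod, Measure.restrict_apply (hcell k n), sq]
            · intro n n' hn
              refine Set.disjoint_left.2 fun p hp hp' => hn ?_
              have h1 : ⌈p.1.2 * 2 ^ k⌉₊ = n := hp.1
              have h2 : ⌈p.1.2 * 2 ^ k⌉₊ = n' := hp'.1
              exact h1.symm.trans h2
            · exact fun n => (hcell k n).prod (hcell k n)
    have hdiag : MeasurableSet {p : (E × ℝ≥0) × E × ℝ≥0 | p.1.2 = p.2.2} :=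
      measurableSet_eq_fun measurable_fst.snd measurable_snd.snd
    have hdiag0 : ((μ.restrict U).prod (μ.restrict U)) {p | p.1.2 = p.2.2} = 0 := by
      rw [Measure.measure_prod_null hdiag]
      refine Eventually.of_forall fun z => ?_
      refine Measure.restrict_le_self.absolutelyContinuous (measure_mono_null ?_ (hμ z.2))
      intro z' hz'
      exact ⟨trivial, Eq.symm hz'⟩
    have hlim := tendsto_measure_of_ae_tendsto_indicator_of_isFiniteMeasure atTop
      (μ := (μ.restrict U).prod (μ.restrict U)) hdiag hAm (Eventually.of_forall fun p => by
        by_cases hp : p.1.2 = p.2.2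
        · exact Eventually.of_forall fun k => by simp [hA, hp]
        · have hev := ((tendsto_nextGrid p.1.2).prodMk_nhds (tendsto_nextGrid p.2.2)).eventually
            ((isOpen_ne_fun continuous_fst continuous_snd).mem_nhds hp)
          filter_upwards [hev] with k hk
          exact iff_of_false (fun h : ⌈p.1.2 * 2 ^ k⌉₊ = ⌈p.2.2 * 2 ^ k⌉₊ =>
            hk (by rw [nextGrid, nextGrid, h])) hp)
    rw [hdiag0] at hlim
    exact le_antisymm (ge_of_tendsto' hlim hbound) zero_le
  filter_upwards [ae_all_iff.2 key] with ω hω s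
  have hsup : X ω (univ ×ˢ {s}) = ⨆ j, X ω (spanningSets μ j ∩ univ ×ˢ {s}) := by
    rw [← Monotone.measure_iUnion, ← iUnion_inter, iUnion_spanningSets, univ_inter]
    exact fun i j hij => inter_subset_inter_left _ (monotone_spanningSets μ hij)
  rw [hsup]
  refine iSup_le fun j => ?_
  obtain ⟨n, hn⟩ := h.counting ω _ ((measurableSet_spanningSets μ j).inter (measurableSet_slice s))
  have := hω j s
  rw [hn] at this ⊢
  have h2 : n < 2 := by
    rw [not_le] at this
    exact_mod_cast this
  have h3 : n ≤ 1 := Order.le_of_lt_add_one (by rwa [one_add_one_eq_two])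
  exact_mod_cast h3

end IsPoissonRandomMeasure

/-! ### Mean measures and the compensation formula under `Q` -/

section MeanMeasure

variable {E : Type*} [MeasurableSpace E] (ν : Measure E)

instance [SigmaFinite ν] (g : E → ℝ≥0 → ℝ≥0) : SigmaFinite (meanMeasure ν g) :=
  SigmaFinite.withDensity_of_ne_top' fun _ => ENNReal.coe_ne_top

theorem prod_timeMeasure_slice (s : ℝ≥0) : (ν.prod timeMeasure) (univ ×ˢ {s}) = 0 := by
  rw [Measure.prod_prod]; simp

theorem meanMeasure_slice (g : E → ℝ≥0 → ℝ≥0) (s : ℝ≥0) :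
    meanMeasure ν g (univ ×ˢ {s}) = 0 :=
  withDensity_absolutelyContinuous _ _ (prod_timeMeasure_slice ν s)

end MeanMeasure

/-- The compensation formula for predictable integrands. -/
theorem lintegral_compensation {Ω E : Type*} {mΩ : MeasurableSpace Ω} [MeasurableSpace E]
    {Q : Measure Ω} [IsProbabilityMeasure Q] {ℱ : Filtration ℝ≥0 mΩ} {C : Ω → Measure (E × ℝ≥0)}
    {μ : Measure (E × ℝ≥0)} [SigmaFinite μ] (hC : IsPoissonRandomMeasure C μ Q)
    (hCℱ : IsCompatible C ℱ Q) (hμ : ∀ s, μ (univ ×ˢ {s}) = 0)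
    {H : Ω × E × ℝ≥0 → ℝ≥0∞} (hH : Measurable[predictable E ℱ] H) :
    ∫⁻ ω, ∫⁻ z, H (ω, z) ∂C ω ∂Q = ∫⁻ ω, ∫⁻ z, H (ω, z) ∂μ ∂Q := by
  set κ : Kernel Ω (E × ℝ≥0) := ⟨C, hC.measurable⟩ with hκ
  have hκs : IsSFiniteKernel κ := hC.hasFiniteCover.isSFiniteKernel hC.measurable
  have hHm : Measurable H := hH.mono (predictable_le ℱ) le_rfl
  have hrect : ∀ s (F : Set Ω) (W : Set (E × ℝ≥0)), MeasurableSet[ℱ s] F → MeasurableSet W →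
      μ W ≠ ∞ → (s = 0 ∨ W ⊆ {z | s < z.2}) → (Q ⊗ₘ κ) (F ×ˢ W) = (Q.prod μ) (F ×ˢ W) := by
    intro s F W hF hW hfin h
    -- Independence of `ℱ s` is available only for the points strictly after `s`. For `s = 0` the
    -- set `W` may meet time `0`, where `C` almost surely has no points.
    have hae : ∀ᵐ ω ∂Q, C ω W = (C ω).restrict (univ ×ˢ Ioi s) W := by
      rcases h with rfl | h
      · filter_upwards [hC.ae_eq_zero (measurableSet_slice 0) (hμ 0)] with ω hω
        rw [Measure.restrict_apply hW]
        refine le_antisymm ?_ (measure_mono inter_subset_left)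
        have : W ⊆ (W ∩ univ ×ˢ Ioi 0) ∪ univ ×ˢ {0} := by
          intro z hz
          rcases eq_or_ne z.2 0 with h0 | h0
          · exact Or.inr ⟨trivial, h0⟩
          · exact Or.inl ⟨hz, trivial, pos_iff_ne_zero.2 h0⟩
        refine (measure_mono this).trans ((measure_union_le _ _).trans ?_)
        rw [hω, add_zero]
      · refine Eventually.of_forall fun ω => ?_
        rw [Measure.restrict_apply hW, inter_eq_left.2]
        exact fun z hz => ⟨trivial, h hz⟩
    have hF' := ℱ.le s _ hF
    rw [Measure.compProd_apply_prod hF' hW, Measure.prod_prod]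
    change ∫⁻ ω in F, C ω W ∂Q = _
    have hmeas : Measurable[MeasurableSpace.comap
        (fun ω => (C ω).restrict (univ ×ˢ Ioi s)) inferInstance]
        fun ω => (C ω).restrict (univ ×ˢ Ioi s) W :=
      (Measure.measurable_coe hW).comp (comap_measurable _)
    have hind := lintegral_mul_eq_lintegral_mul_lintegral_of_independent_measurableSpace
      (μ := Q) (f := fun ω => (C ω).restrict (univ ×ˢ Ioi s) W) (g := F.indicator 1)
      (Measurable.comap_le (hC.measurable.restrict_measure
        (MeasurableSet.univ.prod measurableSet_Ioi)))
      (ℱ.le s) (hCℱ.indep s) hmeas (measurable_const.indicator hF)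
    rw [lintegral_congr_ae (ae_restrict_of_ae hae), ← lintegral_indicator hF']
    rw [lintegral_indicator_one hF', ← lintegral_congr_ae hae, hC.lintegral_apply hW hfin] at hind
    rw [mul_comm, ← hind]
    refine lintegral_congr fun ω => ?_
    by_cases hω : ω ∈ F <;> simp [hω]
  -- Both measures agree on the π-system of predictable rectangles. The spanning sets of `μ`
  -- localize to finite measures, so they agree on the predictable σ-algebra.
  have htrim : (Q ⊗ₘ κ).trim (predictable_le ℱ) = (Q.prod μ).trim (predictable_le ℱ) := by
    set U := fun j => (univ : Set Ω) ×ˢ spanningSets μ j with hU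
    have hUm : ∀ j, MeasurableSet[predictable E ℱ] (U j) := fun j =>
      measurableSet_predictable_prod_zero MeasurableSet.univ (measurableSet_spanningSets μ j)
    refine (@Measure.ext_iff_of_iUnion_eq_univ _ _ (predictable E ℱ) _ _ _ U ?_).2 fun j => ?_
    · rw [hU, ← prod_iUnion, iUnion_spanningSets, univ_prod_univ]
    have hUj := predictable_le ℱ _ (hUm j)
    have hUfin : μ (spanningSets μ j) < ∞ := measure_spanningSets_lt_top μ j
    have hM : ∀ G ∈ predictableRectangles E ℱ,
        ((Q ⊗ₘ κ).restrict (U j)) G = ((Q.prod μ).restrict (U j)) G := by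
      rintro _ ⟨s, F, V, hF, hV, h, rfl⟩
      have hFV := (ℱ.le s _ hF).prod hV
      rw [Measure.restrict_apply hFV, Measure.restrict_apply hFV, prod_inter_prod, inter_univ]
      exact hrect s F _ hF (hV.inter (measurableSet_spanningSets μ j))
        ((measure_mono inter_subset_right).trans_lt hUfin).ne
        (h.imp id fun h => inter_subset_left.trans h)
    have huniv : (univ : Set (Ω × E × ℝ≥0)) ∈ predictableRectangles E ℱ :=
      ⟨0, univ, univ, MeasurableSet.univ, MeasurableSet.univ, Or.inl rfl, univ_prod_univ.symm⟩
    -- The whole space is itself a rectangle, so finiteness for `Q ⊗ₘ κ` is inherited from the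
    -- product measure.
    have hfin : IsFiniteMeasure ((Q ⊗ₘ κ).restrict (U j)) := by
      refine ⟨?_⟩
      rw [hM univ huniv, Measure.restrict_apply_univ, hU, Measure.prod_prod]
      simpa using hUfin
    rw [restrict_trim _ _ (hUm j), restrict_trim _ _ (hUm j)]
    refine @ext_of_generate_finite _ (predictable E ℱ) _ _ (predictableRectangles E ℱ) rfl
      (isPiSystem_predictableRectangles ℱ) (isFiniteMeasure_trim _) (fun G hG => ?_) ?_
    · have hGm : MeasurableSet[predictable E ℱ] G := MeasurableSpace.measurableSet_generateFrom hG
      rw [trim_measurableSet_eq _ hGm, trim_measurableSet_eq _ hGm, hM G hG]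
    · rw [trim_measurableSet_eq _ MeasurableSet.univ, trim_measurableSet_eq _ MeasurableSet.univ,
        hM _ huniv]
  calc ∫⁻ ω, ∫⁻ z, H (ω, z) ∂C ω ∂Q = ∫⁻ x, H x ∂(Q ⊗ₘ κ) :=
        (Measure.lintegral_compProd (κ := κ) hHm).symm
    _ = ∫⁻ x, H x ∂(Q.prod μ) := by
        rw [← lintegral_trim (predictable_le ℱ) hH, htrim, lintegral_trim (predictable_le ℱ) hH]
    _ = _ := lintegral_prod _ hHm.aemeasurable
/-! ### Path regularity of solutions of the likelihood equation -/

theorem tendsto_setIntegral_of_eventually {S ι : Type*} [MeasurableSpace S] {μ : Measure S}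
    {l : Filter ι} [l.IsCountablyGenerated] {f : S → ℝ} {A : ι → Set S} {B T : Set S}
    (hA : ∀ i, MeasurableSet (A i)) (hB : MeasurableSet B)
    (hf : IntegrableOn f T μ) (hAT : ∀ᶠ i in l, A i ⊆ T) (hBT : B ⊆ T)
    (h : ∀ z, ∀ᶠ i in l, z ∈ A i ↔ z ∈ B) :
    Tendsto (fun i => ∫ z in A i, f z ∂μ) l (𝓝 (∫ z in B, f z ∂μ)) := by
  have heq : ∀ A : Set S, MeasurableSet A → A ⊆ T →
      ∫ z in A, f z ∂μ = ∫ z in T, A.indicator f z ∂μ := fun A hA hAT => by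
    rw [setIntegral_indicator hA, inter_eq_right.2 hAT]
  rw [heq B hB hBT]
  refine Tendsto.congr' (f₁ := fun i => ∫ z in T, (A i).indicator f z ∂μ) ?_ ?_
  · filter_upwards [hAT] with i hi using (heq _ (hA i) hi).symm
  refine tendsto_integral_filter_of_dominated_convergence (fun z => ‖f z‖) ?_ ?_ hf.norm ?_
  · exact Eventually.of_forall fun i => hf.aestronglyMeasurable.indicator (hA i)
  · exact Eventually.of_forall fun i => Eventually.of_forall fun z => norm_indicator_le_norm_self _ _
  · refine Eventually.of_forall fun z => tendsto_const_nhds.congr' ?_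
    filter_upwards [h z] with i hi
    by_cases hz : z ∈ B
    · rw [indicator_of_mem hz, indicator_of_mem (hi.2 hz)]
    · rw [indicator_of_notMem hz, indicator_of_notMem (fun h => hz (hi.1 h))]

section Path

variable {E : Type*} [MeasurableSpace E] {c μ : Measure (E × ℝ≥0)} {f : E × ℝ≥0 → ℝ}
  {l : ℝ≥0 → ℝ}

/-- `l(t) = 1 + ∫_{E × [0,t]} f d(c - μ)` for all `t`, both integrals being absolutely
convergent. -/
def IsPathIntegral (c μ : Measure (E × ℝ≥0)) (f : E × ℝ≥0 → ℝ) (l : ℝ≥0 → ℝ) : Prop :=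
  ∀ t : ℝ≥0, IntegrableOn f (univ ×ˢ Iic t) c ∧ IntegrableOn f (univ ×ˢ Iic t) μ ∧
    l t = 1 + ((∫ z in univ ×ˢ Iic t, f z ∂c) - ∫ z in univ ×ˢ Iic t, f z ∂μ)

theorem measurableSet_univ_prod_Iic (t : ℝ≥0) : MeasurableSet (univ ×ˢ Iic t : Set (E × ℝ≥0)) :=
  MeasurableSet.univ.prod measurableSet_Iic

theorem measurableSet_univ_prod_Iio (t : ℝ≥0) : MeasurableSet (univ ×ˢ Iio t : Set (E × ℝ≥0)) :=
  MeasurableSet.univ.prod measurableSet_Iio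

namespace IsPathIntegral

theorem tendsto_nhdsLT (h : IsPathIntegral c μ f l) (s : ℝ≥0) :
    Tendsto l (𝓝[<] s)
      (𝓝 (1 + ((∫ z in univ ×ˢ Iio s, f z ∂c) - ∫ z in univ ×ˢ Iio s, f z ∂μ))) := by
  have key : ∀ m : Measure (E × ℝ≥0), IntegrableOn f (univ ×ˢ Iic s) m →
      Tendsto (fun t => ∫ z in univ ×ˢ Iic t, f z ∂m) (𝓝[<] s)
        (𝓝 (∫ z in univ ×ˢ Iio s, f z ∂m)) := by
    intro m hm
    refine tendsto_setIntegral_of_eventually measurableSet_univ_prod_Iic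
      (measurableSet_univ_prod_Iio s) hm ?_ (prod_mono_right Iio_subset_Iic_self) fun z => ?_
    · filter_upwards [self_mem_nhdsWithin] with t ht
      exact prod_mono_right (Iic_subset_Iic.2 (le_of_lt ht))
    · by_cases hz : z.2 < s
      · filter_upwards [Ioo_mem_nhdsLT hz] with t ht
        simp [hz, ht.1.le]
      · filter_upwards [self_mem_nhdsWithin] with t ht
        have : ¬ z.2 ≤ t := fun h => hz (h.trans_lt ht)
        simp [hz, this]
  have := ((key c (h s).1).sub (key μ (h s).2.1)).const_add 1
  exact this.congr fun t => (h t).2.2.symm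

theorem apply_zero (h : IsPathIntegral c μ f l) (hc : c (univ ×ˢ {0}) = 0)
    (hμ : μ (univ ×ˢ {0}) = 0) : l 0 = 1 := by
  have h0 : Iic (0 : ℝ≥0) = {0} := by ext; simp
  rw [(h 0).2.2, h0, setIntegral_measure_zero _ hc, setIntegral_measure_zero _ hμ]
  simp

theorem leftLim_eq (h : IsPathIntegral c μ f l) (hc : c (univ ×ˢ {0}) = 0)
    (hμ : μ (univ ×ˢ {0}) = 0) (s : ℝ≥0) :
    Function.leftLim l s =
      1 + ((∫ z in univ ×ˢ Iio s, f z ∂c) - ∫ z in univ ×ˢ Iio s, f z ∂μ) := by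
  rcases eq_or_ne s 0 with rfl | hs
  · rw [leftLim_zero_nnreal, h.apply_zero hc hμ]
    simp
  · have : (𝓝[<] s).NeBot := nhdsLT_neBot_of_exists_lt ⟨0, pos_iff_ne_zero.2 hs⟩
    exact leftLim_eq_of_tendsto (h.tendsto_nhdsLT s)

theorem tendsto_prevGrid (h : IsPathIntegral c μ f l) (s : ℝ≥0) :
    Tendsto (fun k => l (prevGrid k s)) atTop (𝓝 (Function.leftLim l s)) := by
  rcases eq_or_ne s 0 with rfl | hs
  · simp [prevGrid_zero, leftLim_zero_nnreal]
  · exact (tendsto_leftLim_of_tendsto ⟨_, h.tendsto_nhdsLT s⟩).comp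
      (tendsto_prevGrid_nhdsLT (pos_iff_ne_zero.2 hs))

/-- Right continuity by dominated convergence on `[0, s + 1]`, along sequences that may touch `s`,
as the grid points after `s` do. -/
theorem tendsto_of_ge (h : IsPathIntegral c μ f l) {s : ℝ≥0} {φ : ℕ → ℝ≥0} (hs : ∀ k, s ≤ φ k)
    (hφ : Tendsto φ atTop (𝓝 s)) : Tendsto (fun k => l (φ k)) atTop (𝓝 (l s)) := by
  have key : ∀ m : Measure (E × ℝ≥0), IntegrableOn f (univ ×ˢ Iic (s + 1)) m →
      Tendsto (fun k => ∫ z in univ ×ˢ Iic (φ k), f z ∂m) atTop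
        (𝓝 (∫ z in univ ×ˢ Iic s, f z ∂m)) := by
    intro m hm
    refine tendsto_setIntegral_of_eventually (fun k => measurableSet_univ_prod_Iic _)
      (measurableSet_univ_prod_Iic s) hm ?_
      (prod_mono_right (Iic_subset_Iic.2 le_self_add)) fun z => ?_
    · filter_upwards [hφ.eventually_le_const (lt_add_one s)] with k hk
      exact prod_mono_right (Iic_subset_Iic.2 hk)
    · by_cases hz : z.2 ≤ s
      · exact Eventually.of_forall fun k => by simp [hz, hz.trans (hs k)]
      · filter_upwards [hφ.eventually_lt_const (not_le.1 hz)] with k hk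
        exact iff_of_false (fun h : z ∈ univ ×ˢ Iic (φ k) => hk.not_ge h.2) fun h => hz h.2
  rw [(h s).2.2]
  refine (((key c (h _).1).sub (key μ (h _).2.1)).const_add 1).congr fun k => ?_
  exact (h (φ k)).2.2.symm

/-- The measure `μ` does not charge time slices, so the jumps of `l` come from `c` alone. -/
theorem sub_leftLim (h : IsPathIntegral c μ f l) (hc : c (univ ×ˢ {0}) = 0)
    (hμ : ∀ s, μ (univ ×ˢ {s}) = 0) (s : ℝ≥0) :
    l s - Function.leftLim l s = ∫ z in univ ×ˢ {s}, f z ∂c := by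
  have hunion : (univ ×ˢ Iic s : Set (E × ℝ≥0)) = univ ×ˢ Iio s ∪ univ ×ˢ {s} := by
    rw [← prod_union, Iio_union_right]
  have hdisj : Disjoint (univ ×ˢ Iio s : Set (E × ℝ≥0)) (univ ×ˢ {s}) := by
    refine Set.disjoint_left.2 fun z hz hz' => ?_
    have h1 : z.2 < s := hz.2
    have h2 : z.2 = s := hz'.2
    exact h1.ne h2
  have key : ∀ m : Measure (E × ℝ≥0), IntegrableOn f (univ ×ˢ Iic s) m →
      ∫ z in univ ×ˢ Iic s, f z ∂m =
        (∫ z in univ ×ˢ Iio s, f z ∂m) + ∫ z in univ ×ˢ {s}, f z ∂m := by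
    intro m hm
    rw [hunion] at hm ⊢
    exact setIntegral_union hdisj (measurableSet_slice s) (hm.mono_set subset_union_left)
      (hm.mono_set subset_union_right)
  rw [h.leftLim_eq hc (hμ 0), (h s).2.2, key c (h s).1, key μ (h s).2.1,
    setIntegral_measure_zero _ (hμ s)]
  ring

end IsPathIntegral

end Path

/-! ### The likelihood model -/

set_option linter.unusedSectionVars false

section Model

variable {Ω E : Type*} {mΩ : MeasurableSpace Ω} [MeasurableSpace E]

/-- The predictable intensity `λ(u, s, D_{s-}, η_{s-})`. -/
noncomputable def leftIntensity (lam : E → ℝ≥0 → ℝ → Measure (E × ℝ≥0) → ℝ≥0)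
    (C : Ω → Measure (E × ℝ≥0)) (D : ℝ≥0 → Ω → ℝ) (x : Ω × E × ℝ≥0) : ℝ≥0 :=
  lam x.2.1 x.2.2 (Function.leftLim (fun s => D s x.1) x.2.2) (configLeft (C x.1) x.2.2)

/-- The predictable likelihood ratio `λ(u, s, D_{s-}, η_{s-}) / λ_Q(u, s)`. -/
noncomputable def intensityRatio (lam : E → ℝ≥0 → ℝ → Measure (E × ℝ≥0) → ℝ≥0)
    (lamQ : E → ℝ≥0 → ℝ≥0) (C : Ω → Measure (E × ℝ≥0)) (D : ℝ≥0 → Ω → ℝ)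
    (x : Ω × E × ℝ≥0) : ℝ≥0 :=
  leftIntensity lam C D x / lamQ x.2.1 x.2.2

/-- The standing assumptions on `C`, `D`, `L`, `P`. -/
structure IsLikelihoodModel (Q : Measure Ω) (ℱ : Filtration ℝ≥0 mΩ) (ν : Measure E)
    (lamQ : E → ℝ≥0 → ℝ≥0) (lam : E → ℝ≥0 → ℝ → Measure (E × ℝ≥0) → ℝ≥0)
    (C : Ω → Measure (E × ℝ≥0)) (D L : ℝ≥0 → Ω → ℝ) (P : Measure Ω) : Prop where
  measurable_lamQ : Measurable (fun z : E × ℝ≥0 => lamQ z.1 z.2)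
  measurable_lam : Measurable (fun z : E × ℝ≥0 × ℝ × Measure (E × ℝ≥0) =>
    lam z.1 z.2.1 z.2.2.1 z.2.2.2)
  lam_eq_zero : ∀ u s x m, lamQ u s = 0 → lam u s x m = 0
  poisson : IsPoissonRandomMeasure C (meanMeasure ν lamQ) Q
  cadlag : ∀ ω, IsCadlagPath (fun t => D t ω)
  compatible : IsCompatible C ℱ Q
  adapted : ∀ t, Measurable[ℱ t] (D t)
  equation : SolvesLikelihoodEquation ν lam lamQ C D L Q
  martingale : Martingale L ℱ Q
  density : ∀ t (F : Set Ω), MeasurableSet[ℱ t] F → P.real F = ∫ ω in F, L t ω ∂Q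

theorem measurable_leftIntensity {ℱ : Filtration ℝ≥0 mΩ}
    {lam : E → ℝ≥0 → ℝ → Measure (E × ℝ≥0) → ℝ≥0}
    (hlam : Measurable (fun z : E × ℝ≥0 × ℝ × Measure (E × ℝ≥0) =>
      lam z.1 z.2.1 z.2.2.1 z.2.2.2)) {C : Ω → Measure (E × ℝ≥0)} {D : ℝ≥0 → Ω → ℝ}
    (hD : ∀ ω, IsCadlagPath (fun t => D t ω)) (hDa : ∀ t, Measurable[ℱ t] (D t))
    (hCa : ∀ t, Measurable[ℱ t] fun ω => (C ω).restrict (univ ×ˢ Iic t)) :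
    Measurable[predictable E ℱ] (leftIntensity lam C D) := by
  have h1 := measurable_leftLim_predictable (E := E) hD hDa
  have h2 := measurable_configLeft_predictable hCa
  have h3 := measurable_predictable_snd (E := E) ℱ
  let _ := predictable E ℱ
  exact hlam.comp ((measurable_fst.comp h3).prodMk
    ((measurable_snd.comp h3).prodMk (h1.prodMk h2)))

theorem measurable_intensityRatio {ℱ : Filtration ℝ≥0 mΩ}
    {lam : E → ℝ≥0 → ℝ → Measure (E × ℝ≥0) → ℝ≥0}
    (hlam : Measurable (fun z : E × ℝ≥0 × ℝ × Measure (E × ℝ≥0) =>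
      lam z.1 z.2.1 z.2.2.1 z.2.2.2)) {lamQ : E → ℝ≥0 → ℝ≥0}
    (hlamQ : Measurable (fun z : E × ℝ≥0 => lamQ z.1 z.2)) {C : Ω → Measure (E × ℝ≥0)}
    {D : ℝ≥0 → Ω → ℝ} (hD : ∀ ω, IsCadlagPath (fun t => D t ω)) (hDa : ∀ t, Measurable[ℱ t] (D t))
    (hCa : ∀ t, Measurable[ℱ t] fun ω => (C ω).restrict (univ ×ˢ Iic t)) :
    Measurable[predictable E ℱ] (intensityRatio lam lamQ C D) := by
  have h1 := measurable_leftIntensity hlam hD hDa hCa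
  have h3 := measurable_predictable_snd (E := E) ℱ
  let _ := predictable E ℱ
  exact h1.div (hlamQ.comp h3)

namespace IsLikelihoodModel

variable {Q : Measure Ω} [IsProbabilityMeasure Q] {ℱ : Filtration ℝ≥0 mΩ} {ν : Measure E}
  [SigmaFinite ν] {lamQ : E → ℝ≥0 → ℝ≥0} {lam : E → ℝ≥0 → ℝ → Measure (E × ℝ≥0) → ℝ≥0}
  {C : Ω → Measure (E × ℝ≥0)} {D L : ℝ≥0 → Ω → ℝ} {P : Measure Ω}

theorem likelihoodIntegrand_eq (lam : E → ℝ≥0 → ℝ → Measure (E × ℝ≥0) → ℝ≥0)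
    (lamQ : E → ℝ≥0 → ℝ≥0) (C : Ω → Measure (E × ℝ≥0)) (D L : ℝ≥0 → Ω → ℝ) (ω : Ω)
    (z : E × ℝ≥0) :
    likelihoodIntegrand lam lamQ (C ω) (fun s => D s ω) (fun s => L s ω) z =
      ((intensityRatio lam lamQ C D (ω, z) : ℝ) - 1) * Function.leftLim (fun s => L s ω) z.2 := by
  simp [likelihoodIntegrand, intensityRatio, leftIntensity]

variable (M : IsLikelihoodModel Q ℱ ν lamQ lam C D L P)
include M

theorem measurable_left : Measurable[predictable E ℱ] (leftIntensity lam C D) :=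
  measurable_leftIntensity M.measurable_lam M.cadlag M.adapted M.compatible.adapted

theorem measurable_ratio : Measurable[predictable E ℱ] (intensityRatio lam lamQ C D) :=
  measurable_intensityRatio M.measurable_lam M.measurable_lamQ M.cadlag M.adapted
    M.compatible.adapted

/-- Division by zero gives `0` in `ℝ≥0`. Where `lamQ` vanishes the identity survives because `lam`
vanishes too. -/
theorem ratio_mul (x : Ω × E × ℝ≥0) :
    intensityRatio lam lamQ C D x * lamQ x.2.1 x.2.2 = leftIntensity lam C D x := by
  by_cases h : lamQ x.2.1 x.2.2 = 0
  · rw [h, mul_zero]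
    exact (M.lam_eq_zero _ _ _ _ h).symm
  · exact div_mul_cancel₀ _ h

theorem ae_isPathIntegral : ∀ᵐ ω ∂Q, IsPathIntegral (C ω) (meanMeasure ν lamQ)
    (fun z => ((intensityRatio lam lamQ C D (ω, z) : ℝ) - 1) *
      Function.leftLim (fun s => L s ω) z.2) (fun s => L s ω) := by
  filter_upwards [M.equation] with ω hω
  have : (fun z => ((intensityRatio lam lamQ C D (ω, z) : ℝ) - 1) *
      Function.leftLim (fun s => L s ω) z.2) =
      likelihoodIntegrand lam lamQ (C ω) (fun s => D s ω) (fun s => L s ω) :=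
    funext fun z => (likelihoodIntegrand_eq lam lamQ C D L ω z).symm
  rw [this]
  exact hω

theorem ae_slice_zero (s : ℝ≥0) : ∀ᵐ ω ∂Q, C ω (univ ×ˢ {s}) = 0 :=
  M.poisson.ae_eq_zero (measurableSet_slice s) (meanMeasure_slice ν lamQ s)

theorem ae_apply_zero : ∀ᵐ ω ∂Q, L 0 ω = 1 := by
  filter_upwards [M.ae_isPathIntegral, M.ae_slice_zero 0] with ω h h0
  exact h.apply_zero h0 (meanMeasure_slice ν lamQ 0)

/-- At the points of `C`, `L(s) = ρ L(s-)`. -/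
theorem ae_jump : ∀ᵐ ω ∂Q, ∀ᵐ z ∂C ω, L z.2 ω =
    (intensityRatio lam lamQ C D (ω, z) : ℝ) * Function.leftLim (fun s => L s ω) z.2 := by
  filter_upwards [M.ae_isPathIntegral, M.ae_slice_zero 0,
    M.poisson.ae_simple (meanMeasure_slice ν lamQ)] with ω h h0 hsimple
  have := M.poisson.hasFiniteCover.sigmaFinite ω
  have hr : Measurable fun z => (intensityRatio lam lamQ C D (ω, z) : ℝ) - 1 :=
    ((M.measurable_ratio.mono (predictable_le ℱ) le_rfl).comp
      measurable_prodMk_left).coe_nnreal_real.sub_const 1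
  filter_upwards [ae_eq_setIntegral_slice (M.poisson.counting ω) hsimple hr] with z hz
  have hsub := h.sub_leftLim h0 (meanMeasure_slice ν lamQ) z.2
  -- On one slice `L(s-)` is a constant factor, and the remaining integral of `ρ - 1` is its value
  -- at the only point of the slice.
  rw [setIntegral_congr_fun (g := fun z' => ((intensityRatio lam lamQ C D (ω, z') : ℝ) - 1) *
    Function.leftLim (fun s => L s ω) z.2) (measurableSet_slice z.2), integral_mul_const, hz] at hsub
  · linarith
  · intro z' hz'
    have : z'.2 = z.2 := hz'.2
    simp only [this]

/-- `L` has no fixed times of discontinuity. -/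
theorem ae_leftLim_eq (s : ℝ≥0) : ∀ᵐ ω ∂Q, Function.leftLim (fun r => L r ω) s = L s ω := by
  filter_upwards [M.ae_isPathIntegral, M.ae_slice_zero 0, M.ae_slice_zero s] with ω h h0 hs
  have hsub := h.sub_leftLim h0 (meanMeasure_slice ν lamQ) s
  rw [setIntegral_measure_zero _ hs] at hsub
  linarith

theorem integrable (t : ℝ≥0) : Integrable (L t) Q := M.martingale.integrable t

/-- Over every set of `ℱ t` the integral of `L t` is a value of `P.real`, hence nonnegative. Only
such sets are available, so the argument runs under the trimmed measure. -/
theorem ae_nonneg (t : ℝ≥0) : 0 ≤ᵐ[Q] L t := by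
  have hm : StronglyMeasurable[ℱ t] (L t) := M.martingale.1 t
  have := ae_nonneg_of_forall_setIntegral_nonneg (μ := Q.trim (ℱ.le t)) (f := L t)
    ((M.integrable t).trim (ℱ.le t) hm) fun F hF _ => by
      rw [← setIntegral_trim (ℱ.le t) hm hF, ← M.density t F hF]
      exact measureReal_nonneg
  exact ae_of_ae_trim _ this

theorem ae_forall_nonneg : ∀ᵐ ω ∂Q, ∀ t, 0 ≤ L t ω := by
  have hgrid : ∀ᵐ ω ∂Q, ∀ k n : ℕ, 0 ≤ L ((n : ℝ≥0) / 2 ^ k) ω :=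
    ae_all_iff.2 fun k => ae_all_iff.2 fun n => M.ae_nonneg _
  filter_upwards [hgrid, M.ae_isPathIntegral] with ω h hp t
  exact ge_of_tendsto' (hp.tendsto_of_ge (fun k => le_nextGrid k t) (tendsto_nextGrid t))
    fun k => h k _

/-- The mass is `E_Q L(0) = 1`. Finiteness of `P` is not assumed: `P.real univ = 1` excludes
infinite mass because `toReal ∞ = 0`. -/
theorem isProbabilityMeasure : IsProbabilityMeasure P := by
  have h := M.density 0 univ MeasurableSet.univ
  rw [setIntegral_univ, integral_congr_ae M.ae_apply_zero] at h
  simp only [integral_const, probReal_univ, smul_eq_mul, mul_one] at h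
  refine ⟨?_⟩
  rw [measureReal_def] at h
  rwa [← ENNReal.toReal_eq_one_iff]

theorem measurable_density (t : ℝ≥0) : Measurable[ℱ t] fun ω => ENNReal.ofReal (L t ω) :=
  (M.martingale.1 t).measurable.ennreal_ofReal

theorem measure_eq (t : ℝ≥0) {F : Set Ω} (hF : MeasurableSet[ℱ t] F) :
    P F = ∫⁻ ω in F, ENNReal.ofReal (L t ω) ∂Q := by
  have := M.isProbabilityMeasure
  rw [← ofReal_integral_eq_lintegral_ofReal (M.integrable t).integrableOn
    (ae_restrict_of_ae (M.ae_nonneg t)), ← M.density t F hF, measureReal_def,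
    ENNReal.ofReal_toReal (measure_ne_top _ _)]

theorem lintegral_eq (t : ℝ≥0) {X : Ω → ℝ≥0∞} (hX : Measurable[ℱ t] X) :
    ∫⁻ ω, X ω ∂P = ∫⁻ ω, ENNReal.ofReal (L t ω) * X ω ∂Q := by
  have hle := ℱ.le t
  have hd := M.measurable_density t
  have htrim : P.trim hle = (Q.withDensity fun ω => ENNReal.ofReal (L t ω)).trim hle := by
    refine @Measure.ext _ (ℱ t) _ _ fun F hF => ?_
    rw [trim_measurableSet_eq _ hF, trim_measurableSet_eq _ hF, withDensity_apply _ (hle _ hF),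
      M.measure_eq t hF]
  rw [← lintegral_trim hle hX, htrim, lintegral_trim hle hX,
    lintegral_withDensity_eq_lintegral_mul _ (hd.mono hle le_rfl) (hX.mono hle le_rfl)]
  rfl

end IsLikelihoodModel

end Model
/-! ### The compensator of `C` under `P` -/

/-- A simple counting measure puts mass at most `N` on the points that have fewer than `N`
predecessors. -/
theorem measure_configLeft_lt_le {E : Type*} [MeasurableSpace E] {c : Measure (E × ℝ≥0)}
    (hc : ∀ B, MeasurableSet B → ∃ n : ℕ∞, c B = (n : ℝ≥0∞))
    (h1 : ∀ s, c (univ ×ˢ {s}) ≤ 1) {U : Set (E × ℝ≥0)} (hU : MeasurableSet U) (N : ℕ) :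
    c {z | z ∈ U ∧ configLeft c z.2 U < N} ≤ N := by
  have happ : ∀ s, configLeft c s U = c (U ∩ univ ×ˢ Iio s) := fun s => by
    rw [configLeft, Measure.restrict_apply hU]
  have hmono : ∀ {s s'}, s ≤ s' → configLeft c s' U < N → configLeft c s U < N := by
    intro s s' hs h
    refine lt_of_le_of_lt ?_ h
    rw [happ, happ]
    exact measure_mono (inter_subset_inter_right _ (prod_mono_right (Iio_subset_Iio hs)))
  -- The times with fewer than `N` predecessors form an initial segment. If it has a last time `b`,
  -- there are at most `N - 1` points before `b` and one at `b`. Otherwise the points lie in a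
  -- countable directed union of sets `U ∩ (E × [0, q))`, each of mass below `N`.
  by_cases hmax : ∃ b, configLeft c b U < N ∧ ∀ s, configLeft c s U < N → s ≤ b
  · obtain ⟨b, hb, hb'⟩ := hmax
    have hsub : {z | z ∈ U ∧ configLeft c z.2 U < N} ⊆ U ∩ univ ×ˢ Iio b ∪ univ ×ˢ {b} := by
      rintro z ⟨hz, hz'⟩
      rcases (hb' _ hz').lt_or_eq with h | h
      · exact Or.inl ⟨hz, trivial, h⟩
      · exact Or.inr ⟨trivial, h⟩
    refine (measure_mono hsub).trans ((measure_union_le _ _).trans ?_)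
    rw [happ] at hb
    obtain ⟨n, hn⟩ := hc _ (hU.inter (measurableSet_univ_prod_Iio b))
    rw [hn] at hb ⊢
    have hlt : n < N := by exact_mod_cast hb
    have hle : n + 1 ≤ N := Order.add_one_le_of_lt hlt
    calc (n : ℝ≥0∞) + c (univ ×ˢ {b}) ≤ (n : ℝ≥0∞) + 1 := by gcongr; exact h1 b
      _ ≤ N := by exact_mod_cast hle
  · push Not at hmax
    obtain ⟨d, hdc, hdd⟩ := TopologicalSpace.exists_countable_dense ℝ≥0
    set T := {q | q ∈ d ∧ configLeft c q U < N} with hT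
    have hTc : T.Countable := hdc.mono fun q hq => hq.1
    have hsub : {z | z ∈ U ∧ configLeft c z.2 U < N} ⊆ ⋃ q ∈ T, (U ∩ univ ×ˢ Iio q) := by
      rintro z ⟨hz, hz'⟩
      obtain ⟨s', hs', hlt⟩ := hmax _ hz'
      obtain ⟨q, hq, hq1, hq2⟩ := hdd.exists_between hlt
      exact mem_iUnion₂.2 ⟨q, ⟨hq, hmono hq2.le hs'⟩, hz, trivial, hq1⟩
    refine (measure_mono hsub).trans ?_
    rw [measure_biUnion_eq_iSup hTc]
    · refine iSup₂_le fun q hq => ?_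
      rw [← happ]
      exact hq.2.le
    · intro q hq q' hq'
      refine ⟨max q q', ?_, ?_, ?_⟩
      · rcases max_choice q q' with h | h <;> rw [h] <;> assumption
      · exact inter_subset_inter_right _ (prod_mono_right (Iio_subset_Iio (le_max_left _ _)))
      · exact inter_subset_inter_right _ (prod_mono_right (Iio_subset_Iio (le_max_right _ _)))

section Compensator

set_option linter.unusedSectionVars false

variable {Ω E : Type*} {mΩ : MeasurableSpace Ω} [MeasurableSpace E]

/-- A predictable version of `L(s-)`. -/
noncomputable def leftDensity (L : ℝ≥0 → Ω → ℝ) (x : Ω × E × ℝ≥0) : ℝ≥0∞ :=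
  limsup (fun k => ENNReal.ofReal (L (prevGrid k x.2.2) x.1)) atTop

namespace IsLikelihoodModel

variable {Q : Measure Ω} [IsProbabilityMeasure Q] {ℱ : Filtration ℝ≥0 mΩ} {ν : Measure E}
  [SigmaFinite ν] {lamQ : E → ℝ≥0 → ℝ≥0} {lam : E → ℝ≥0 → ℝ → Measure (E × ℝ≥0) → ℝ≥0}
  {C : Ω → Measure (E × ℝ≥0)} {D L : ℝ≥0 → Ω → ℝ} {P : Measure Ω}
  (M : IsLikelihoodModel Q ℱ ν lamQ lam C D L P)
include M

/-- The paths of `L` are regular only almost surely. A `limsup` along the grid is predictable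
without exception and equals `L(s-)` on regular paths. -/
theorem measurable_leftDensity :
    Measurable[predictable E ℱ] (leftDensity L : Ω × E × ℝ≥0 → ℝ≥0∞) := by
  have h := fun k => measurable_prevGrid_predictable (E := E) M.measurable_density k
  let _ := predictable E ℱ
  exact Measurable.limsup h

theorem ae_leftDensity_eq : ∀ᵐ ω ∂Q, ∀ z : E × ℝ≥0,
    leftDensity L (ω, z) = ENNReal.ofReal (Function.leftLim (fun s => L s ω) z.2) := by
  filter_upwards [M.ae_isPathIntegral] with ω h z
  exact ((ENNReal.continuous_ofReal.tendsto _).comp (h.tendsto_prevGrid z.2)).limsup_eq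

theorem ae_leftDensity_eq_density (z : E × ℝ≥0) :
    ∀ᵐ ω ∂Q, leftDensity L (ω, z) = ENNReal.ofReal (L z.2 ω) := by
  filter_upwards [M.ae_leftDensity_eq, M.ae_leftLim_eq z.2] with ω h h'
  rw [h, h']

theorem ae_density_jump : ∀ᵐ ω ∂Q, ∀ᵐ z ∂C ω, ENNReal.ofReal (L z.2 ω) =
    intensityRatio lam lamQ C D (ω, z) * leftDensity L (ω, z) := by
  filter_upwards [M.ae_leftDensity_eq, M.ae_jump] with ω h h'
  filter_upwards [h'] with z hz
  rw [hz, h, ENNReal.ofReal_mul NNReal.zero_le_coe, ENNReal.ofReal_coe_nnreal]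

/-- Truncated subtraction is the positive part, and `(L - a)⁺` is a `Q`-submartingale. On `{L r >
a}` the martingale property applies together with `x ≤ (x - a)⁺ + a`; elsewhere the left integrand
vanishes. Finiteness of `E_Q X` permits cancelling `a E_Q[X; L r > a]`. -/
theorem lintegral_density_sub_le {r t : ℝ≥0} (hrt : r ≤ t) {X : Ω → ℝ≥0∞}
    (hX : Measurable[ℱ r] X) (hfin : ∫⁻ ω, X ω ∂Q ≠ ∞) (a : ℝ≥0) :
    ∫⁻ ω, (ENNReal.ofReal (L r ω) - a) * X ω ∂Q ≤
      ∫⁻ ω, (ENNReal.ofReal (L t ω) - a) * X ω ∂Q := by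
  have hdr := M.measurable_density r
  set F := {ω | (a : ℝ≥0∞) < ENNReal.ofReal (L r ω)} with hF
  have hFm : MeasurableSet[ℱ r] F := hdr measurableSet_Ioi
  have hFm' : MeasurableSet F := ℱ.le r _ hFm
  have hXF : Measurable[ℱ r] (F.indicator X) := hX.indicator hFm
  have hXFm : Measurable (F.indicator X) := hXF.mono (ℱ.le r) le_rfl
  have hdm : ∀ s, Measurable fun ω => ENNReal.ofReal (L s ω) := fun s =>
    (M.measurable_density s).mono (ℱ.le s) le_rfl
  have hfinF : (a : ℝ≥0∞) * ∫⁻ ω, F.indicator X ω ∂Q ≠ ∞ :=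
    ENNReal.mul_ne_top ENNReal.coe_ne_top
      (ne_top_of_le_ne_top hfin (lintegral_mono (indicator_le_self F X)))
  have h1 : ∫⁻ ω, (ENNReal.ofReal (L r ω) - a) * X ω ∂Q + a * ∫⁻ ω, F.indicator X ω ∂Q =
      ∫⁻ ω, ENNReal.ofReal (L r ω) * F.indicator X ω ∂Q := by
    rw [← lintegral_const_mul _ hXFm, ← lintegral_add_right _ (hXFm.const_mul _)]
    refine lintegral_congr fun ω => ?_
    by_cases hω : ω ∈ F
    · rw [indicator_of_mem hω, ← add_mul, tsub_add_cancel_of_le (le_of_lt hω)]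
    · have : ENNReal.ofReal (L r ω) ≤ a := not_lt.1 hω
      simp [hω, tsub_eq_zero_of_le this]
  have h2 : ∫⁻ ω, ENNReal.ofReal (L r ω) * F.indicator X ω ∂Q =
      ∫⁻ ω, ENNReal.ofReal (L t ω) * F.indicator X ω ∂Q := by
    rw [← M.lintegral_eq r hXF, ← M.lintegral_eq t (hXF.mono (ℱ.mono hrt) le_rfl)]
  refine (ENNReal.add_le_add_iff_right hfinF).1 ?_
  rw [h1, h2, ← lintegral_const_mul _ hXFm, ← lintegral_add_right _ (hXFm.const_mul _)]
  refine lintegral_mono fun ω => ?_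
  by_cases hω : ω ∈ F
  · simp only [indicator_of_mem hω]
    rw [← add_mul]
    gcongr
    exact le_tsub_add
  · simp [hω]

theorem measurable_measure_section {G : Set (Ω × E × ℝ≥0)} (hG : MeasurableSet[predictable E ℱ] G)
    {r : ℝ≥0} (hGr : ∀ x ∈ G, x.2.2 ≤ r) :
    Measurable[ℱ r] fun ω => C ω (Prod.mk ω ⁻¹' G) := by
  have hi : Measurable[predictable E ℱ] (G.indicator fun _ => (1 : ℝ≥0∞)) :=
    measurable_const.indicator hG
  have h := measurable_setLIntegral_predictable M.poisson.hasFiniteCover M.compatible.adapted hi r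
  convert h using 2 with ω
  have hGm : MeasurableSet (Prod.mk ω ⁻¹' G) := measurable_prodMk_left (predictable_le ℱ _ hG)
  have heq : (fun z => G.indicator (fun _ => (1 : ℝ≥0∞)) (ω, z)) =
      (Prod.mk ω ⁻¹' G).indicator 1 := rfl
  rw [heq, lintegral_indicator_one hGm, Measure.restrict_apply hGm, inter_eq_left.2]
  exact fun z hz => ⟨trivial, hGr _ hz⟩

end IsLikelihoodModel

end Compensator
section Compensator

set_option linter.unusedSectionVars false

variable {Ω E : Type*} {mΩ : MeasurableSpace Ω} [MeasurableSpace E]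

namespace IsLikelihoodModel

variable {Q : Measure Ω} [IsProbabilityMeasure Q] {ℱ : Filtration ℝ≥0 mΩ} {ν : Measure E}
  [SigmaFinite ν] {lamQ : E → ℝ≥0 → ℝ≥0} {lam : E → ℝ≥0 → ℝ → Measure (E × ℝ≥0) → ℝ≥0}
  {C : Ω → Measure (E × ℝ≥0)} {D L : ℝ≥0 → Ω → ℝ} {P : Measure Ω}
  (M : IsLikelihoodModel Q ℱ ν lamQ lam C D L P)
include M

theorem tendsto_lintegral_density_sub (t : ℝ≥0) :
    Tendsto (fun a : ℕ => ∫⁻ ω, (ENNReal.ofReal (L t ω) - (a : ℝ≥0)) ∂Q) atTop (𝓝 0) := by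
  have hm : Measurable fun ω => ENNReal.ofReal (L t ω) :=
    (M.measurable_density t).mono (ℱ.le t) le_rfl
  have h := tendsto_lintegral_of_dominated_convergence (μ := Q)
    (F := fun (a : ℕ) ω => ENNReal.ofReal (L t ω) - (a : ℝ≥0)) (f := fun _ => 0)
    (fun ω => ENNReal.ofReal (L t ω)) (fun a => hm.sub_const _)
    (fun a => Eventually.of_forall fun ω => tsub_le_self)
    (M.integrable t).lintegral_lt_top.ne (Eventually.of_forall fun ω => by
      refine tendsto_const_nhds.congr' ?_
      obtain ⟨n, hn⟩ := exists_nat_ge (L t ω)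
      filter_upwards [eventually_ge_atTop n] with a ha
      rw [eq_comm, tsub_eq_zero_iff_le, ← ENNReal.ofReal_coe_nnreal]
      exact ENNReal.ofReal_le_ofReal (hn.trans (by exact_mod_cast ha)))
  simpa using h

/-- Change of measure for the number of points of `C` in a predictable set that contains a bounded
number of points. -/
theorem lintegral_section_eq {G : Set (Ω × E × ℝ≥0)} (hG : MeasurableSet[predictable E ℱ] G)
    {t : ℝ≥0} (hGt : ∀ x ∈ G, x.2.2 ≤ t) (K : ℕ)
    (hK : ∀ᵐ ω ∂Q, C ω (Prod.mk ω ⁻¹' G) ≤ K) :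
    ∫⁻ ω, C ω (Prod.mk ω ⁻¹' G) ∂P =
      ∫⁻ ω, ∫⁻ z, G.indicator (fun x => intensityRatio lam lamQ C D x * leftDensity L x) (ω, z)
        ∂C ω ∂Q := by
  set κ : Kernel Ω (E × ℝ≥0) := ⟨C, M.poisson.measurable⟩ with hκ
  have hκs : IsSFiniteKernel κ := M.poisson.hasFiniteCover.isSFiniteKernel M.poisson.measurable
  have hGm : MeasurableSet G := predictable_le ℱ _ hG
  set g : Ω × E × ℝ≥0 → ℝ≥0∞ := fun x => intensityRatio lam lamQ C D x * leftDensity L x with hg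
  have hgm : Measurable g :=
    (M.measurable_ratio.mono (predictable_le ℱ) le_rfl).coe_nnreal_ennreal.mul
      (M.measurable_leftDensity.mono (predictable_le ℱ) le_rfl)
  set m := (Q ⊗ₘ κ).restrict G with hm
  have hgint : ∫⁻ ω, ∫⁻ z, G.indicator g (ω, z) ∂C ω ∂Q = ∫⁻ x, g x ∂m := by
    rw [hm, ← lintegral_indicator hGm]
    exact (Measure.lintegral_compProd (κ := κ) (hgm.indicator hGm)).symm
  rw [hgint]
  have hdm : ∀ s, Measurable fun ω => ENNReal.ofReal (L s ω) := fun s =>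
    (M.measurable_density s).mono (ℱ.le s) le_rfl
  have hCm : ∀ {A : Set (Ω × E × ℝ≥0)}, MeasurableSet A →
      Measurable fun ω => C ω (Prod.mk ω ⁻¹' A) := fun hA => Kernel.measurable_kernel_prodMk_left
        (κ := κ) hA
  have hmuniv : m univ ≤ K := by
    rw [hm, Measure.restrict_apply_univ, Measure.compProd_apply hGm]
    calc ∫⁻ ω, C ω (Prod.mk ω ⁻¹' G) ∂Q ≤ ∫⁻ _, (K : ℝ≥0∞) ∂Q := lintegral_mono_ae hK
      _ = K := by simp
  have hfin : IsFiniteMeasure m := ⟨hmuniv.trans_lt (ENNReal.natCast_lt_top K)⟩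
  -- the dyadic cells
  set cell : ℕ → ℕ → Set (Ω × E × ℝ≥0) := fun k n => {x | ⌈x.2.2 * 2 ^ k⌉₊ = n} with hcell
  have hcellm : ∀ k n, MeasurableSet[predictable E ℱ] (cell k n) := fun k n =>
    measurable_predictable_snd ℱ ((Nat.measurable_ceil.comp (measurable_snd.mul_const _))
      (measurableSet_singleton n))
  have hcellm' : ∀ k n, MeasurableSet (cell k n) := fun k n => predictable_le ℱ _ (hcellm k n)
  have hcellU : ∀ k, ⋃ n, cell k n = univ := fun k => by
    ext x; simp [hcell]
  have hcelld : ∀ k, Pairwise (Function.onFun Disjoint (cell k)) := fun k n n' h =>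
    Set.disjoint_left.2 fun x hx hx' => h (Eq.trans (Eq.symm hx) hx')
  set r : ℕ → ℕ → ℝ≥0 := fun k n => min ((n : ℝ≥0) / 2 ^ k) t with hr
  have hrt : ∀ k n, r k n ≤ t := fun k n => min_le_right _ _
  have hcellr : ∀ k n, ∀ x ∈ G ∩ cell k n, x.2.2 ≤ r k n := by
    rintro k n x ⟨hx, hx'⟩
    refine le_min ?_ (hGt x hx)
    have : ⌈x.2.2 * 2 ^ k⌉₊ = n := hx'
    rw [← this]
    exact le_nextGrid k _
  set gk : ℕ → Ω × E × ℝ≥0 → ℝ≥0∞ := fun k x =>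
    ENNReal.ofReal (L (min (nextGrid k x.2.2) t) x.1) with hgk
  have hgkcell : ∀ k n, ∀ x ∈ cell k n, gk k x = ENNReal.ofReal (L (r k n) x.1) := by
    intro k n x hx
    have : ⌈x.2.2 * 2 ^ k⌉₊ = n := hx
    simp only [hgk, hr, nextGrid, this]
  have hgkm : ∀ k, Measurable (gk k) := by
    intro k B hB
    have : gk k ⁻¹' B = ⋃ n, ((fun x : Ω × E × ℝ≥0 => ENNReal.ofReal (L (r k n) x.1)) ⁻¹' B ∩
        cell k n) := by
      ext x
      simp only [mem_preimage, mem_iUnion, mem_inter_iff]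
      constructor
      · intro h
        exact ⟨⌈x.2.2 * 2 ^ k⌉₊, by rwa [← hgkcell k _ x rfl], rfl⟩
      · rintro ⟨n, h, hx⟩
        rwa [hgkcell k n x hx]
    rw [this]
    exact MeasurableSet.iUnion fun n => (((hdm _).comp measurable_fst) hB).inter (hcellm' k n)
  have hdecomp : ∀ k (φ : ℝ≥0∞ → ℝ≥0∞), Measurable φ → ∫⁻ x, φ (gk k x) ∂m =
      ∑' n, ∫⁻ ω, φ (ENNReal.ofReal (L (r k n) ω)) * C ω (Prod.mk ω ⁻¹' (G ∩ cell k n)) ∂Q := by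
    intro k φ hφ
    rw [← setLIntegral_univ, ← hcellU k, lintegral_iUnion (hcellm' k) (hcelld k)]
    refine tsum_congr fun n => ?_
    rw [setLIntegral_congr_fun (hcellm' k n) (g := fun x => φ (ENNReal.ofReal (L (r k n) x.1)))
      (fun x hx => by simp only [hgkcell k n x hx]), hm, Measure.restrict_restrict (hcellm' k n),
      inter_comm, ← lintegral_indicator (hGm.inter (hcellm' k n))]
    refine (Measure.lintegral_compProd (κ := κ)
      (((hφ.comp (hdm (r k n))).comp measurable_fst).indicator (hGm.inter (hcellm' k n)))).trans ?_
    refine lintegral_congr fun ω => ?_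
    have hsec : MeasurableSet (Prod.mk ω ⁻¹' (G ∩ cell k n)) :=
      measurable_prodMk_left (hGm.inter (hcellm' k n))
    change ∫⁻ z, (Prod.mk ω ⁻¹' (G ∩ cell k n)).indicator
      (fun _ => φ (ENNReal.ofReal (L (r k n) ω))) z ∂κ ω = _
    rw [lintegral_indicator_const hsec]
    rfl
  have hXm : ∀ k n, Measurable[ℱ (r k n)] fun ω => C ω (Prod.mk ω ⁻¹' (G ∩ cell k n)) :=
    fun k n => M.measurable_measure_section (hG.inter (hcellm k n)) (hcellr k n)
  have hXsum : ∀ k ω, ∑' n, C ω (Prod.mk ω ⁻¹' (G ∩ cell k n)) = C ω (Prod.mk ω ⁻¹' G) := by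
    intro k ω
    rw [← measure_iUnion, ← preimage_iUnion, ← inter_iUnion, hcellU, inter_univ]
    · exact fun n n' h => (((hcelld k h).mono inter_subset_right inter_subset_right)).preimage _
    · exact fun n => measurable_prodMk_left (hGm.inter (hcellm' k n))
  -- The number of points of `G` in a cell is known at the right end `r k n`, so its `P`-expectation
  -- carries the density `L (r k n)`. There is no error at any level.
  have hexact : ∀ k, ∫⁻ x, gk k x ∂m = ∫⁻ ω, C ω (Prod.mk ω ⁻¹' G) ∂P := by
    intro k
    rw [hdecomp k (fun y => y) measurable_id]
    simp_rw [← M.lintegral_eq _ (hXm k _)]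
    rw [← lintegral_tsum fun n => ((hXm k n).mono (ℱ.le _) le_rfl).aemeasurable]
    exact lintegral_congr fun ω => hXsum k ω
  -- Uniform integrability in `k`: the submartingale bound moves every weight to time `t`, and at
  -- most `K` points are counted.
  have htail : ∀ k (a : ℕ), ∫⁻ x, (gk k x - (a : ℝ≥0)) ∂m ≤
      K * ∫⁻ ω, (ENNReal.ofReal (L t ω) - (a : ℝ≥0)) ∂Q := by
    intro k a
    rw [hdecomp k (fun y => y - (a : ℝ≥0)) (measurable_id.sub_const _)]
    calc ∑' n, ∫⁻ ω, (ENNReal.ofReal (L (r k n) ω) - (a : ℝ≥0)) *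
          C ω (Prod.mk ω ⁻¹' (G ∩ cell k n)) ∂Q
        ≤ ∑' n, ∫⁻ ω, (ENNReal.ofReal (L t ω) - (a : ℝ≥0)) *
          C ω (Prod.mk ω ⁻¹' (G ∩ cell k n)) ∂Q := by
          refine ENNReal.tsum_le_tsum fun n => M.lintegral_density_sub_le (hrt k n) (hXm k n) ?_ _
          refine ((lintegral_mono_ae (g := fun _ => (K : ℝ≥0∞)) ?_).trans_lt (by simp)).ne
          filter_upwards [hK] with ω hω
          exact (measure_mono (preimage_mono inter_subset_left)).trans hω
      _ = ∫⁻ ω, (ENNReal.ofReal (L t ω) - (a : ℝ≥0)) * C ω (Prod.mk ω ⁻¹' G) ∂Q := by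
          refine (lintegral_tsum fun n => (((hdm t).sub_const (a : ℝ≥0)).mul
            ((hXm k n).mono (ℱ.le _) le_rfl)).aemeasurable).symm.trans ?_
          refine lintegral_congr fun ω => ?_
          simp only [Pi.mul_apply]
          rw [ENNReal.tsum_mul_left, hXsum]
      _ ≤ ∫⁻ ω, K * (ENNReal.ofReal (L t ω) - (a : ℝ≥0)) ∂Q := by
          refine lintegral_mono_ae ?_
          filter_upwards [hK] with ω hω
          rw [mul_comm]
          gcongr
      _ = _ := lintegral_const_mul _ ((hdm t).sub_const _)
  -- Right continuity gives the limit `L(s)`, which equals `ρ L(s-)` at the points of `C`.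
  have hlim : ∀ᵐ x ∂m, Tendsto (fun k => gk k x) atTop (𝓝 (g x)) := by
    refine (ae_restrict_iff' hGm).2 ?_
    have hset : MeasurableSet {x | x ∈ G → Tendsto (fun k => gk k x) atTop (𝓝 (g x))} := by
      have h1 : MeasurableSet {x | Tendsto (fun k => gk k x) atTop (𝓝 (g x))} :=
        measurableSet_tendsto_fun hgkm hgm
      have : {x | x ∈ G → Tendsto (fun k => gk k x) atTop (𝓝 (g x))} =
          Gᶜ ∪ {x | Tendsto (fun k => gk k x) atTop (𝓝 (g x))} := by
        ext x; simp [imp_iff_not_or]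
      rw [this]
      exact hGm.compl.union h1
    refine Measure.ae_compProd_of_ae_ae hset ?_
    filter_upwards [M.ae_density_jump, M.ae_isPathIntegral] with ω hω hpath
    change ∀ᵐ z ∂C ω, _
    filter_upwards [hω] with z hz hzG
    simp only [hgk, hg]
    rw [← hz]
    refine (ENNReal.continuous_ofReal.tendsto _).comp (hpath.tendsto_of_ge
      (fun k => le_min (le_nextGrid k _) (hGt _ hzG)) ?_)
    simpa [min_eq_left (hGt _ hzG)] using
      (tendsto_nextGrid z.2).min (tendsto_const_nhds (x := t))
  -- The upper bound truncates at `a`, lets `k` and then `a` tend to infinity, and uses the uniform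
  -- tail bound. The lower bound is Fatou's lemma.
  refine le_antisymm ?_ ?_
  · have hbound : ∀ a : ℕ, ∫⁻ ω, C ω (Prod.mk ω ⁻¹' G) ∂P ≤
        ∫⁻ x, g x ∂m + K * ∫⁻ ω, (ENNReal.ofReal (L t ω) - (a : ℝ≥0)) ∂Q := by
      intro a
      have hmin : Tendsto (fun k => ∫⁻ x, min (gk k x) (a : ℝ≥0) ∂m) atTop
          (𝓝 (∫⁻ x, min (g x) (a : ℝ≥0) ∂m)) := by
        refine tendsto_lintegral_of_dominated_convergence (fun _ => ((a : ℝ≥0) : ℝ≥0∞))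
          (fun k => (hgkm k).min measurable_const)
          (fun k => Eventually.of_forall fun x => min_le_right _ _) ?_ ?_
        · rw [lintegral_const]
          exact ENNReal.mul_ne_top ENNReal.coe_ne_top (measure_ne_top _ _)
        · filter_upwards [hlim] with x hx using hx.min tendsto_const_nhds
      have hle : ∀ k, ∫⁻ ω, C ω (Prod.mk ω ⁻¹' G) ∂P ≤ ∫⁻ x, min (gk k x) (a : ℝ≥0) ∂m +
          K * ∫⁻ ω, (ENNReal.ofReal (L t ω) - (a : ℝ≥0)) ∂Q := by
        intro k
        rw [← hexact k]
        calc ∫⁻ x, gk k x ∂m = ∫⁻ x, (min (gk k x) (a : ℝ≥0) + (gk k x - (a : ℝ≥0))) ∂m := by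
              refine lintegral_congr fun x => ?_
              rcases le_total (gk k x) (a : ℝ≥0) with h | h
              · rw [min_eq_left h, tsub_eq_zero_of_le h, add_zero]
              · rw [min_eq_right h, add_tsub_cancel_of_le h]
          _ = ∫⁻ x, min (gk k x) (a : ℝ≥0) ∂m + ∫⁻ x, (gk k x - (a : ℝ≥0)) ∂m :=
              lintegral_add_left ((hgkm k).min measurable_const) _
          _ ≤ _ := by gcongr; exact htail k a
      refine (ge_of_tendsto' (hmin.add_const _) hle).trans ?_
      gcongr
      exact min_le_left _ _
    have h0 : Tendsto (fun a : ℕ => ∫⁻ x, g x ∂m +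
        K * ∫⁻ ω, (ENNReal.ofReal (L t ω) - (a : ℝ≥0)) ∂Q) atTop (𝓝 (∫⁻ x, g x ∂m + K * 0)) :=
      (ENNReal.Tendsto.const_mul (M.tendsto_lintegral_density_sub t)
        (Or.inr (ENNReal.natCast_ne_top K))).const_add _
    simpa using ge_of_tendsto' h0 hbound
  · calc ∫⁻ x, g x ∂m = ∫⁻ x, liminf (fun k => gk k x) atTop ∂m := by
          refine lintegral_congr_ae ?_
          filter_upwards [hlim] with x hx using hx.liminf_eq.symm
      _ ≤ liminf (fun k => ∫⁻ x, gk k x ∂m) atTop := lintegral_liminf_le hgkm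
      _ = _ := by simp [hexact]

end IsLikelihoodModel

end Compensator
section Compensator

set_option linter.unusedSectionVars false

variable {Ω E : Type*} {mΩ : MeasurableSpace Ω} [MeasurableSpace E]

namespace IsLikelihoodModel

variable {Q : Measure Ω} [IsProbabilityMeasure Q] {ℱ : Filtration ℝ≥0 mΩ} {ν : Measure E}
  [SigmaFinite ν] {lamQ : E → ℝ≥0 → ℝ≥0} {lam : E → ℝ≥0 → ℝ → Measure (E × ℝ≥0) → ℝ≥0}
  {C : Ω → Measure (E × ℝ≥0)} {D L : ℝ≥0 → Ω → ℝ} {P : Measure Ω}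
  (M : IsLikelihoodModel Q ℱ ν lamQ lam C D L P)
include M

/-- Compensation under `Q` supplies the factor `λ_Q`, which cancels the denominator of `ρ`. After
Fubini the time is fixed, so `L(s-)` may be replaced by `L(s)`, and this density turns `Q` into `P`
on the `ℱ s`-measurable section. -/
theorem lintegral_section_eq_intensity {G : Set (Ω × E × ℝ≥0)}
    (hG : MeasurableSet[predictable E ℱ] G) {t : ℝ≥0} (hGt : ∀ x ∈ G, x.2.2 ≤ t) (K : ℕ)
    (hK : ∀ᵐ ω ∂Q, C ω (Prod.mk ω ⁻¹' G) ≤ K) :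
    ∫⁻ ω, C ω (Prod.mk ω ⁻¹' G) ∂P =
      ∫⁻ ω, ∫⁻ z, G.indicator (fun x => (leftIntensity lam C D x : ℝ≥0∞)) (ω, z)
        ∂(ν.prod timeMeasure) ∂P := by
  have := M.isProbabilityMeasure
  have hle := predictable_le (E := E) ℱ
  set g : Ω × E × ℝ≥0 → ℝ≥0∞ := fun x => intensityRatio lam lamQ C D x * leftDensity L x with hg
  have hgm : Measurable[predictable E ℱ] g := M.measurable_ratio.coe_nnreal_ennreal.mul
    M.measurable_leftDensity
  set h : Ω × E × ℝ≥0 → ℝ≥0∞ := G.indicator fun x => (leftIntensity lam C D x : ℝ≥0∞) with hh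
  have hhp : Measurable[predictable E ℱ] h := M.measurable_left.coe_nnreal_ennreal.indicator hG
  have hhm : Measurable h := hhp.mono hle le_rfl
  have hdm : Measurable (leftDensity L : Ω × E × ℝ≥0 → ℝ≥0∞) :=
    M.measurable_leftDensity.mono hle le_rfl
  rw [M.lintegral_section_eq hG hGt K hK,
    lintegral_compensation M.poisson M.compatible (meanMeasure_slice ν lamQ) (hgm.indicator hG)]
  calc ∫⁻ ω, ∫⁻ z, G.indicator g (ω, z) ∂meanMeasure ν lamQ ∂Q
      = ∫⁻ ω, ∫⁻ z, leftDensity L (ω, z) * h (ω, z) ∂(ν.prod timeMeasure) ∂Q := by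
        refine lintegral_congr fun ω => ?_
        have hgω : Measurable fun z => G.indicator g (ω, z) :=
          ((hgm.indicator hG).mono hle le_rfl).comp measurable_prodMk_left
        rw [meanMeasure, lintegral_withDensity_eq_lintegral_mul _
          M.measurable_lamQ.coe_nnreal_ennreal hgω]
        refine lintegral_congr fun z => ?_
        simp only [Pi.mul_apply, hh]
        by_cases hz : (ω, z) ∈ G
        · rw [indicator_of_mem hz, indicator_of_mem hz, ← M.ratio_mul (ω, z)]
          push_cast
          simp only [hg]
          ring
        · simp [hz]
    _ = ∫⁻ z, ∫⁻ ω, leftDensity L (ω, z) * h (ω, z) ∂Q ∂(ν.prod timeMeasure) :=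
        lintegral_lintegral_swap (hdm.mul hhm).aemeasurable
    _ = ∫⁻ z, ∫⁻ ω, h (ω, z) ∂P ∂(ν.prod timeMeasure) := by
        refine lintegral_congr fun z => ?_
        rw [M.lintegral_eq z.2 (measurable_predictable_section hhp z)]
        refine lintegral_congr_ae ?_
        filter_upwards [M.ae_leftDensity_eq_density z] with ω hω
        rw [hω]
    _ = ∫⁻ ω, ∫⁻ z, h (ω, z) ∂(ν.prod timeMeasure) ∂P :=
        (lintegral_lintegral_swap (f := fun ω z => h (ω, z)) hhm.aemeasurable).symm

/-- Under `P`, the compensator of `C` is `λ(u, s, D_{s-}, η_{s-}) ν(du) ds`. -/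
theorem lintegral_compensation_left {H : Ω × E × ℝ≥0 → ℝ≥0∞}
    (hH : Measurable[predictable E ℱ] H) :
    ∫⁻ ω, ∫⁻ z, H (ω, z) ∂C ω ∂P =
      ∫⁻ ω, ∫⁻ z, H (ω, z) * leftIntensity lam C D (ω, z) ∂(ν.prod timeMeasure) ∂P := by
  have := M.isProbabilityMeasure
  have hle := predictable_le (E := E) ℱ
  set κ : Kernel Ω (E × ℝ≥0) := ⟨C, M.poisson.measurable⟩ with hκ
  have hκs : IsSFiniteKernel κ := M.poisson.hasFiniteCover.isSFiniteKernel M.poisson.measurable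
  have hHm : Measurable H := hH.mono hle le_rfl
  have hlm : Measurable fun x : Ω × E × ℝ≥0 => (leftIntensity lam C D x : ℝ≥0∞) :=
    M.measurable_left.coe_nnreal_ennreal.mono hle le_rfl
  set M1 := P ⊗ₘ κ with hM1
  set M2 := (P.prod (ν.prod timeMeasure)).withDensity
    fun x => (leftIntensity lam C D x : ℝ≥0∞) with hM2
  obtain ⟨K, hK, hKU, hKf⟩ := M.poisson.hasFiniteCover
  -- A countable predictable cover with bounded counts: in `V (n, k, t)` only the points of `K n` up
  -- to time `t` with fewer than `k` predecessors in `K n` remain, so there are at most `k` of them.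
  set V : ℕ × ℕ × ℕ → Set (Ω × E × ℝ≥0) := fun i =>
    {x | (x.2 ∈ K i.1 ∧ configLeft (C x.1) x.2.2 (K i.1) < i.2.1) ∧ x.2.2 ≤ i.2.2} with hV
  have hVm : ∀ i, MeasurableSet[predictable E ℱ] (V i) := by
    intro i
    have h1 : Measurable[predictable E ℱ] fun x : Ω × E × ℝ≥0 =>
        configLeft (C x.1) x.2.2 (K i.1) :=
      (Measure.measurable_coe (hK i.1)).comp
        (measurable_configLeft_predictable M.compatible.adapted)
    have h2 := measurable_predictable_snd (E := E) ℱ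
    have h3 : MeasurableSet[predictable E ℱ] {x : Ω × E × ℝ≥0 | x.2.2 ≤ i.2.2} :=
      h2 (measurable_snd measurableSet_Iic)
    exact ((h2 (hK i.1)).inter (h1 measurableSet_Iio)).inter h3
  have hVU : ⋃ i, V i = univ := by
    refine eq_univ_of_forall fun x => mem_iUnion.2 ?_
    obtain ⟨n, hn⟩ := mem_iUnion.1 (hKU.symm ▸ mem_univ x.2 : x.2 ∈ ⋃ n, K n)
    have hfin : configLeft (C x.1) x.2.2 (K n) < ∞ :=
      (Measure.restrict_apply_le _ _).trans_lt (hKf n x.1)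
    obtain ⟨k, hk⟩ := ENNReal.exists_nat_gt hfin.ne
    obtain ⟨t, ht⟩ := exists_nat_ge x.2.2
    exact ⟨(n, k, t), ⟨hn, hk⟩, ht⟩
  have hVb : ∀ i, ∀ᵐ ω ∂Q, C ω (Prod.mk ω ⁻¹' V i) ≤ i.2.1 := by
    intro i
    filter_upwards [M.poisson.ae_simple (meanMeasure_slice ν lamQ)] with ω hω
    refine (measure_mono ?_).trans
      (measure_configLeft_lt_le (M.poisson.counting ω) hω (hK i.1) i.2.1)
    exact fun z hz => hz.1
  have htrim : M1.trim hle = M2.trim hle := by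
    refine (@Measure.ext_iff_of_iUnion_eq_univ _ _ (predictable E ℱ) _ _ _ V hVU).2 fun i => ?_
    rw [restrict_trim _ _ (hVm i), restrict_trim _ _ (hVm i)]
    refine @Measure.ext _ (predictable E ℱ) _ _ fun G hG => ?_
    have hGV := hG.inter (hVm i)
    have hGVm := hle _ hGV
    rw [trim_measurableSet_eq _ hG, trim_measurableSet_eq _ hG, Measure.restrict_apply (hle _ hG),
      Measure.restrict_apply (hle _ hG), hM1, Measure.compProd_apply hGVm, hM2,
      withDensity_apply _ hGVm, ← lintegral_indicator hGVm]
    refine (M.lintegral_section_eq_intensity hGV (t := i.2.2) (fun x hx => hx.2.2) i.2.1 ?_).trans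
      (lintegral_prod _ (hlm.indicator hGVm).aemeasurable).symm
    filter_upwards [hVb i] with ω hω
    exact (measure_mono (preimage_mono inter_subset_right)).trans hω
  calc ∫⁻ ω, ∫⁻ z, H (ω, z) ∂C ω ∂P = ∫⁻ x, H x ∂M1 :=
        (Measure.lintegral_compProd (κ := κ) hHm).symm
    _ = ∫⁻ x, H x ∂M2 := by
        rw [← lintegral_trim hle hH, htrim, lintegral_trim hle hH]
    _ = ∫⁻ x, H x * leftIntensity lam C D x ∂(P.prod (ν.prod timeMeasure)) := by
        rw [hM2, lintegral_withDensity_eq_lintegral_mul _ hlm hHm]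
        simp only [Pi.mul_apply, mul_comm]
    _ = _ := lintegral_prod _ (hHm.mul hlm).aemeasurable

end IsLikelihoodModel

end Compensator
/-! ### Localization along a continuous increasing path that may jump to `∞` -/

/-- An increasing left-continuous path from `0` that is right-continuous as long as it is
finite to the right. -/
structure IsCompensatorPath (F : ℝ≥0 → ℝ≥0∞) : Prop where
  mono : Monotone F
  zero : F 0 = 0
  left : ∀ s, F s = ⨆ k, F (prevGrid k s)
  right : ∀ s s', s < s' → F s' < ∞ → Tendsto F (𝓝[>] s) (𝓝 (F s))

/-- The largest finite value of `F` on the dyadic points of `[0, t]`. -/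
noncomputable def finiteSup (F : ℝ≥0 → ℝ≥0∞) (t : ℝ≥0) : ℝ≥0∞ :=
  ⨆ (k : ℕ) (n : ℕ), if (n : ℝ≥0) / 2 ^ k ≤ t ∧ F ((n : ℝ≥0) / 2 ^ k) < ∞ then
    F ((n : ℝ≥0) / 2 ^ k) else 0

open scoped Classical in
/-- The first time at which `finiteSup F` is at least `a`. -/
noncomputable def levelTime (F : ℝ≥0 → ℝ≥0∞) (a : ℝ≥0∞) : WithTop ℝ≥0 :=
  if {t | a ≤ finiteSup F t}.Nonempty then ((sInf {t | a ≤ finiteSup F t} : ℝ≥0) : WithTop ℝ≥0)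
  else ⊤

theorem le_finiteSup {F : ℝ≥0 → ℝ≥0∞} {t : ℝ≥0} (k n : ℕ) (h : (n : ℝ≥0) / 2 ^ k ≤ t)
    (h' : F ((n : ℝ≥0) / 2 ^ k) < ∞) : F ((n : ℝ≥0) / 2 ^ k) ≤ finiteSup F t := by
  refine le_trans ?_ (le_iSup₂ (f := fun (k n : ℕ) => if (n : ℝ≥0) / 2 ^ k ≤ t ∧
    F ((n : ℝ≥0) / 2 ^ k) < ∞ then F ((n : ℝ≥0) / 2 ^ k) else 0) k n)
  rw [if_pos ⟨h, h'⟩]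

theorem finiteSup_le {F : ℝ≥0 → ℝ≥0∞} {t : ℝ≥0} {b : ℝ≥0∞}
    (h : ∀ k n : ℕ, (n : ℝ≥0) / 2 ^ k ≤ t → F ((n : ℝ≥0) / 2 ^ k) < ∞ →
      F ((n : ℝ≥0) / 2 ^ k) ≤ b) : finiteSup F t ≤ b := by
  refine iSup₂_le fun k n => ?_
  split_ifs with hc
  · exact h k n hc.1 hc.2
  · exact zero_le

theorem monotone_finiteSup (F : ℝ≥0 → ℝ≥0∞) : Monotone (finiteSup F) := fun _ _ h =>
  finiteSup_le fun k n hk hF => le_finiteSup k n (hk.trans h) hF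

namespace IsCompensatorPath

variable {F : ℝ≥0 → ℝ≥0∞}

theorem le_finiteSup_of_lt_top (hF : IsCompensatorPath F) {s : ℝ≥0}
    (h : ∀ r < s, F r < ∞) : F s ≤ finiteSup F s := by
  rw [hF.left]
  refine iSup_le fun k => ?_
  rcases eq_or_ne s 0 with rfl | hs
  · rw [prevGrid_zero, hF.zero]
    exact zero_le
  · have := prevGrid_lt k (pos_iff_ne_zero.2 hs)
    exact le_finiteSup k _ this.le (h _ this)

theorem finiteSup_zero (hF : IsCompensatorPath F) : finiteSup F 0 = 0 := by
  refine le_antisymm (finiteSup_le fun k n hk _ => ?_) zero_le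
  rw [le_antisymm hk zero_le, hF.zero]

theorem finiteSup_le_self (hF : IsCompensatorPath F) (t : ℝ≥0) : finiteSup F t ≤ F t :=
  finiteSup_le fun _ _ hk _ => hF.mono hk

/-- The infimum is attained, which makes `levelTime` a stopping time without a right-continuous
filtration. If `F` is finite somewhere to the right of `τ`, it is right continuous at `τ`. Otherwise
`F` is infinite after `τ`, and `finiteSup F`, which ignores infinite values, no longer grows. With
`F` itself the level could first be passed immediately after an explosion time. -/
theorem le_finiteSup_sInf (hF : IsCompensatorPath F) {a : ℝ≥0∞}
    (hne : {t | a ≤ finiteSup F t}.Nonempty) :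
    a ≤ finiteSup F (sInf {t | a ≤ finiteSup F t}) := by
  set τ := sInf {t | a ≤ finiteSup F t} with hτ
  by_contra! hlt
  have hlow : ∀ t, τ < t → ∃ r, a ≤ finiteSup F r ∧ r < t := fun t ht => by
    obtain ⟨r, hr, hrt⟩ := exists_lt_of_csInf_lt hne ht
    exact ⟨r, hr, hrt⟩
  by_cases hT : ∃ s', τ < s' ∧ F s' < ∞
  · obtain ⟨s', hs', hfin⟩ := hT
    have hFτ : F τ < a := (hF.le_finiteSup_of_lt_top fun r hr =>
      (hF.mono (hr.trans hs').le).trans_lt hfin).trans_lt hlt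
    have hev := (hF.right τ s' hs' hfin).eventually_lt_const hFτ
    have : (𝓝[>] τ).NeBot := inferInstance
    obtain ⟨t, ht, htτ⟩ := (hev.and self_mem_nhdsWithin).exists
    obtain ⟨r, hr, hrt⟩ := hlow t htτ
    have h1 := hr.trans ((monotone_finiteSup F hrt.le).trans (hF.finiteSup_le_self t))
    exact absurd ht (not_lt.2 h1)
  · push Not at hT
    obtain ⟨r, hr, -⟩ := hlow (τ + 1) (lt_add_one τ)
    refine absurd hlt (not_lt.2 (hr.trans (finiteSup_le fun k n hk hfin => ?_)))
    refine le_finiteSup k n ?_ hfin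
    by_contra! h
    exact absurd hfin (not_lt.2 (hT _ h))

theorem levelTime_le_iff (hF : IsCompensatorPath F) {a : ℝ≥0∞} {t : ℝ≥0} :
    levelTime F a ≤ t ↔ a ≤ finiteSup F t := by
  unfold levelTime
  split_ifs with hne
  · rw [WithTop.coe_le_coe]
    constructor
    · exact fun h => (hF.le_finiteSup_sInf hne).trans (monotone_finiteSup F h)
    · exact fun h => csInf_le (OrderBot.bddBelow _) h
  · refine ⟨fun h => absurd h (WithTop.coe_lt_top t).not_ge, fun h => absurd ⟨t, h⟩ hne⟩

theorem apply_le_of_le_levelTime (hF : IsCompensatorPath F) {a : ℝ≥0∞}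
    (hfin : ∀ t, F t < ∞) {s : ℝ≥0} (hs : (s : WithTop ℝ≥0) ≤ levelTime F a) : F s ≤ a := by
  rw [hF.left]
  refine iSup_le fun k => ?_
  rcases eq_or_ne s 0 with rfl | h0
  · rw [prevGrid_zero, hF.zero]
    exact zero_le
  · have hlt := prevGrid_lt k (pos_iff_ne_zero.2 h0)
    refine (hF.le_finiteSup_of_lt_top fun r _ => hfin r).trans ?_
    by_contra! h
    have h1 := hF.levelTime_le_iff.2 h.le
    exact absurd (WithTop.coe_le_coe.1 (hs.trans h1)) (not_le.2 hlt)

theorem bot_lt_levelTime (hF : IsCompensatorPath F) {a : ℝ≥0∞} (ha : 0 < a) :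
    ⊥ < levelTime F a := by
  rw [← not_le]
  intro h
  have h0 : levelTime F a ≤ ((0 : ℝ≥0) : WithTop ℝ≥0) := h
  rw [hF.levelTime_le_iff, hF.finiteSup_zero] at h0
  exact absurd ha (not_lt.2 h0)

theorem monotone_levelTime (hF : IsCompensatorPath F) : Monotone (levelTime F) := by
  intro a b hab
  cases hb : levelTime F b with
  | top => exact le_top
  | coe t => exact hF.levelTime_le_iff.2 (hab.trans (hF.levelTime_le_iff.1 hb.le))

theorem tendsto_levelTime (hF : IsCompensatorPath F) (hfin : ∀ t, F t < ∞) :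
    Tendsto (fun n : ℕ => levelTime F ((n : ℝ≥0∞) + 1)) atTop (𝓝 ⊤) := by
  refine tendsto_order.2 ⟨fun b hb => ?_, fun b hb => absurd hb (by simp)⟩
  lift b to ℝ≥0 using hb.ne
  obtain ⟨n, hn⟩ := ENNReal.exists_nat_gt (hfin b).ne
  filter_upwards [eventually_ge_atTop n] with m hm
  rw [← not_le, hF.levelTime_le_iff, not_le]
  refine (hF.finiteSup_le_self b).trans_lt (hn.trans_le ?_)
  exact (by exact_mod_cast hm : (n : ℝ≥0∞) ≤ m).trans le_self_add

end IsCompensatorPath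

/-- Integrating a density over `A × [0, t]` gives a compensator path. -/
theorem isCompensatorPath_lintegral {E : Type*} [MeasurableSpace E] {m : Measure (E × ℝ≥0)}
    (hm : ∀ s, m (univ ×ˢ {s}) = 0) (f : E × ℝ≥0 → ℝ≥0∞) {A : Set E} (hA : MeasurableSet A) :
    IsCompensatorPath fun t => ∫⁻ z in A ×ˢ Iic t, f z ∂m := by
  set ρ := m.withDensity f with hρ
  have hmeas : ∀ t, MeasurableSet (A ×ˢ Iic t : Set (E × ℝ≥0)) := fun t =>
    hA.prod measurableSet_Iic
  have hF : (fun t => ∫⁻ z in A ×ˢ Iic t, f z ∂m) = fun t => ρ (A ×ˢ Iic t) :=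
    funext fun t => (withDensity_apply _ (hmeas t)).symm
  have hslice : ∀ s, ρ (A ×ˢ {s}) = 0 := fun s => withDensity_absolutelyContinuous m f
    (measure_mono_null (prod_mono_left (subset_univ _)) (hm s))
  have h00 : Iic (0 : ℝ≥0) = {0} := by ext; simp
  rw [hF]
  refine ⟨fun s t h => measure_mono (prod_mono_right (Iic_subset_Iic.2 h)), ?_, ?_, ?_⟩
  · simp only [h00, hslice]
  · intro s
    rcases eq_or_ne s 0 with rfl | hs
    · simp [prevGrid_zero]
    · have hs' := pos_iff_ne_zero.2 hs
      have h1 : ρ (A ×ˢ Iic s) = ρ (A ×ˢ Iio s) := by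
        refine le_antisymm ?_ (measure_mono (prod_mono_right Iio_subset_Iic_self))
        rw [← Iio_union_right, prod_union]
        refine (measure_union_le _ _).trans ?_
        rw [hslice, add_zero]
      rw [h1, ← iUnion_Iic_prevGrid hs', prod_iUnion]
      exact Monotone.measure_iUnion fun i j hij =>
        prod_mono_right (Iic_subset_Iic.2 (monotone_prevGrid s hij))
  · intro s s' hs hfin
    refine tendsto_measure_of_tendsto_indicator _ hmeas (hmeas s') hfin.ne ?_ fun z => ?_
    · filter_upwards [Ioo_mem_nhdsGT hs] with t ht
      exact prod_mono_right (Iic_subset_Iic.2 ht.2.le)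
    · by_cases hz : z.2 ≤ s
      · filter_upwards [self_mem_nhdsWithin] with t ht
        have : z.2 ≤ t := hz.trans (le_of_lt ht)
        simp [hz, this]
      · filter_upwards [Ioo_mem_nhdsGT (not_le.1 hz)] with t ht
        exact iff_of_false (fun h => (not_le.2 ht.2) h.2) fun h => hz h.2
-- The compensated process is a local martingale
section LocalMartingale

set_option linter.unusedSectionVars false

variable {Ω E : Type*} {mΩ : MeasurableSpace Ω} [MeasurableSpace E]

theorem ae_prod_timeMeasure_of_countable (ν : Measure E) [SigmaFinite ν] {p : ℝ≥0 → Prop}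
    (hp : {s | ¬ p s}.Countable) : ∀ᵐ z ∂(ν.prod timeMeasure), p z.2 := by
  refine measure_mono_null (t := ⋃ s ∈ {s | ¬ p s}, univ ×ˢ {s}) ?_
    ((measure_biUnion_null_iff hp).2 fun s _ => prod_timeMeasure_slice ν s)
  intro z hz
  exact mem_iUnion₂.2 ⟨z.2, hz, trivial, rfl⟩

/-- The cumulative intensity does not change if left limits are taken in the integrand. -/
theorem cumulativeIntensity_eq (ν : Measure E) [SigmaFinite ν]
    (lam : E → ℝ≥0 → ℝ → Measure (E × ℝ≥0) → ℝ≥0) {C : Ω → Measure (E × ℝ≥0)}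
    (hC : HasFiniteCover C) {D : ℝ≥0 → Ω → ℝ} (hD : ∀ ω, IsCadlagPath fun t => D t ω) (ω : Ω)
    {A : Set E} (hA : MeasurableSet A) (t : ℝ≥0) :
    cumulativeIntensity ν lam (C ω) (fun s => D s ω) A t =
      ∫⁻ z in A ×ˢ Iic t, leftIntensity lam C D (ω, z) ∂(ν.prod timeMeasure) := by
  have := hC.sigmaFinite ω
  -- The jumps of `D` and the time slices charged by `C` occupy countably many times, which are
  -- Lebesgue null.
  have h1 := ae_prod_timeMeasure_of_countable ν
    (p := fun s => Function.leftLim (fun s => D s ω) s = D s ω) (hD ω).countable_jumps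
  have h2 := ae_prod_timeMeasure_of_countable ν (p := fun s => C ω (univ ×ˢ {s}) = 0)
    countable_slices
  refine setLIntegral_congr_fun_ae (hA.prod measurableSet_Iic) ?_
  filter_upwards [h1, h2] with z hz1 hz2 _
  rw [leftIntensity, hz1, config_eq_configLeft hz2]

/-- The stochastic interval `[0, τ]` is predictable. -/
theorem measurableSet_le_stoppingTime {ℱ : Filtration ℝ≥0 mΩ} {τ : Ω → WithTop ℝ≥0}
    (hτ : IsStoppingTime ℱ τ) :
    MeasurableSet[predictable E ℱ] {x : Ω × E × ℝ≥0 | (x.2.2 : WithTop ℝ≥0) ≤ τ x.1} := by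
  -- A time lies strictly after `τ` exactly when some dyadic number `q` satisfies `τ ≤ q < s`. The
  -- complement is therefore a countable union of predictable rectangles.
  have heq : {x : Ω × E × ℝ≥0 | (x.2.2 : WithTop ℝ≥0) ≤ τ x.1} =
      (⋃ (k : ℕ) (n : ℕ), {ω | τ ω ≤ ((n : ℝ≥0) / 2 ^ k : ℝ≥0)} ×ˢ
        {z : E × ℝ≥0 | (n : ℝ≥0) / 2 ^ k < z.2})ᶜ := by
    ext x
    simp only [mem_ofPred_eq, mem_compl_iff, mem_iUnion, mem_prod, not_exists, not_and, not_lt]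
    constructor
    · intro h k n hn
      exact WithTop.coe_le_coe.1 (h.trans hn)
    · intro h
      by_contra! hlt
      cases hr : τ x.1 with
      | top => exact absurd (hr ▸ hlt) (not_lt.2 le_top)
      | coe r =>
        rw [hr] at hlt h
        have hlt' : r < x.2.2 := WithTop.coe_lt_coe.1 hlt
        obtain ⟨k, hk⟩ := ((tendsto_nextGrid r).eventually_lt_const hlt').exists
        exact absurd (h k _ (WithTop.coe_le_coe.2 (le_nextGrid k r))) (not_le.2 hk)
  rw [heq]
  refine MeasurableSet.compl (MeasurableSet.iUnion fun k => MeasurableSet.iUnion fun n => ?_)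
  exact measurableSet_predictable_prod (hτ _) (measurable_snd measurableSet_Ioi) subset_rfl

/-- The event `{τ ≤ t}` says that `finiteSup` has reached `a` by time `t`, which involves only
countably many times up to `t`. -/
theorem isStoppingTime_levelTime {ℱ : Filtration ℝ≥0 mΩ} {Λ : ℝ≥0 → Ω → ℝ≥0∞}
    (hΛ : ∀ ω, IsCompensatorPath fun t => Λ t ω) (hΛm : ∀ t, Measurable[ℱ t] (Λ t)) (a : ℝ≥0∞) :
    IsStoppingTime ℱ fun ω => levelTime (fun t => Λ t ω) a := by
  intro t
  have heq : {ω | levelTime (fun t => Λ t ω) a ≤ t} =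
      {ω | a ≤ finiteSup (fun t => Λ t ω) t} := by
    ext ω
    exact (hΛ ω).levelTime_le_iff
  rw [heq]
  have hm : Measurable[ℱ t] fun ω => finiteSup (fun t => Λ t ω) t := by
    unfold finiteSup
    refine Measurable.iSup fun k => Measurable.iSup fun n => ?_
    by_cases h : (n : ℝ≥0) / 2 ^ k ≤ t
    · have hm := (hΛm ((n : ℝ≥0) / 2 ^ k)).mono (ℱ.mono h) le_rfl
      simp only [h, true_and]
      exact Measurable.ite (hm measurableSet_Iio) hm measurable_const
    · simp only [h, false_and, if_false]
      exact measurable_const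
  exact hm measurableSet_Ici

/-- Two increasing integrable adapted processes whose increments have the same expectation on
the past differ by a martingale. -/
theorem martingale_toReal_sub {P : Measure Ω} [IsFiniteMeasure P] {ℱ : Filtration ℝ≥0 mΩ}
    {a b : ℝ≥0 → Ω → ℝ≥0∞} (ham : ∀ t, Measurable[ℱ t] (a t)) (hbm : ∀ t, Measurable[ℱ t] (b t))
    (ha : ∀ t, ∫⁻ ω, a t ω ∂P ≠ ∞) (hb : ∀ t, ∫⁻ ω, b t ω ∂P ≠ ∞)
    (h : ∀ s t, s ≤ t → ∃ a' b' : Ω → ℝ≥0∞, Measurable a' ∧ Measurable b' ∧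
      (∀ ω, a t ω = a s ω + a' ω) ∧ (∀ ω, b t ω = b s ω + b' ω) ∧
      ∀ F, MeasurableSet[ℱ s] F → ∫⁻ ω in F, a' ω ∂P = ∫⁻ ω in F, b' ω ∂P) :
    Martingale (fun t ω => (a t ω).toReal - (b t ω).toReal) ℱ P := by
  have ham' : ∀ t, Measurable (a t) := fun t => (ham t).mono (ℱ.le t) le_rfl
  have hbm' : ∀ t, Measurable (b t) := fun t => (hbm t).mono (ℱ.le t) le_rfl
  have hai : ∀ t, Integrable (fun ω => (a t ω).toReal) P := fun t =>
    integrable_toReal_of_lintegral_ne_top (ham' t).aemeasurable (ha t)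
  have hbi : ∀ t, Integrable (fun ω => (b t ω).toReal) P := fun t =>
    integrable_toReal_of_lintegral_ne_top (hbm' t).aemeasurable (hb t)
  have hadapt : ∀ t, Measurable[ℱ t] fun ω => (a t ω).toReal - (b t ω).toReal := fun t =>
    (ham t).ennreal_toReal.sub (hbm t).ennreal_toReal
  have hset : ∀ {f : Ω → ℝ≥0∞} (F : Set Ω), Measurable f → ∫⁻ ω, f ω ∂P ≠ ∞ →
      ∫ ω in F, (f ω).toReal ∂P = (∫⁻ ω in F, f ω ∂P).toReal ∧ ∫⁻ ω in F, f ω ∂P ≠ ∞ := by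
    intro f F hf hfin
    have hfinF : ∫⁻ ω in F, f ω ∂P ≠ ∞ := ne_top_of_le_ne_top hfin (setLIntegral_le_lintegral _ _)
    exact ⟨integral_toReal hf.aemeasurable (ae_lt_top hf hfinF), hfinF⟩
  refine ⟨fun t => (hadapt t).stronglyMeasurable, fun s t hst => ?_⟩
  refine (ae_eq_condExp_of_forall_setIntegral_eq (ℱ.le s) ((hai t).sub (hbi t))
    (fun F _ _ => ((hai s).sub (hbi s)).integrableOn) (fun F hF _ => ?_)
    (hadapt s).stronglyMeasurable.aestronglyMeasurable).symm
  -- The increments come as separate functions, so nothing is subtracted in `ℝ≥0∞`.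
  obtain ⟨a', b', ha'm, hb'm, haa', hbb', hFeq⟩ := h s t hst
  have hsplit : ∀ r, ∫ ω in F, ((a r ω).toReal - (b r ω).toReal) ∂P =
      (∫⁻ ω in F, a r ω ∂P).toReal - (∫⁻ ω in F, b r ω ∂P).toReal := fun r => by
    rw [integral_sub (hai r).integrableOn (hbi r).integrableOn, (hset F (ham' r) (ha r)).1,
      (hset F (hbm' r) (hb r)).1]
  have hat : ∫⁻ ω in F, a t ω ∂P = ∫⁻ ω in F, a s ω ∂P + ∫⁻ ω in F, a' ω ∂P := by
    simp_rw [haa']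
    exact lintegral_add_left (ham' s) _
  have hbt : ∫⁻ ω in F, b t ω ∂P = ∫⁻ ω in F, b s ω ∂P + ∫⁻ ω in F, b' ω ∂P := by
    simp_rw [hbb']
    exact lintegral_add_left (hbm' s) _
  have hfin' : ∫⁻ ω in F, a' ω ∂P ≠ ∞ := by
    have := (hset F (ham' t) (ha t)).2
    rw [hat] at this
    exact (ENNReal.add_ne_top.1 this).2
  simp only [Pi.sub_apply]
  rw [hsplit, hsplit, hat, hbt, ← hFeq F hF, ENNReal.toReal_add (hset F (ham' s) (ha s)).2 hfin',
    ENNReal.toReal_add (hset F (hbm' s) (hb s)).2 hfin']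
  ring

end LocalMartingale
section LocalMartingale

set_option linter.unusedSectionVars false

variable {Ω E : Type*} {mΩ : MeasurableSpace Ω} [MeasurableSpace E]

/-- Stopping is integration of a predictable indicator, the form in which the compensation formula
reaches stopped processes. -/
theorem setLIntegral_indicator_stopped {τ : Ω → WithTop ℝ≥0} {A : Set E} (hA : MeasurableSet A)
    (m : Measure (E × ℝ≥0)) (f : E × ℝ≥0 → ℝ≥0∞) (t : ℝ≥0) (ω : Ω) :
    ∫⁻ z in univ ×ˢ Iic t, {x : Ω × E × ℝ≥0 | x.2.1 ∈ A ∧ (x.2.2 : WithTop ℝ≥0) ≤ τ x.1}.indicator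
        1 (ω, z) * f z ∂m =
      ∫⁻ z in A ×ˢ Iic (min (t : WithTop ℝ≥0) (τ ω)).untopA, f z ∂m := by
  have hne : min (t : WithTop ℝ≥0) (τ ω) ≠ ⊤ :=
    ((min_le_left _ _).trans_lt (WithTop.coe_lt_top t)).ne
  rw [← lintegral_indicator (measurableSet_univ_prod_Iic t),
    ← lintegral_indicator (hA.prod measurableSet_Iic)]
  refine lintegral_congr fun z => ?_
  have hiff : z ∈ A ×ˢ Iic (min (t : WithTop ℝ≥0) (τ ω)).untopA ↔
      z.2 ≤ t ∧ z.1 ∈ A ∧ (z.2 : WithTop ℝ≥0) ≤ τ ω := by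
    rw [mem_prod, mem_Iic, WithTop.le_untopA_iff hne, le_min_iff, WithTop.coe_le_coe]
    tauto
  by_cases h1 : z.2 ≤ t
  · rw [indicator_of_mem (by exact ⟨trivial, h1⟩)]
    by_cases h2 : z.1 ∈ A ∧ (z.2 : WithTop ℝ≥0) ≤ τ ω
    · rw [indicator_of_mem (by exact h2), indicator_of_mem (hiff.2 ⟨h1, h2⟩)]
      simp
    · rw [indicator_of_notMem (by exact h2), indicator_of_notMem fun h => h2 (hiff.1 h).2, zero_mul]
  · rw [indicator_of_notMem fun h => h1 h.2, indicator_of_notMem fun h => h1 (hiff.1 h).1]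

namespace IsLikelihoodModel

variable {Q : Measure Ω} [IsProbabilityMeasure Q] {ℱ : Filtration ℝ≥0 mΩ} {ν : Measure E}
  [SigmaFinite ν] {lamQ : E → ℝ≥0 → ℝ≥0} {lam : E → ℝ≥0 → ℝ → Measure (E × ℝ≥0) → ℝ≥0}
  {C : Ω → Measure (E × ℝ≥0)} {D L : ℝ≥0 → Ω → ℝ} {P : Measure Ω}
  (M : IsLikelihoodModel Q ℱ ν lamQ lam C D L P)
include M

/-- The compensation formula on `F × U` for the points of `C` in a predictable set `G`. -/
theorem setLIntegral_compensation {G : Set (Ω × E × ℝ≥0)} (hG : MeasurableSet[predictable E ℱ] G)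
    {F : Set Ω} {U : Set (E × ℝ≥0)} (hF : MeasurableSet F) (hU : MeasurableSet U)
    (hFU : MeasurableSet[predictable E ℱ] (F ×ˢ U)) :
    ∫⁻ ω in F, ∫⁻ z in U, G.indicator 1 (ω, z) ∂C ω ∂P =
      ∫⁻ ω in F, ∫⁻ z in U, G.indicator 1 (ω, z) * leftIntensity lam C D (ω, z)
        ∂(ν.prod timeMeasure) ∂P := by
  have hi : Measurable[predictable E ℱ] (G.indicator (1 : Ω × E × ℝ≥0 → ℝ≥0∞)) :=
    (measurable_const (a := (1 : ℝ≥0∞))).indicator hG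
  have h := M.lintegral_compensation_left (hi.indicator hFU)
  have key : ∀ (m : Ω → Measure (E × ℝ≥0)) (f : Ω × E × ℝ≥0 → ℝ≥0∞),
      ∫⁻ ω in F, ∫⁻ z in U, f (ω, z) ∂m ω ∂P =
        ∫⁻ ω, ∫⁻ z, (F ×ˢ U).indicator f (ω, z) ∂m ω ∂P := by
    intro m f
    rw [← lintegral_indicator hF]
    refine lintegral_congr fun ω => ?_
    by_cases hω : ω ∈ F
    · rw [indicator_of_mem hω, ← lintegral_indicator hU]
      refine lintegral_congr fun z => ?_
      by_cases hz : z ∈ U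
      · rw [indicator_of_mem hz, indicator_of_mem (mk_mem_prod hω hz)]
      · rw [indicator_of_notMem hz, indicator_of_notMem fun h => hz h.2]
    · rw [indicator_of_notMem hω]
      have : (fun z => (F ×ˢ U).indicator f (ω, z)) = fun _ => 0 :=
        funext fun z => indicator_of_notMem (fun h => hω h.1) _
      rw [this, lintegral_zero]
  rw [key C, h, key (fun _ => ν.prod timeMeasure)
    (fun x => G.indicator 1 x * leftIntensity lam C D x)]
  refine lintegral_congr fun ω => lintegral_congr fun z => ?_
  by_cases hz : (ω, z) ∈ F ×ˢ U
  · rw [indicator_of_mem hz, indicator_of_mem hz]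
  · rw [indicator_of_notMem hz, indicator_of_notMem hz, zero_mul]

/-- Stopped when it reaches level `n + 1`, the compensator is bounded almost surely. The
compensation formula on all of `[0, t]` then bounds the expected number of points, and this also
gives the finiteness of `C(A, t)`. The same formula on `F × (s, t]` with `F ∈ ℱ s` is the martingale
property. -/
theorem isLocalMartingale_compensated {A : Set E} (hA : MeasurableSet A)
    (hfin : ∀ᵐ ω ∂P, ∀ t, cumulativeIntensity ν lam (C ω) (fun s => D s ω) A t < ∞) :
    (∀ᵐ ω ∂P, ∀ t, C ω (A ×ˢ Iic t) < ∞) ∧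
      IsLocalMartingale
        (fun t ω => (C ω (A ×ˢ Iic t)).toReal -
          (cumulativeIntensity ν lam (C ω) (fun s => D s ω) A t).toReal) ℱ P := by
  have := M.isProbabilityMeasure
  have hle := predictable_le (E := E) ℱ
  set Λ : ℝ≥0 → Ω → ℝ≥0∞ := fun t ω =>
    ∫⁻ z in A ×ˢ Iic t, leftIntensity lam C D (ω, z) ∂(ν.prod timeMeasure) with hΛ
  have hcum : ∀ t ω, cumulativeIntensity ν lam (C ω) (fun s => D s ω) A t = Λ t ω := fun t ω =>
    cumulativeIntensity_eq ν lam M.poisson.hasFiniteCover M.cadlag ω hA t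
  simp only [hcum] at hfin ⊢
  have hpath : ∀ ω, IsCompensatorPath fun t => Λ t ω := fun ω =>
    isCompensatorPath_lintegral (prod_timeMeasure_slice ν) _ hA
  have hνcover : HasFiniteCover fun _ : Ω => ν.prod timeMeasure :=
    ⟨spanningSets _, measurableSet_spanningSets _, iUnion_spanningSets _,
      fun n _ => measure_spanningSets_lt_top _ n⟩
  have hintm : ∀ {f : Ω × E × ℝ≥0 → ℝ≥0∞}, Measurable[predictable E ℱ] f → ∀ t,
      Measurable[ℱ t] fun ω => ∫⁻ z in univ ×ˢ Iic t, f (ω, z) ∂(ν.prod timeMeasure) :=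
    fun hf t => measurable_setLIntegral_predictable hνcover (fun _ => measurable_const) hf t
  have hleft : Measurable[predictable E ℱ]
      fun x : Ω × E × ℝ≥0 => (leftIntensity lam C D x : ℝ≥0∞) :=
    M.measurable_left.coe_nnreal_ennreal
  have hAset : MeasurableSet[predictable E ℱ] {x : Ω × E × ℝ≥0 | x.2.1 ∈ A} :=
    measurable_predictable_snd ℱ (measurable_fst hA)
  have hΛm : ∀ t, Measurable[ℱ t] (Λ t) := by
    intro t
    convert hintm (hleft.indicator hAset) t using 2 with ω
    change ∫⁻ z in A ×ˢ Iic t, (leftIntensity lam C D (ω, z) : ℝ≥0∞) ∂(ν.prod timeMeasure) = _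
    rw [← lintegral_indicator (hA.prod measurableSet_Iic),
      ← lintegral_indicator (measurableSet_univ_prod_Iic t)]
    refine lintegral_congr fun z => ?_
    by_cases h1 : z.2 ≤ t
    · rw [indicator_of_mem (s := univ ×ˢ Iic t) ⟨trivial, h1⟩]
      by_cases h2 : z.1 ∈ A
      · rw [indicator_of_mem (s := A ×ˢ Iic t) ⟨h2, h1⟩, indicator_of_mem (by exact h2)]
      · rw [indicator_of_notMem fun h => h2 h.1, indicator_of_notMem (by exact h2)]
    · rw [indicator_of_notMem fun h => h1 h.2, indicator_of_notMem fun h => h1 h.2]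
  -- The shift to `n + 1` keeps the level positive for `n = 0`, so that every `τ n` is positive.
  set τ : ℕ → Ω → WithTop ℝ≥0 := fun n ω => levelTime (fun t => Λ t ω) ((n : ℝ≥0∞) + 1) with hτ
  have hτst : ∀ n, IsStoppingTime ℱ (τ n) := fun n => isStoppingTime_levelTime hpath hΛm _
  have hτtop : ∀ᵐ ω ∂P, Tendsto (τ · ω) atTop (𝓝 ⊤) := by
    filter_upwards [hfin] with ω hω using (hpath ω).tendsto_levelTime hω
  set G : ℕ → Set (Ω × E × ℝ≥0) := fun n =>
    {x | x.2.1 ∈ A ∧ (x.2.2 : WithTop ℝ≥0) ≤ τ n x.1} with hG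
  have hGm : ∀ n, MeasurableSet[predictable E ℱ] (G n) := fun n =>
    hAset.inter (measurableSet_le_stoppingTime (hτst n))
  have hGi : ∀ n, Measurable[predictable E ℱ] ((G n).indicator (1 : Ω × E × ℝ≥0 → ℝ≥0∞)) :=
    fun n => (measurable_const (a := (1 : ℝ≥0∞))).indicator (hGm n)
  set a : ℕ → ℝ≥0 → Ω → ℝ≥0∞ := fun n t ω =>
    ∫⁻ z in univ ×ˢ Iic t, (G n).indicator 1 (ω, z) ∂C ω with ha
  set b : ℕ → ℝ≥0 → Ω → ℝ≥0∞ := fun n t ω =>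
    ∫⁻ z in univ ×ˢ Iic t, (G n).indicator 1 (ω, z) * leftIntensity lam C D (ω, z)
      ∂(ν.prod timeMeasure) with hb
  have haeq : ∀ n t ω, a n t ω = C ω (A ×ˢ Iic (min (t : WithTop ℝ≥0) (τ n ω)).untopA) := by
    intro n t ω
    have h := setLIntegral_indicator_stopped (τ := τ n) hA (C ω) (fun _ => 1) t ω
    rw [setLIntegral_one] at h
    simpa only [mul_one] using h
  have hbeq : ∀ n t ω, b n t ω = Λ (min (t : WithTop ℝ≥0) (τ n ω)).untopA ω := fun n t ω =>
    setLIntegral_indicator_stopped (τ := τ n) hA (ν.prod timeMeasure)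
      (fun z => leftIntensity lam C D (ω, z)) t ω
  have ham : ∀ n t, Measurable[ℱ t] (a n t) := fun n t =>
    measurable_setLIntegral_predictable M.poisson.hasFiniteCover M.compatible.adapted (hGi n) t
  have hbm : ∀ n t, Measurable[ℱ t] (b n t) := fun n t => hintm ((hGi n).mul hleft) t
  have hbfin : ∀ n t, ∫⁻ ω, b n t ω ∂P ≠ ∞ := by
    intro n t
    refine ne_top_of_le_ne_top (b := (n : ℝ≥0∞) + 1) (by finiteness) ?_
    calc ∫⁻ ω, b n t ω ∂P ≤ ∫⁻ _, ((n : ℝ≥0∞) + 1) ∂P := by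
          refine lintegral_mono_ae ?_
          filter_upwards [hfin] with ω hω
          rw [hbeq]
          refine (hpath ω).apply_le_of_le_levelTime hω ?_
          have hne : min (t : WithTop ℝ≥0) (τ n ω) ≠ ⊤ :=
            ((min_le_left _ _).trans_lt (WithTop.coe_lt_top t)).ne
          exact ((WithTop.le_untopA_iff hne).1 le_rfl).trans (min_le_right _ _)
      _ = _ := by simp
  have hafin : ∀ n t, ∫⁻ ω, a n t ω ∂P ≠ ∞ := by
    intro n t
    have h := M.setLIntegral_compensation (hGm n) (F := univ) MeasurableSet.univ
      (measurableSet_univ_prod_Iic t)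
      (measurableSet_predictable_prod_zero MeasurableSet.univ (measurableSet_univ_prod_Iic t))
    rw [Measure.restrict_univ] at h
    exact h ▸ hbfin n t
  refine ⟨?_, τ, ⟨⟨hτst, hτtop⟩, ?_⟩, fun n => ?_⟩
  · have hall : ∀ᵐ ω ∂P, ∀ n N : ℕ, a n N ω < ∞ := ae_all_iff.2 fun n => ae_all_iff.2 fun N =>
      ae_lt_top ((ham n N).mono (ℱ.le _) le_rfl) (hafin n N)
    filter_upwards [hall, hτtop] with ω hω htop t
    obtain ⟨N, hN⟩ := exists_nat_ge t
    obtain ⟨n, hn⟩ := (htop.eventually_const_lt (WithTop.coe_lt_top (N : ℝ≥0))).exists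
    have h := hω n N
    rw [haeq, min_eq_left hn.le] at h
    exact (measure_mono (prod_mono_right (Iic_subset_Iic.2 hN))).trans_lt h
  · refine Eventually.of_forall fun ω n n' h => (hpath ω).monotone_levelTime ?_
    gcongr
  · have hpos : ∀ ω, ⊥ < τ n ω := fun ω =>
      (hpath ω).bot_lt_levelTime (lt_of_lt_of_le one_pos le_add_self)
    have heq : stoppedProcess (fun i => {ω | ⊥ < τ n ω}.indicator fun ω =>
        (C ω (A ×ˢ Iic i)).toReal - (Λ i ω).toReal) (τ n) =
        fun t ω => (a n t ω).toReal - (b n t ω).toReal := by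
      funext t ω
      rw [stoppedProcess, indicator_of_mem (by exact hpos ω), haeq, hbeq]
    rw [heq]
    refine martingale_toReal_sub (ham n) (hbm n) (hafin n) (hbfin n) fun s t hst => ?_
    have hUm : MeasurableSet (univ ×ˢ Ioc s t : Set (E × ℝ≥0)) :=
      MeasurableSet.univ.prod measurableSet_Ioc
    have hsplit : ∀ (m : Measure (E × ℝ≥0)) (f : E × ℝ≥0 → ℝ≥0∞),
        ∫⁻ z in univ ×ˢ Iic t, f z ∂m =
          ∫⁻ z in univ ×ˢ Iic s, f z ∂m + ∫⁻ z in univ ×ˢ Ioc s t, f z ∂m := by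
      intro m f
      rw [← Iic_union_Ioc_eq_Iic hst, prod_union, lintegral_union hUm]
      refine Set.disjoint_left.2 fun z hz hz' => ?_
      exact absurd hz'.2.1 (not_lt.2 hz.2)
    refine ⟨fun ω => ∫⁻ z in univ ×ˢ Ioc s t, (G n).indicator 1 (ω, z) ∂C ω,
      fun ω => ∫⁻ z in univ ×ˢ Ioc s t, (G n).indicator 1 (ω, z) * leftIntensity lam C D (ω, z)
        ∂(ν.prod timeMeasure), ?_, ?_, fun ω => hsplit _ _, fun ω => hsplit _ _, fun F hF => ?_⟩
    · exact (M.poisson.hasFiniteCover.restrict _).measurable_lintegral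
        (M.poisson.measurable.restrict_measure hUm) ((hGi n).mono hle le_rfl)
    · exact (hνcover.restrict _).measurable_lintegral measurable_const
        (((hGi n).mul hleft).mono hle le_rfl)
    · exact M.setLIntegral_compensation (hGm n) (ℱ.le s _ hF) hUm
        (measurableSet_predictable_prod hF hUm fun z hz => hz.2.1)

end IsLikelihoodModel

end LocalMartingale
/-! ### Picard iteration -/

/-- Under the product of `n + 1` copies of `v`, the sets where the `i`-th coordinate is strictly the
largest are disjoint and have equal mass, the integral on the left. Strictness allows `v` to have
atoms, at the price of an inequality. -/
theorem succ_mul_lintegral_measure_Iio_pow_le (v : Measure ℝ≥0) [IsFiniteMeasure v] (n : ℕ) :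
    ((n : ℝ≥0∞) + 1) * ∫⁻ r, v (Iio r) ^ n ∂v ≤ v univ ^ (n + 1) := by
  set A : Fin (n + 1) → Set (Fin (n + 1) → ℝ≥0) := fun i => {x | ∀ j, x (i.succAbove j) < x i}
    with hA
  have hAm : ∀ i, MeasurableSet (A i) := fun i => by
    simp only [hA, ofPred_forall]
    exact MeasurableSet.iInter fun j =>
      measurableSet_lt (measurable_pi_apply _) (measurable_pi_apply _)
  have hdisj : Pairwise (Function.onFun Disjoint A) := by
    intro i k hik
    refine Set.disjoint_left.2 fun x hx hx' => ?_
    obtain ⟨a, ha⟩ := Fin.exists_succAbove_eq hik.symm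
    obtain ⟨b, hb⟩ := Fin.exists_succAbove_eq hik
    have h1 := hx a
    have h2 := hx' b
    rw [ha] at h1
    rw [hb] at h2
    exact lt_asymm h1 h2
  have hmeas : ∀ i, Measure.pi (fun _ => v) (A i) = ∫⁻ r, v (Iio r) ^ n ∂v := by
    intro i
    have hmp := measurePreserving_piFinSuccAbove (fun _ : Fin (n + 1) => v) i
    set B : Set (ℝ≥0 × (Fin n → ℝ≥0)) := {p | ∀ j, p.2 j < p.1} with hB
    have hBm : MeasurableSet B := by
      simp only [hB, ofPred_forall]
      exact MeasurableSet.iInter fun j =>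
        measurableSet_lt ((measurable_pi_apply j).comp measurable_snd) measurable_fst
    have hpre : A i = (MeasurableEquiv.piFinSuccAbove (fun _ => ℝ≥0) i) ⁻¹' B := rfl
    rw [hpre, hmp.measure_preimage hBm.nullMeasurableSet, Measure.prod_apply hBm]
    refine lintegral_congr fun r => ?_
    have hsec : Prod.mk r ⁻¹' B = Set.pi univ fun _ : Fin n => Iio r := by
      ext y
      simp [hB]
    rw [hsec, Measure.pi_pi]
    simp
  calc ((n : ℝ≥0∞) + 1) * ∫⁻ r, v (Iio r) ^ n ∂v
      = ∑ i : Fin (n + 1), Measure.pi (fun _ => v) (A i) := by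
        simp [hmeas]
    _ = Measure.pi (fun _ => v) (⋃ i, A i) := by
        rw [measure_iUnion hdisj hAm, tsum_fintype]
    _ ≤ Measure.pi (fun _ => v) univ := measure_mono (subset_univ _)
    _ = v univ ^ (n + 1) := by
        rw [Measure.pi_univ]
        simp

/-- One step of the Picard estimate: it produces the factorial even though `v` may have atoms at the
points of `c`. -/
theorem setLIntegral_measure_Iio_pow_le (v : Measure ℝ≥0) [IsFiniteMeasure v] (n : ℕ) (s : ℝ≥0) :
    ∫⁻ r in Iio s, v (Iio r) ^ n / (n.factorial : ℝ≥0∞) ∂v ≤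
      v (Iio s) ^ (n + 1) / ((n + 1).factorial : ℝ≥0∞) := by
  have h := succ_mul_lintegral_measure_Iio_pow_le (v.restrict (Iio s)) n
  rw [Measure.restrict_apply_univ, setLIntegral_congr_fun (g := fun r => v (Iio r) ^ n)
    measurableSet_Iio fun r hr => by
      simp only [Measure.restrict_apply measurableSet_Iio]
      rw [inter_eq_left.2 (Iio_subset_Iio (le_of_lt hr))]] at h
  have hn : ((n.factorial : ℕ) : ℝ≥0∞) ≠ 0 := by exact_mod_cast n.factorial_ne_zero
  have hn' : ((n : ℝ≥0∞) + 1) ≠ 0 := by positivity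
  simp only [div_eq_mul_inv]
  rw [lintegral_mul_const', Nat.factorial_succ]
  · push_cast
    rw [ENNReal.mul_inv (.inl hn') (.inr hn), ← mul_assoc]
    gcongr
    rw [← div_eq_mul_inv, ENNReal.le_div_iff_mul_le (.inl hn') (.inl (by finiteness)), mul_comm]
    exact h
  · exact ENNReal.inv_ne_top.2 hn

/-- The Picard iterates of `p(s) = 1 + ∫_{E × [0,s)} ψ(z) p(z₂) d(c - μ)`. -/
noncomputable def picardIterate {E : Type*} [MeasurableSpace E] (c μ : Measure (E × ℝ≥0))
    (ψ : E × ℝ≥0 → ℝ) : ℕ → ℝ≥0 → ℝ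
  | 0 => fun _ => 0
  | n + 1 => fun s => 1 + ((∫ z in univ ×ˢ Iio s, ψ z * picardIterate c μ ψ n z.2 ∂c) -
      ∫ z in univ ×ˢ Iio s, ψ z * picardIterate c μ ψ n z.2 ∂μ)

/-- The Picard approximations of the solution at time `t`. -/
noncomputable def picardApprox {E : Type*} [MeasurableSpace E] (c μ : Measure (E × ℝ≥0))
    (ψ : E × ℝ≥0 → ℝ) (n : ℕ) (t : ℝ≥0) : ℝ :=
  1 + ((∫ z in univ ×ˢ Iic t, ψ z * picardIterate c μ ψ n z.2 ∂c) -
    ∫ z in univ ×ˢ Iic t, ψ z * picardIterate c μ ψ n z.2 ∂μ)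

section Measurability

variable {Ω E : Type*} {𝒢 : MeasurableSpace Ω} [MeasurableSpace E] {C : Ω → Measure (E × ℝ≥0)}
  {μ : Measure (E × ℝ≥0)} {ψ : Ω × E × ℝ≥0 → ℝ}

/-- The σ-algebra on `Ω` is arbitrary, so it can be the one generated by `(C, D)`. Joint
measurability in time is what lets the induction integrate the iterate again. -/
theorem measurable_picardIterate (hC : HasFiniteCover C) (hCm : Measurable C)
    (hμ : HasFiniteCover fun _ : Ω => μ) (hψ : Measurable ψ) (n : ℕ) :
    Measurable fun x : Ω × ℝ≥0 => picardIterate (C x.1) μ (fun z => ψ (x.1, z)) n x.2 := by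
  induction n with
  | zero => exact measurable_const
  | succ n ih =>
    have key : ∀ X : Ω → Measure (E × ℝ≥0), HasFiniteCover X → Measurable X →
        Measurable fun x : Ω × ℝ≥0 => ∫ z in univ ×ˢ Iio x.2,
          ψ (x.1, z) * picardIterate (C x.1) μ (fun z => ψ (x.1, z)) n z.2 ∂X x.1 := by
      intro X hX hXm
      have hX' : HasFiniteCover fun x : Ω × ℝ≥0 => X x.1 := by
        obtain ⟨K, hK, hU, hf⟩ := hX
        exact ⟨K, hK, hU, fun n x => hf n x.1⟩
      have hf : Measurable fun y : (Ω × ℝ≥0) × E × ℝ≥0 =>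
          {y : (Ω × ℝ≥0) × E × ℝ≥0 | y.2.2 < y.1.2}.indicator
            (fun y => ψ (y.1.1, y.2) *
              picardIterate (C y.1.1) μ (fun z => ψ (y.1.1, z)) n y.2.2) y := by
        refine Measurable.indicator ?_ ?_
        · exact (hψ.comp ((measurable_fst.comp measurable_fst).prodMk measurable_snd)).mul
            (ih.comp ((measurable_fst.comp measurable_fst).prodMk
              (measurable_snd.comp measurable_snd)))
        · exact measurableSet_lt (measurable_snd.comp measurable_snd)
            (measurable_snd.comp measurable_fst)
      convert hX'.measurable_integral (hXm.comp measurable_fst) hf using 2 with x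
      rw [← integral_indicator (measurableSet_univ_prod_Iio x.2)]
      refine integral_congr_ae (Eventually.of_forall fun z => ?_)
      beta_reduce
      by_cases hz : z.2 < x.2
      · rw [indicator_of_mem (show z ∈ univ ×ˢ Iio x.2 from ⟨trivial, hz⟩),
          indicator_of_mem (by exact hz)]
      · rw [indicator_of_notMem fun h => hz h.2, indicator_of_notMem (by exact hz)]
    exact ((key C hC hCm).sub (key (fun _ => μ) hμ measurable_const)).const_add 1

theorem measurable_picardApprox (hC : HasFiniteCover C) (hCm : Measurable C)
    (hμ : HasFiniteCover fun _ : Ω => μ) (hψ : Measurable ψ) (n : ℕ) (t : ℝ≥0) :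
    Measurable fun ω => picardApprox (C ω) μ (fun z => ψ (ω, z)) n t := by
  have hf : Measurable fun y : Ω × E × ℝ≥0 =>
      ψ y * picardIterate (C y.1) μ (fun z => ψ (y.1, z)) n y.2.2 :=
    hψ.mul ((measurable_picardIterate hC hCm hμ hψ n).comp
      (measurable_fst.prodMk (measurable_snd.comp measurable_snd)))
  have hS := measurableSet_univ_prod_Iic (E := E) t
  exact (((hC.restrict _).measurable_integral (hCm.restrict_measure hS) hf).sub
    ((hμ.restrict _).measurable_integral measurable_const hf)).const_add 1

end Measurability

/-! ### Convergence of the Picard iterates -/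

section Convergence

variable {E : Type*} [MeasurableSpace E] {c μ : Measure (E × ℝ≥0)} {ψ : E × ℝ≥0 → ℝ}
  {l : ℝ≥0 → ℝ}

theorem enorm_integral_sub_integral_le {S : Type*} [MeasurableSpace S] {c μ : Measure S}
    (f g : S → ℝ) {B : Set S} (hfc : IntegrableOn f B c)
    (hfμ : IntegrableOn f B μ) (hgc : IntegrableOn g B c) (hgμ : IntegrableOn g B μ) :
    ‖((∫ z in B, f z ∂c) - ∫ z in B, f z ∂μ) - ((∫ z in B, g z ∂c) - ∫ z in B, g z ∂μ)‖ₑ ≤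
      ∫⁻ z in B, ‖f z - g z‖ₑ ∂(c + μ) := by
  have h : ((∫ z in B, f z ∂c) - ∫ z in B, f z ∂μ) - ((∫ z in B, g z ∂c) - ∫ z in B, g z ∂μ) =
      (∫ z in B, (f z - g z) ∂c) - ∫ z in B, (f z - g z) ∂μ := by
    rw [integral_sub hfc hgc, integral_sub hfμ hgμ]
    ring
  rw [h, Measure.restrict_add, lintegral_add_measure]
  exact (enorm_sub_le).trans (add_le_add (enorm_integral_le_lintegral_enorm _)
    (enorm_integral_le_lintegral_enorm _))

namespace IsPathIntegral

/-- The Picard iterates converge to the left limits of the solution, at a factorial rate. -/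
theorem enorm_leftLim_sub_picardIterate_le
    (h : IsPathIntegral c μ (fun z => ψ z * Function.leftLim l z.2) l) (hψ : Measurable ψ)
    (hc : c (univ ×ˢ {0}) = 0) (hμ : μ (univ ×ˢ {0}) = 0)
    (hq : ∀ n, Measurable (picardIterate c μ ψ n)) {t : ℝ≥0}
    {v : Measure ℝ≥0} [IsFiniteMeasure v] (hv : v = (((c + μ).restrict (univ ×ˢ Iic t)).withDensity
      fun z => ‖ψ z‖ₑ).map Prod.snd) :
    ∃ B : ℝ≥0∞, B ≠ ∞ ∧ ∀ n, IntegrableOn (fun z => ψ z * picardIterate c μ ψ n z.2)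
      (univ ×ˢ Iic t) (c + μ) ∧ ∀ s ≤ t,
      ‖Function.leftLim l s - picardIterate c μ ψ n s‖ₑ ≤
        B * (v (Iio s) ^ n / (n.factorial : ℝ≥0∞)) := by
  set T : Set (E × ℝ≥0) := univ ×ˢ Iic t
  have hps := h.leftLim_eq hc hμ
  set p := Function.leftLim l
  have hTm : MeasurableSet T := measurableSet_univ_prod_Iic t
  have hint : IntegrableOn (fun z => ψ z * p z.2) T (c + μ) :=
    IntegrableOn.add_measure (h t).1 (h t).2.1
  have hsub : ∀ s ≤ t, (univ ×ˢ Iio s : Set (E × ℝ≥0)) ⊆ T := fun s hs =>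
    prod_mono_right fun r hr => le_trans (le_of_lt hr) hs
  have hvint : ∀ (g : ℝ≥0 → ℝ≥0∞), Measurable g → ∀ U : Set ℝ≥0, MeasurableSet U → U ⊆ Iic t →
      ∫⁻ z in univ ×ˢ U, ‖ψ z‖ₑ * g z.2 ∂(c + μ) = ∫⁻ r in U, g r ∂v := by
    intro g hg U hU hUt
    rw [hv, setLIntegral_map hU hg measurable_snd]
    change _ = ∫⁻ z in Prod.snd ⁻¹' U, (g ∘ Prod.snd) z ∂_
    rw [setLIntegral_withDensity_eq_setLIntegral_mul _ hψ.enorm (hg.comp measurable_snd)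
        (measurable_snd hU), Measure.restrict_restrict (measurable_snd hU)]
    congr 2
    ext z
    simp only [T, mem_prod, mem_univ, true_and, mem_inter_iff, mem_preimage, mem_Iic]
    exact ⟨fun hz => ⟨hz, hUt hz⟩, fun hz => hz.1⟩
  -- This bounds the solution on `[0, t]`, hence the error of the zeroth iterate, which is `0`.
  set B : ℝ≥0∞ := 1 + ∫⁻ z in T, ‖ψ z * p z.2‖ₑ ∂(c + μ) with hB
  have hBtop : B ≠ ∞ := ENNReal.add_ne_top.2 ⟨ENNReal.one_ne_top, hint.2.ne⟩
  have hVm : ∀ n : ℕ, Measurable fun r => B * (v (Iio r) ^ n / (n.factorial : ℝ≥0∞)) := fun n =>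
    ((Monotone.measurable fun a b hab => measure_mono (Iio_subset_Iio hab)).pow_const n
      |>.div_const _).const_mul _
  -- The error bound at stage `n` yields integrability of the iterate, which is needed before the
  -- bound at stage `n + 1` can be stated as a difference of integrals.
  have hpint : ∀ n, (∀ s ≤ t, ‖p s - picardIterate c μ ψ n s‖ₑ ≤
        B * (v (Iio s) ^ n / (n.factorial : ℝ≥0∞))) →
      IntegrableOn (fun z => ψ z * picardIterate c μ ψ n z.2) T (c + μ) := by
    intro n hn
    have hm : AEStronglyMeasurable (fun z => ψ z * picardIterate c μ ψ n z.2)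
        ((c + μ).restrict T) :=
      (hψ.mul ((hq n).comp measurable_snd)).aestronglyMeasurable
    have hd : IntegrableOn (fun z => ψ z * p z.2 - ψ z * picardIterate c μ ψ n z.2) T (c + μ) := by
      refine ⟨hint.1.sub hm, ?_⟩
      calc ∫⁻ z in T, ‖ψ z * p z.2 - ψ z * picardIterate c μ ψ n z.2‖ₑ ∂(c + μ)
          ≤ ∫⁻ z in T, ‖ψ z‖ₑ * (B * (v (Iio z.2) ^ n / (n.factorial : ℝ≥0∞))) ∂(c + μ) := by
            refine setLIntegral_mono' hTm fun z hz => ?_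
            rw [← mul_sub, enorm_mul]
            gcongr
            exact hn _ hz.2
        _ = ∫⁻ r in Iic t, B * (v (Iio r) ^ n / (n.factorial : ℝ≥0∞)) ∂v :=
            hvint _ (hVm n) _ measurableSet_Iic subset_rfl
        _ ≤ ∫⁻ r in Iic t, B * (v univ ^ n / 1) ∂v := by
            gcongr
            · exact subset_univ _
            · exact_mod_cast n.factorial_pos
        _ < ∞ := by
            rw [setLIntegral_const, div_one]
            finiteness
    have := hint.sub hd
    refine this.congr (Eventually.of_forall fun z => ?_)
    simp
  have hind : ∀ n, ∀ s ≤ t, ‖p s - picardIterate c μ ψ n s‖ₑ ≤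
      B * (v (Iio s) ^ n / (n.factorial : ℝ≥0∞)) := by
    intro n
    induction n with
    | zero =>
      intro s hs
      have hle := enorm_integral_sub_integral_le (c := c) (μ := μ) (fun z => ψ z * p z.2)
        (fun _ => 0) ((h t).1.mono_set (hsub s hs)) ((h t).2.1.mono_set (hsub s hs))
        integrableOn_zero integrableOn_zero
      simp only [integral_zero, sub_zero] at hle
      simp only [picardIterate, sub_zero, pow_zero, Nat.factorial_zero, Nat.cast_one, div_one,
        mul_one]
      rw [hps s, hB]
      refine (enorm_add_le _ _).trans (add_le_add (by simp) (hle.trans ?_))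
      exact lintegral_mono_set (hsub s hs)
    | succ n ih =>
      intro s hs
      have hi := (hpint n ih).mono_set (hsub s hs)
      have hic : IntegrableOn (fun z => ψ z * picardIterate c μ ψ n z.2) (univ ×ˢ Iio s) c :=
        hi.mono_measure (Measure.le_add_right le_rfl)
      have hiμ : IntegrableOn (fun z => ψ z * picardIterate c μ ψ n z.2) (univ ×ˢ Iio s) μ :=
        hi.mono_measure (Measure.le_add_left le_rfl)
      have hle := enorm_integral_sub_integral_le (c := c) (μ := μ) (fun z => ψ z * p z.2)
        (fun z => ψ z * picardIterate c μ ψ n z.2) ((h t).1.mono_set (hsub s hs))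
        ((h t).2.1.mono_set (hsub s hs)) hic hiμ
      rw [hps s, picardIterate, add_sub_add_left_eq_sub]
      calc _ ≤ _ := hle
        _ ≤ ∫⁻ z in univ ×ˢ Iio s, ‖ψ z‖ₑ * (B * (v (Iio z.2) ^ n / (n.factorial : ℝ≥0∞)))
            ∂(c + μ) := by
            refine setLIntegral_mono' (measurableSet_univ_prod_Iio s) fun z hz => ?_
            rw [← mul_sub, enorm_mul]
            gcongr
            exact ih _ (hsub s hs hz).2
        _ = ∫⁻ r in Iio s, B * (v (Iio r) ^ n / (n.factorial : ℝ≥0∞)) ∂v :=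
            hvint _ (hVm n) _ measurableSet_Iio fun r hr => le_trans (le_of_lt hr) hs
        _ = B * ∫⁻ r in Iio s, v (Iio r) ^ n / (n.factorial : ℝ≥0∞) ∂v :=
            lintegral_const_mul' _ _ hBtop
        _ ≤ _ := by
            gcongr
            exact setLIntegral_measure_Iio_pow_le v n s
  exact ⟨B, hBtop, fun n => ⟨hpint n (hind n), hind n⟩⟩

theorem tendsto_picardApprox
    (h : IsPathIntegral c μ (fun z => ψ z * Function.leftLim l z.2) l) (hψ : Measurable ψ)
    (hc : c (univ ×ˢ {0}) = 0) (hμ : μ (univ ×ˢ {0}) = 0)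
    (hq : ∀ n, Measurable (picardIterate c μ ψ n)) {t : ℝ≥0}
    (hψc : ∫⁻ z in univ ×ˢ Iic t, ‖ψ z‖ₑ ∂c < ∞) (hψμ : ∫⁻ z in univ ×ˢ Iic t, ‖ψ z‖ₑ ∂μ < ∞) :
    Tendsto (fun n => picardApprox c μ ψ n t) atTop (𝓝 (l t)) := by
  set v : Measure ℝ≥0 := (((c + μ).restrict (univ ×ˢ Iic t)).withDensity
    fun z => ‖ψ z‖ₑ).map Prod.snd with hv
  have hTm := measurableSet_univ_prod_Iic (E := E) t
  have hvu : v univ = ∫⁻ z in univ ×ˢ Iic t, ‖ψ z‖ₑ ∂(c + μ) := by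
    rw [hv, Measure.map_apply measurable_snd MeasurableSet.univ, preimage_univ,
      withDensity_apply _ MeasurableSet.univ, Measure.restrict_univ]
  have hvfin : IsFiniteMeasure v := by
    refine ⟨?_⟩
    rw [hvu, Measure.restrict_add, lintegral_add_measure]
    exact ENNReal.add_lt_top.2 ⟨hψc, hψμ⟩
  obtain ⟨B, hB, hbound⟩ := h.enorm_leftLim_sub_picardIterate_le hψ hc hμ hq hv
  have hlim : Tendsto (fun n : ℕ => B * v univ * (v univ ^ n / (n.factorial : ℝ≥0∞))) atTop
      (𝓝 0) := by
    have h1 := FloorSemiring.tendsto_pow_div_factorial_atTop (v univ).toReal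
    have h2 := (ENNReal.tendsto_ofReal h1)
    rw [ENNReal.ofReal_zero] at h2
    have h3 := ENNReal.Tendsto.const_mul (a := B * v univ) h2 (.inr (by finiteness))
    rw [mul_zero] at h3
    refine h3.congr fun n => ?_
    rw [ENNReal.ofReal_div_of_pos (by positivity), ENNReal.ofReal_pow ENNReal.toReal_nonneg,
      ENNReal.ofReal_toReal (measure_ne_top _ _), ENNReal.ofReal_natCast]
  rw [tendsto_iff_edist_tendsto_0]
  refine tendsto_of_tendsto_of_tendsto_of_le_of_le tendsto_const_nhds hlim (fun _ => zero_le)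
    fun n => ?_
  obtain ⟨hint, hle⟩ := hbound n
  have hsub := enorm_integral_sub_integral_le (c := c) (μ := μ)
    (fun z => ψ z * picardIterate c μ ψ n z.2) (fun z => ψ z * Function.leftLim l z.2)
    (hint.mono_measure (Measure.le_add_right le_rfl))
    (hint.mono_measure (Measure.le_add_left le_rfl)) (h t).1 (h t).2.1
  rw [edist_eq_enorm_sub, (h t).2.2, picardApprox, add_sub_add_left_eq_sub]
  calc _ ≤ _ := hsub
    _ ≤ ∫⁻ z in univ ×ˢ Iic t, B * (v univ ^ n / (n.factorial : ℝ≥0∞)) * ‖ψ z‖ₑ ∂(c + μ) := by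
        refine setLIntegral_mono' hTm fun z hz => ?_
        rw [← mul_sub, enorm_mul, mul_comm, ← enorm_neg, neg_sub]
        gcongr
        refine (hle _ hz.2).trans ?_
        gcongr
        exact subset_univ _
    _ = B * (v univ ^ n / (n.factorial : ℝ≥0∞)) * v univ := by
        rw [lintegral_const_mul _ hψ.enorm, hvu]
    _ = _ := by ring

end IsPathIntegral

end Convergence
/-! ### The density is a functional of `C` and `D` -/

section Density

set_option linter.unusedSectionVars false

variable {Ω E : Type*} {mΩ : MeasurableSpace Ω} [MeasurableSpace E]

/-- Under a constant filtration, predictability reduces to measurability for `𝒢` and the product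
σ-algebra. -/
theorem measurable_intensityRatio_of_measurable {𝒢 : MeasurableSpace Ω}
    {lam : E → ℝ≥0 → ℝ → Measure (E × ℝ≥0) → ℝ≥0}
    (hlam : Measurable (fun z : E × ℝ≥0 × ℝ × Measure (E × ℝ≥0) =>
      lam z.1 z.2.1 z.2.2.1 z.2.2.2)) {lamQ : E → ℝ≥0 → ℝ≥0}
    (hlamQ : Measurable (fun z : E × ℝ≥0 => lamQ z.1 z.2)) {C : Ω → Measure (E × ℝ≥0)}
    {D : ℝ≥0 → Ω → ℝ} (hD : ∀ ω, IsCadlagPath (fun t => D t ω)) (hDm : ∀ t, Measurable[𝒢] (D t))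
    (hCm : Measurable[𝒢] C) : Measurable (intensityRatio lam lamQ C D) := by
  have h := measurable_intensityRatio (ℱ := Filtration.const ℝ≥0 𝒢 le_rfl) hlam hlamQ hD hDm
    fun t => hCm.restrict_measure (measurableSet_univ_prod_Iic t)
  exact h.mono (predictable_le _) le_rfl

namespace IsLikelihoodModel

variable {Q : Measure Ω} [IsProbabilityMeasure Q] {ℱ : Filtration ℝ≥0 mΩ} {ν : Measure E}
  [SigmaFinite ν] {lamQ : E → ℝ≥0 → ℝ≥0} {lam : E → ℝ≥0 → ℝ → Measure (E × ℝ≥0) → ℝ≥0}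
  {C : Ω → Measure (E × ℝ≥0)} {D L : ℝ≥0 → Ω → ℝ} {P : Measure Ω}
  (M : IsLikelihoodModel Q ℱ ν lamQ lam C D L P)
include M

theorem hasFiniteCover : HasFiniteCover C := M.poisson.hasFiniteCover

/-- Split according to the first index at which `L` is below `ε`. That event is known at its time,
so its `P`-mass is the integral of `L < ε` over it. -/
theorem measure_exists_density_lt_le {q : ℕ → ℝ≥0} (hq : Monotone q) (ε : ℝ≥0∞) (n : ℕ) :
    P {ω | ∃ i < n, ENNReal.ofReal (L (q i) ω) < ε} ≤
      ε * Q {ω | ∃ i < n, ENNReal.ofReal (L (q i) ω) < ε} := by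
  set A : ℕ → Set Ω := fun i => {ω | ENNReal.ofReal (L (q i) ω) < ε}
  have hA : ∀ i n, i ≤ n → MeasurableSet[ℱ (q n)] (A i) := fun i n hin =>
    ((M.measurable_density (q i)).mono (ℱ.mono (hq hin)) le_rfl) measurableSet_Iio
  have hF : ∀ n, {ω | ∃ i < n, ENNReal.ofReal (L (q i) ω) < ε} = ⋃ i < n, A i := fun n => by
    ext ω
    simp [A]
  rw [hF n]
  induction n with
  | zero => simp
  | succ n ih =>
    have hm : MeasurableSet[ℱ (q n)] (⋃ i < n, A i) :=
      MeasurableSet.iUnion fun i => MeasurableSet.iUnion fun hi => hA i n hi.le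
    have hd : MeasurableSet[ℱ (q n)] (A n \ ⋃ i < n, A i) := (hA n n le_rfl).diff hm
    have hU : (⋃ i < n + 1, A i) = (⋃ i < n, A i) ∪ (A n \ ⋃ i < n, A i) := by
      rw [union_sdiff_self, biUnion_lt_succ]
    rw [hU, measure_union disjoint_sdiff_right (ℱ.le _ _ hd),
      measure_union disjoint_sdiff_right (ℱ.le _ _ hd), mul_add]
    refine add_le_add ih ?_
    rw [M.measure_eq _ hd, ← setLIntegral_const]
    exact setLIntegral_mono measurable_const fun ω hω => (hω.1 : _ < _).le

theorem measure_exists_dyadic_density_lt_le (t : ℝ≥0) (ε : ℝ≥0∞) :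
    P {ω | ∃ k i : ℕ, ENNReal.ofReal (L (min ((i : ℝ≥0) / 2 ^ k) t) ω) < ε} ≤ ε := by
  have hk : ∀ k : ℕ, P {ω | ∃ i : ℕ, ENNReal.ofReal (L (min ((i : ℝ≥0) / 2 ^ k) t) ω) < ε} ≤ ε := by
    intro k
    have hU : {ω | ∃ i : ℕ, ENNReal.ofReal (L (min ((i : ℝ≥0) / 2 ^ k) t) ω) < ε} =
        ⋃ n : ℕ, {ω | ∃ i < n, ENNReal.ofReal (L (min ((i : ℝ≥0) / 2 ^ k) t) ω) < ε} := by
      ext ω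
      simp only [mem_ofPred_eq, mem_iUnion]
      exact ⟨fun ⟨i, hi⟩ => ⟨i + 1, i, i.lt_succ_self, hi⟩, fun ⟨_, i, _, hi⟩ => ⟨i, hi⟩⟩
    rw [hU, Monotone.measure_iUnion]
    · refine iSup_le fun n => (M.measure_exists_density_lt_le
        (q := fun i : ℕ => min ((i : ℝ≥0) / 2 ^ k) t) (fun i j hij => ?_) ε n).trans
        (mul_le_of_le_one_right' prob_le_one)
      dsimp only
      gcongr
    · exact fun n m hnm ω ⟨i, hi, h⟩ => ⟨i, hi.trans_le hnm, h⟩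
  have hU : {ω | ∃ k i : ℕ, ENNReal.ofReal (L (min ((i : ℝ≥0) / 2 ^ k) t) ω) < ε} =
      ⋃ k : ℕ, {ω | ∃ i : ℕ, ENNReal.ofReal (L (min ((i : ℝ≥0) / 2 ^ k) t) ω) < ε} := by
    ext ω
    simp
  rw [hU, Monotone.measure_iUnion]
  · exact iSup_le hk
  · refine monotone_nat_of_le_succ fun k ω ⟨i, hi⟩ => ⟨2 * i, ?_⟩
    have : ((2 * i : ℕ) : ℝ≥0) / 2 ^ (k + 1) = (i : ℝ≥0) / 2 ^ k := by
      rw [pow_succ']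
      push_cast
      exact mul_div_mul_left _ _ two_ne_zero
    rwa [this]

/-- Where `L(t) ≠ 0`, the path of `L` stays away from `0` on `[0, t]`. -/
theorem ae_exists_pos_le (t : ℝ≥0) : ∀ᵐ ω ∂Q, L t ω ≠ 0 → ∃ ε : ℝ, 0 < ε ∧
    ∀ k i : ℕ, ε ≤ L (min ((i : ℝ≥0) / 2 ^ k) t) ω := by
  set Z : Set Ω := ⋂ m : ℕ, {ω | ∃ k i : ℕ,
    ENNReal.ofReal (L (min ((i : ℝ≥0) / 2 ^ k) t) ω) < ENNReal.ofReal (1 / ((m : ℝ) + 1))} with hZ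
  have hZm : MeasurableSet[ℱ t] Z := by
    refine MeasurableSet.iInter fun m => ?_
    simp only [ofPred_exists]
    exact MeasurableSet.iUnion fun k => MeasurableSet.iUnion fun i =>
      ((M.measurable_density _).mono (ℱ.mono (min_le_right _ _)) le_rfl) measurableSet_Iio
  have hPZ : P Z = 0 := by
    have hlim : Tendsto (fun m : ℕ => ENNReal.ofReal (1 / ((m : ℝ) + 1))) atTop (𝓝 0) := by
      rw [← ENNReal.ofReal_zero]
      exact ENNReal.tendsto_ofReal tendsto_one_div_add_atTop_nhds_zero_nat
    exact le_antisymm (ge_of_tendsto' hlim fun m =>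
      (measure_mono (iInter_subset _ m)).trans (M.measure_exists_dyadic_density_lt_le t _)) zero_le
  -- On `Z` the path comes arbitrarily close to `0`. Since `P Z = 0` and `Z ∈ ℱ t`, the density `L
  -- t` vanishes `Q`-almost everywhere on `Z`.
  rw [M.measure_eq t hZm, setLIntegral_eq_zero_iff (ℱ.le t _ hZm)
    ((M.measurable_density t).mono (ℱ.le t) le_rfl)] at hPZ
  filter_upwards [hPZ, M.ae_forall_nonneg] with ω hω hnn hne
  have hωZ : ω ∉ Z := fun h => hne (le_antisymm (ENNReal.ofReal_eq_zero.1 (hω h)) (hnn t))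
  simp only [hZ, mem_iInter, mem_ofPred_eq, not_forall, not_exists, not_lt] at hωZ
  obtain ⟨m, hm⟩ := hωZ
  exact ⟨1 / ((m : ℝ) + 1), by positivity, fun k i =>
    (ENNReal.ofReal_le_ofReal_iff (hnn _)).1 (hm k i)⟩

/-- The equation makes `(ρ - 1) L(s-)` integrable, and `L(s-) ≥ ε` on `[0, t]` lets the second
factor be divided out. -/
theorem ae_lintegral_ratio_lt_top (t : ℝ≥0) : ∀ᵐ ω ∂Q, L t ω ≠ 0 →
    ∫⁻ z in univ ×ˢ Iic t, ‖(intensityRatio lam lamQ C D (ω, z) : ℝ) - 1‖ₑ ∂C ω < ∞ ∧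
    ∫⁻ z in univ ×ˢ Iic t, ‖(intensityRatio lam lamQ C D (ω, z) : ℝ) - 1‖ₑ
      ∂(meanMeasure ν lamQ) < ∞ := by
  filter_upwards [M.ae_exists_pos_le t, M.ae_isPathIntegral] with ω hω h hne
  obtain ⟨ε, hε, hle⟩ := hω hne
  have hleft : ∀ s ≤ t, ε ≤ Function.leftLim (fun s => L s ω) s := fun s hs =>
    ge_of_tendsto' (h.tendsto_prevGrid s) fun k => by
      have hk := hle k (⌈s * 2 ^ k⌉₊ - 1)
      change ε ≤ L (min (prevGrid k s) t) ω at hk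
      have hs' : prevGrid k s ≤ s := by
        rcases eq_or_ne s 0 with rfl | h0
        · rw [prevGrid_zero]
        · exact (prevGrid_lt k (pos_iff_ne_zero.2 h0)).le
      rwa [min_eq_left (hs'.trans hs)] at hk
  have key : ∀ m : Measure (E × ℝ≥0), IntegrableOn (fun z =>
      ((intensityRatio lam lamQ C D (ω, z) : ℝ) - 1) * Function.leftLim (fun s => L s ω) z.2)
        (univ ×ˢ Iic t) m →
      ∫⁻ z in univ ×ˢ Iic t, ‖(intensityRatio lam lamQ C D (ω, z) : ℝ) - 1‖ₑ ∂m < ∞ := by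
    intro m hm
    have hlt : ∫⁻ z in univ ×ˢ Iic t, ‖(intensityRatio lam lamQ C D (ω, z) : ℝ) - 1‖ₑ *
        ENNReal.ofReal ε ∂m < ∞ := by
      refine lt_of_le_of_lt (setLIntegral_mono' (measurableSet_univ_prod_Iic t) fun z hz => ?_) hm.2
      rw [enorm_mul]
      gcongr
      rw [Real.enorm_eq_ofReal_abs]
      exact ENNReal.ofReal_le_ofReal ((hleft _ hz.2).trans (le_abs_self _))
    rw [lintegral_mul_const' _ _ ENNReal.ofReal_ne_top] at hlt
    exact ENNReal.lt_top_of_mul_ne_top_left hlt.ne (ENNReal.ofReal_pos.2 hε).ne'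
  exact ⟨key _ (h t).1, key _ (h t).2.1⟩

/-- `L(t)` is almost surely a function of `C` and `D`. -/
theorem exists_measurable_ae_eq_density {𝒢 : MeasurableSpace Ω} (hCm : Measurable[𝒢] C)
    (hDm : ∀ t, Measurable[𝒢] (D t)) (t : ℝ≥0) :
    ∃ Φ : Ω → ℝ≥0∞, Measurable[𝒢] Φ ∧ (fun ω => ENNReal.ofReal (L t ω)) =ᵐ[Q] Φ := by
  classical
  set μ := meanMeasure ν lamQ with hμ
  set ψ : Ω × E × ℝ≥0 → ℝ := fun x => (intensityRatio lam lamQ C D x : ℝ) - 1 with hψ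
  have hψm : Measurable[𝒢.prod inferInstance] ψ :=
    (measurable_intensityRatio_of_measurable M.measurable_lam M.measurable_lamQ M.cadlag hDm
      hCm).coe_nnreal_real.sub_const 1
  have hψs : ∀ ω, Measurable fun z => ψ (ω, z) := fun ω =>
    hψm.comp (@measurable_prodMk_left _ _ 𝒢 _ ω)
  have hCc := M.hasFiniteCover
  have hμc : HasFiniteCover fun _ : Ω => μ :=
    ⟨spanningSets μ, measurableSet_spanningSets μ, iUnion_spanningSets μ,
      fun n _ => measure_spanningSets_lt_top μ n⟩
  have hS := measurableSet_univ_prod_Iic (E := E) t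
  -- On `V` the Picard scheme converges almost surely; off `V`, almost surely `L t = 0`. The event
  -- involves only `C` and `D`, so cutting to it preserves `𝒢`-measurability.
  set V : Set Ω := {ω | ∫⁻ z in univ ×ˢ Iic t, ‖ψ (ω, z)‖ₑ ∂C ω < ∞ ∧
    ∫⁻ z in univ ×ˢ Iic t, ‖ψ (ω, z)‖ₑ ∂μ < ∞} with hV
  have hVm : MeasurableSet[𝒢] V := by
    refine MeasurableSet.inter (m := 𝒢) ?_ ?_
    · exact (hCc.restrict _).measurable_lintegral (hCm.restrict_measure hS) hψm.enorm
        measurableSet_Iio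
    · exact (hμc.restrict _).measurable_lintegral measurable_const hψm.enorm measurableSet_Iio
  refine ⟨V.indicator fun ω => limsup (fun n =>
    ENNReal.ofReal (picardApprox (C ω) μ (fun z => ψ (ω, z)) n t)) atTop, ?_, ?_⟩
  · refine Measurable.indicator (Measurable.limsup fun n => ?_) hVm
    exact (measurable_picardApprox hCc hCm hμc hψm n t).ennreal_ofReal
  · filter_upwards [M.ae_lintegral_ratio_lt_top t, M.ae_isPathIntegral, M.ae_slice_zero 0]
      with ω hω h h0
    by_cases hωV : ω ∈ V
    · rw [indicator_of_mem hωV]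
      have hq : ∀ n, Measurable (picardIterate (C ω) μ (fun z => ψ (ω, z)) n) := fun n =>
        (measurable_picardIterate hCc hCm hμc hψm n).comp (@measurable_prodMk_left _ _ 𝒢 _ ω)
      have hlim := h.tendsto_picardApprox (hψs ω) h0 (meanMeasure_slice ν lamQ 0) hq hωV.1 hωV.2
      exact (ENNReal.tendsto_ofReal hlim).limsup_eq.symm
    · rw [indicator_of_notMem hωV]
      have : L t ω = 0 := by
        by_contra hne
        exact hωV (hω hne)
      simp [this]

end IsLikelihoodModel

end Density
/-! ### Independence and law under the new measure -/

section History

variable {E : Type*} [MeasurableSpace E]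

/-- The events that depend on a configuration only through its restriction to a bounded time
interval. -/
def historyCylinders (E : Type*) [MeasurableSpace E] : Set (Set (Measure (E × ℝ≥0))) :=
  {V | ∃ n : ℕ, ∃ U, MeasurableSet U ∧ V = (fun m => m.restrict (univ ×ˢ Iic (n : ℝ≥0))) ⁻¹' U}

theorem measurable_restrict_Iic (t : ℝ≥0) :
    Measurable fun m : Measure (E × ℝ≥0) => m.restrict (univ ×ˢ Iic t) :=
  measurable_id.restrict_measure (measurableSet_univ_prod_Iic t)

theorem exists_eq_preimage_restrict_of_le {n k : ℕ} (hnk : n ≤ k) {U : Set (Measure (E × ℝ≥0))}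
    (hU : MeasurableSet U) : ∃ U', MeasurableSet U' ∧
      (fun m : Measure (E × ℝ≥0) => m.restrict (univ ×ˢ Iic (n : ℝ≥0))) ⁻¹' U =
        (fun m => m.restrict (univ ×ˢ Iic (k : ℝ≥0))) ⁻¹' U' := by
  refine ⟨_, measurable_restrict_Iic (n : ℝ≥0) hU, ?_⟩
  ext m
  have h : (univ ×ˢ Iic (n : ℝ≥0) : Set (E × ℝ≥0)) ⊆ univ ×ˢ Iic (k : ℝ≥0) :=
    prod_mono_right (Iic_subset_Iic.2 (by exact_mod_cast hnk))
  rw [mem_preimage, mem_preimage, mem_preimage,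
    Measure.restrict_restrict (measurableSet_univ_prod_Iic _), inter_eq_left.2 h]

theorem isPiSystem_historyCylinders : IsPiSystem (historyCylinders E) := by
  rintro _ ⟨n, U, hU, rfl⟩ _ ⟨k, U', hU', rfl⟩ -
  obtain ⟨V, hV, h⟩ := exists_eq_preimage_restrict_of_le (le_max_left n k) hU
  obtain ⟨V', hV', h'⟩ := exists_eq_preimage_restrict_of_le (le_max_right n k) hU'
  exact ⟨max n k, V ∩ V', hV.inter hV', by rw [h, h', preimage_inter]⟩

/-- A measure of a set is the supremum of its values on growing time windows, so the bounded
histories determine the whole configuration. -/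
theorem generateFrom_historyCylinders :
    MeasurableSpace.generateFrom (historyCylinders E) =
      (inferInstance : MeasurableSpace (Measure (E × ℝ≥0))) := by
  refine le_antisymm (MeasurableSpace.generateFrom_le ?_) ?_
  · rintro _ ⟨n, U, hU, rfl⟩
    exact measurable_restrict_Iic _ hU
  · set 𝒜 := MeasurableSpace.generateFrom (historyCylinders E)
    have hr : ∀ n : ℕ, @Measurable _ _ 𝒜 Measure.instMeasurableSpace
        fun m : Measure (E × ℝ≥0) => m.restrict (univ ×ˢ Iic (n : ℝ≥0)) :=
      fun n U hU => MeasurableSpace.measurableSet_generateFrom ⟨n, U, hU, rfl⟩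
    have hid : @Measurable (Measure (E × ℝ≥0)) _ 𝒜 Measure.instMeasurableSpace id := by
      refine Measure.measurable_of_measurable_coe _ fun B hB => ?_
      have hsup : (fun m : Measure (E × ℝ≥0) => id m B) =
          fun m => ⨆ n : ℕ, m.restrict (univ ×ˢ Iic (n : ℝ≥0)) B := by
        funext m
        have hU : B = ⋃ n : ℕ, B ∩ univ ×ˢ Iic (n : ℝ≥0) := by
          rw [← inter_iUnion]
          refine (inter_eq_left.2 fun z _ => ?_).symm
          obtain ⟨n, hn⟩ := exists_nat_ge z.2
          exact mem_iUnion.2 ⟨n, trivial, hn⟩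
        conv_lhs => rw [id, hU]
        rw [Monotone.measure_iUnion]
        · simp_rw [Measure.restrict_apply hB]
        · exact fun n k hnk => inter_subset_inter_right _
            (prod_mono_right (Iic_subset_Iic.2 (by exact_mod_cast hnk)))
      rw [hsup]
      exact Measurable.iSup fun n => (Measure.measurable_coe hB).comp (hr n)
    exact fun U hU => hid hU

/-- The whole space, as a spanning sequence of history cylinders for a finite measure. -/
noncomputable def spanningHistoryCylinders (μ : Measure (Measure (E × ℝ≥0))) [IsFiniteMeasure μ] :
    μ.FiniteSpanningSetsIn (historyCylinders E) where
  set _ := univ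
  set_mem _ := ⟨0, univ, MeasurableSet.univ, rfl⟩
  finite _ := measure_lt_top _ _
  spanning := iUnion_const _

end History

section Transfer

variable {Ω S : Type*} [MeasurableSpace Ω] [MeasurableSpace S]

/-- The point process conditions do not mention the probability. The Poisson marginals and the
independence are statements about image measures of the law of `X`. -/
theorem IsPoissonRandomMeasure.of_map_eq {X : Ω → Measure S} {μ : Measure S} {P Q : Measure Ω}
    [IsProbabilityMeasure P] [IsProbabilityMeasure Q] (h : IsPoissonRandomMeasure X μ Q)
    (hPQ : P.map X = Q.map X) : IsPoissonRandomMeasure X μ P := by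
  have hX := h.measurable
  have hmap : ∀ {β : Type _} [MeasurableSpace β] {f : Measure S → β}, Measurable f →
      P.map (fun ω => f (X ω)) = Q.map (fun ω => f (X ω)) := by
    intro β _ f hf
    have h1 := Measure.map_map (μ := P) hf hX
    have h2 := Measure.map_map (μ := Q) hf hX
    rw [hPQ, h2] at h1
    exact h1.symm
  refine ⟨IsPoissonRandomMeasure.toIsPointProcess h, fun B hB hμB => ?_, fun n B hB hd => ?_⟩
  · rw [← h.law B hB hμB]
    exact hmap (Measure.measurable_coe hB)
  · have hm : ∀ i, Measurable fun ω => X ω (B i) := fun i =>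
      (Measure.measurable_coe (hB i)).comp hX
    have hi := h.indep n B hB hd
    rw [iIndepFun_iff_map_fun_eq_pi_map fun i => (hm i).aemeasurable] at hi ⊢
    have h1 := hmap (f := fun m (i : Fin n) => m (B i))
      (measurable_pi_lambda _ fun i => Measure.measurable_coe (hB i))
    have h2 : ∀ i, P.map (fun ω => X ω (B i)) = Q.map (fun ω => X ω (B i)) := fun i =>
      hmap (Measure.measurable_coe (hB i))
    rw [h1, hi]
    simp_rw [h2]

end Transfer

section Independence

set_option linter.unusedSectionVars false

variable {Ω E : Type*} {mΩ : MeasurableSpace Ω} [MeasurableSpace E]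

namespace IsLikelihoodModel

variable {Q : Measure Ω} [IsProbabilityMeasure Q] {ℱ : Filtration ℝ≥0 mΩ} {ν : Measure E}
  [SigmaFinite ν] {lamQ : E → ℝ≥0 → ℝ≥0} {lam : E → ℝ≥0 → ℝ → Measure (E × ℝ≥0) → ℝ≥0}
  {C : Ω → Measure (E × ℝ≥0)} {D L : ℝ≥0 → Ω → ℝ} {P : Measure Ω}
  (M : IsLikelihoodModel Q ℱ ν lamQ lam C D L P)
include M

/-- With `Φ` a version of `L(t)` measurable for `σ(C, D)`, `P(a ∩ b) = E_Q[1_a · 1_b Φ]`. The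
factors are measurable for `N` and for `(C, D)`, so the expectation splits. -/
theorem measure_restrict_inter_eq {N : Ω → Measure (E × ℝ≥0)} (hN : Measurable N)
    (hNℱ : ∀ t, Measurable[ℱ t] fun ω => (N ω).restrict (univ ×ˢ Iic t))
    (hindep : IndepFun N (fun ω => (C ω, fun t => D t ω)) Q) (t : ℝ≥0)
    {U U' : Set (Measure (E × ℝ≥0))} (hU : MeasurableSet U) (hU' : MeasurableSet U') :
    P ((fun ω => (N ω).restrict (univ ×ˢ Iic t)) ⁻¹' U ∩
        (fun ω => (C ω).restrict (univ ×ˢ Iic t)) ⁻¹' U') =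
      Q ((fun ω => (N ω).restrict (univ ×ˢ Iic t)) ⁻¹' U) *
        P ((fun ω => (C ω).restrict (univ ×ˢ Iic t)) ⁻¹' U') := by
  set a := (fun ω => (N ω).restrict (univ ×ˢ Iic t)) ⁻¹' U with ha
  set b := (fun ω => (C ω).restrict (univ ×ˢ Iic t)) ⁻¹' U' with hb
  have hpairΩ : Measurable fun ω => (C ω, fun t => D t ω) :=
    M.poisson.measurable.prodMk
      (measurable_pi_lambda _ fun t => (M.adapted t).mono (ℱ.le t) le_rfl)
  have hNm : Measurable[MeasurableSpace.comap N inferInstance] N := comap_measurable _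
  have ha𝒩 : MeasurableSet[MeasurableSpace.comap N inferInstance] a :=
    (measurable_restrict_Iic t).comp hNm hU
  set 𝒢 : MeasurableSpace Ω :=
    MeasurableSpace.comap (fun ω => (C ω, fun t => D t ω)) inferInstance with h𝒢
  have hpair : Measurable[𝒢] fun ω => (C ω, fun t => D t ω) := comap_measurable _
  have hC𝒢 : Measurable[𝒢] C := measurable_fst.comp hpair
  have hD𝒢 : ∀ t, Measurable[𝒢] (D t) := fun t =>
    (measurable_pi_apply t).comp (measurable_snd.comp hpair)
  have h𝒢le : 𝒢 ≤ mΩ := hpairΩ.comap_le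
  obtain ⟨Φ, hΦ, hae⟩ := M.exists_measurable_ae_eq_density hC𝒢 hD𝒢 t
  have hb𝒢 : MeasurableSet[𝒢] b := (measurable_restrict_Iic t).comp hC𝒢 hU'
  have haℱ : MeasurableSet[ℱ t] a := hNℱ t hU
  have hbℱ : MeasurableSet[ℱ t] b := M.compatible.adapted t hU'
  have haΩ := ℱ.le t _ haℱ
  have hbΩ := ℱ.le t _ hbℱ
  have h1 : ∀ F : Set Ω, MeasurableSet[ℱ t] F → P F = ∫⁻ ω in F, Φ ω ∂Q := fun F hF => by
    rw [M.measure_eq t hF]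
    exact lintegral_congr_ae (ae_restrict_of_ae hae)
  have hind := lintegral_mul_eq_lintegral_mul_lintegral_of_independent_measurableSpace
    hN.comap_le h𝒢le ((IndepFun_iff_Indep _ _ _).1 hindep) (f := a.indicator 1)
    (g := b.indicator Φ) ((measurable_const (a := (1 : ℝ≥0∞))).indicator ha𝒩) (hΦ.indicator hb𝒢)
  rw [h1 _ (haℱ.inter hbℱ), h1 _ hbℱ, ← lintegral_indicator (haΩ.inter hbΩ),
    ← lintegral_indicator hbΩ, ← lintegral_indicator_one haΩ, ← hind]
  refine lintegral_congr fun ω => ?_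
  rw [← indicator_indicator]
  by_cases hω : ω ∈ a
  · rw [indicator_of_mem hω, indicator_of_mem hω, Pi.one_apply, one_mul]
  · rw [indicator_of_notMem hω, indicator_of_notMem hω, zero_mul]

theorem map_prodMk_eq {N : Ω → Measure (E × ℝ≥0)} (hN : Measurable N)
    (hNℱ : ∀ t, Measurable[ℱ t] fun ω => (N ω).restrict (univ ×ˢ Iic t))
    (hindep : IndepFun N (fun ω => (C ω, fun t => D t ω)) Q) :
    (Q.map N).prod (P.map C) = P.map fun ω => (N ω, C ω) := by
  have := M.isProbabilityMeasure
  have hC := M.poisson.measurable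
  have := Measure.isProbabilityMeasure_map (μ := Q) hN.aemeasurable
  have := Measure.isProbabilityMeasure_map (μ := P) hC.aemeasurable
  refine Measure.prod_eq_generateFrom generateFrom_historyCylinders generateFrom_historyCylinders
    isPiSystem_historyCylinders isPiSystem_historyCylinders (spanningHistoryCylinders _)
    (spanningHistoryCylinders _) ?_
  rintro _ ⟨n, U, hU, rfl⟩ _ ⟨k, U', hU', rfl⟩
  obtain ⟨V, hV, h⟩ := exists_eq_preimage_restrict_of_le (le_max_left n k) hU
  obtain ⟨V', hV', h'⟩ := exists_eq_preimage_restrict_of_le (le_max_right n k) hU'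
  rw [h, h', Measure.map_apply (hN.prodMk hC)
    ((measurable_restrict_Iic _ hV).prod (measurable_restrict_Iic _ hV')),
    Measure.map_apply hN (measurable_restrict_Iic _ hV),
    Measure.map_apply hC (measurable_restrict_Iic _ hV')]
  exact M.measure_restrict_inter_eq hN hNℱ hindep _ hV hV'

/-- First marginal of the product form of the joint law. -/
theorem map_eq {N : Ω → Measure (E × ℝ≥0)} (hN : Measurable N)
    (hNℱ : ∀ t, Measurable[ℱ t] fun ω => (N ω).restrict (univ ×ˢ Iic t))
    (hindep : IndepFun N (fun ω => (C ω, fun t => D t ω)) Q) : P.map N = Q.map N := by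
  have := M.isProbabilityMeasure
  have hC := M.poisson.measurable
  have := Measure.isProbabilityMeasure_map (μ := P) hC.aemeasurable
  have h := congrArg (Measure.map Prod.fst) (M.map_prodMk_eq hN hNℱ hindep)
  rw [Measure.map_fst_prod, measure_univ, one_smul, Measure.map_map measurable_fst (hN.prodMk hC)]
    at h
  exact h.symm

theorem indepFun {N : Ω → Measure (E × ℝ≥0)} (hN : Measurable N)
    (hNℱ : ∀ t, Measurable[ℱ t] fun ω => (N ω).restrict (univ ×ˢ Iic t))
    (hindep : IndepFun N (fun ω => (C ω, fun t => D t ω)) Q) : IndepFun N C P := by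
  have := M.isProbabilityMeasure
  rw [indepFun_iff_map_prod_eq_prod_map_map hN.aemeasurable M.poisson.measurable.aemeasurable,
    M.map_eq hN hNℱ hindep]
  exact (M.map_prodMk_eq hN hNℱ hindep).symm

end IsLikelihoodModel

end Independence
-- The theorem
theorem lemma2p2 {Ω E : Type*} {mΩ : MeasurableSpace Ω} [MeasurableSpace E]
    (Q : Measure Ω) [IsProbabilityMeasure Q] (ℱ : Filtration ℝ≥0 mΩ)
    (ν : Measure E) [SigmaFinite ν]
    (γ lamQ : E → ℝ≥0 → ℝ≥0)
    (hγ : Measurable (fun z : E × ℝ≥0 => γ z.1 z.2))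
    (hlamQ : Measurable (fun z : E × ℝ≥0 => lamQ z.1 z.2))
    (lam : E → ℝ≥0 → ℝ → Measure (E × ℝ≥0) → ℝ≥0)
    (hlam : Measurable (fun z : E × ℝ≥0 × ℝ × Measure (E × ℝ≥0) =>
      lam z.1 z.2.1 z.2.2.1 z.2.2.2))
    -- the quotient `λ / λ_Q` is meaningful
    (hratio : ∀ u s x m, lamQ u s = 0 → lam u s x m = 0)
    (N C : Ω → Measure (E × ℝ≥0)) (D : ℝ≥0 → Ω → ℝ)
    (hN : IsPoissonRandomMeasure N (meanMeasure ν γ) Q)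
    (hC : IsPoissonRandomMeasure C (meanMeasure ν lamQ) Q)
    (hD : ∀ ω, IsCadlagPath (fun t => D t ω))
    -- `N` is independent of `C` and `D`
    (hindep : IndepFun N (fun ω => (C ω, fun t => D t ω)) Q)
    (hNℱ : IsCompatible N ℱ Q) (hCℱ : IsCompatible C ℱ Q)
    (hDℱ : ∀ t, Measurable[ℱ t] (D t))
    (L : ℝ≥0 → Ω → ℝ)
    (hL : SolvesLikelihoodEquation ν lam lamQ C D L Q)
    (hLmart : Martingale L ℱ Q)
    (P : Measure Ω)
    -- `dP = L(t) dQ` on `ℱ t`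
    (hP : ∀ t (F : Set Ω), MeasurableSet[ℱ t] F → P.real F = ∫ ω in F, L t ω ∂Q) :
    IsProbabilityMeasure P ∧
    (∀ A : Set E, MeasurableSet A →
      (∀ᵐ ω ∂P, ∀ t, cumulativeIntensity ν lam (C ω) (fun s => D s ω) A t < ∞) →
      (∀ᵐ ω ∂P, ∀ t, C ω (A ×ˢ Iic t) < ∞) ∧
      IsLocalMartingale
        (fun t ω => (C ω (A ×ˢ Iic t)).toReal -
          (cumulativeIntensity ν lam (C ω) (fun s => D s ω) A t).toReal) ℱ P) ∧
    IndepFun N C P ∧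
    IsPoissonRandomMeasure N (meanMeasure ν γ) P := by
  have M : IsLikelihoodModel Q ℱ ν lamQ lam C D L P :=
    { measurable_lamQ := hlamQ
      measurable_lam := hlam
      lam_eq_zero := hratio
      poisson := hC
      cadlag := hD
      compatible := hCℱ
      adapted := hDℱ
      equation := hL
      martingale := hLmart
      density := hP }
  have := M.isProbabilityMeasure
  exact ⟨M.isProbabilityMeasure, fun A hA h => M.isLocalMartingale_compensated hA h,
    M.indepFun hN.measurable hNℱ.adapted hindep,
    hN.of_map_eq (M.map_eq hN.measurable hNℱ.adapted hindep)⟩
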